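/- **Conventions.** Regular expressions over an alphabet $\Sigma$ are built from the characters of $\Sigma$ by concatenation, union and star. The length $m$ of a regular expression $R$ is the number of its characters and operators (nodes of its parse tree), and $L(R)$ is its language. $N(R)$ is the automaton with $2m$ states obtained by Thompson's construction, where every node of the parse tree contributes a new start state $\theta$ and a new accepting state $\phi$: a character $\alpha$ gives an $\alpha$-transition $\theta\to\phi$; $ST$ gives $\epsilon$-transitions $(\theta_{ST},\theta_S),(\phi_S,\theta_T),(\phi_T,\phi_{ST})$; $S|T$ gives $(\theta_{S|T},\theta_S),(\theta_{S|T},\theta_T),(\phi_S,\phi_{S|T}),(\phi_T,\phi_{S|T})$; $S^*$ gives $(\theta_{S^*},\theta_S),(\theta_{S^*},\phi_{S^*}),(\phi_S,\phi_{S^*}),(\phi_S,\theta_S)$. Such automata are called TNFAs. The model is the unit-cost RAM with $w$-bit words (addition, subtraction, multiplication, bitwise operations, shifts, comparisons), read-only input, memory initially zero, and space counted in words of working memory, not counting the input and the constant number of registers. Characters are words. A *simulation data structure* for TNFAs with at most $x$ states over an alphabet consists of programs that, given a regular expression with TNFA $A$ of this kind, preprocess it and then maintain a state-set $S$ of $A$,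 initially empty, under the operations $\mathrm{Move}(\alpha)$, $\alpha\in\Sigma$ (replace $S$ by the set of states reachable from $S$ via a single $\alpha$-transition), $\mathrm{Close}$ (replace $S$ by the set of states reachable from $S$ via zero or more $\epsilon$-transitions), $\mathrm{Member}(q)$ (report whether $q\in S$) and $\mathrm{Insert}(q)$ (replace $S$ by $S\cup\{q\}$). Each copy of it works in a block of memory of its own. **Lemma.** For every constant $c$ there is a constant $C$ such that for all programs $D$ (preprocessing, Move, Close, Member, Insert) there is a program with the following property. Let $R$ be a regular expression of length $m$ over an alphabet $\Sigma$, let $Q$ be a string of length $n$ over $\Sigma$, let $\beta\notin\Sigma$ be a further character and let $0<x<m$. Let $t,s,p$ be functions with $t(x)\ge 1$, $s(x)\ge x$ and $p(x)\ge x$. Suppose that $n<2^w$ and $C\cdot\frac{m\,s(x)}{x}\le 2^w$, so that words can hold $n$ and the addresses of the working memory. If $D$ is, on $w$-bit words, a simulation data structure for all TNFAs with at most $x$ states over $\Sigma\cup\{\beta\}$ that supports each operation in time at most $c\,t(x)$, uses space at most $c\,s(x)$ and preprocessing time at most $c\,p(x)$, then the program, given $R$, $Q$, $x$ and $\beta$,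 decides whether $Q\in L(R)$ in time at most $$C\left(\frac{nm\cdot t(x)}{x}+\frac{m\cdot p(x)}{x}\right)$$ using space at most $C\cdot\frac{m\cdot s(x)}{x}$. -/

import Mathlib

/-! ### Regular expressions and Thompson automata -/

/-- Regular expressions over `α`: characters, concatenation, union and star. -/
inductive Regex (α : Type) : Type where
  | char (a : α) : Regex α
  | cat (S T : Regex α) : Regex α
  | alt (S T : Regex α) : Regex α
  | star (S : Regex α) : Regex α

namespace Regex

/-- The length of a regular expression: the number of its characters and operators, i.e. of the
nodes of its parse tree. -/
def size {α : Type} : Regex α → ℕ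
  | char _ => 1
  | cat S T => S.size + T.size + 1
  | alt S T => S.size + T.size + 1
  | star S => S.size + 1

/-- The set of characters that occur. -/
def chars {α : Type} : Regex α → Set α
  | char a => {a}
  | cat S T => S.chars ∪ T.chars
  | alt S T => S.chars ∪ T.chars
  | star S => S.chars

/-- The language generated by a regular expression. -/
def lang {α : Type} : Regex α → Language α
  | char a => {[a]}
  | cat S T => S.lang * T.lang
  | alt S T => S.lang + T.lang
  | star S => KStar.kstar S.lang

end Regex

/-- A finite automaton with states named by natural numbers, one start and one accepting state;
`edge p l q` says that there is a transition from `p` to `q` with label `l`, `none` being `ε`. -/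
structure FA (α : Type) where
  states : Finset ℕ
  edge : ℕ → Option α → ℕ → Prop
  start : ℕ
  accept : ℕ

namespace FA

/-- The states reachable from `Z` via a single `a`-transition. -/
def move {α : Type} (A : FA α) (Z : Set ℕ) (a : α) : Set ℕ :=
  {q | ∃ p ∈ Z, A.edge p (some a) q}

/-- The states reachable from `Z` via zero or more `ε`-transitions. -/
def close {α : Type} (A : FA α) (Z : Set ℕ) : Set ℕ :=
  {q | ∃ p ∈ Z, Relation.ReflTransGen (fun u v => A.edge u none v) p q}

end FA

namespace Regex

/-- Thompson's construction. The nodes of the parse tree are numbered in postorder, starting with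
`o`, and node `i` contributes the start state `2 * i` and the accepting state `2 * i + 1`. -/
def thompson {α : Type} : Regex α → ℕ → FA α
  | char a, o =>
    { states := {2 * o, 2 * o + 1}
      edge := fun p l q => p = 2 * o ∧ l = some a ∧ q = 2 * o + 1
      start := 2 * o
      accept := 2 * o + 1 }
  | cat S T, o =>
    let A := S.thompson o
    let B := T.thompson (o + S.size)
    let r := o + S.size + T.size
    { states := A.states ∪ B.states ∪ {2 * r, 2 * r + 1}
      edge := fun p l q => A.edge p l q ∨ B.edge p l q ∨
        (l = none ∧ ((p = 2 * r ∧ q = A.start) ∨ (p = A.accept ∧ q = B.start) ∨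
          (p = B.accept ∧ q = 2 * r + 1)))
      start := 2 * r
      accept := 2 * r + 1 }
  | alt S T, o =>
    let A := S.thompson o
    let B := T.thompson (o + S.size)
    let r := o + S.size + T.size
    { states := A.states ∪ B.states ∪ {2 * r, 2 * r + 1}
      edge := fun p l q => A.edge p l q ∨ B.edge p l q ∨
        (l = none ∧ ((p = 2 * r ∧ q = A.start) ∨ (p = 2 * r ∧ q = B.start) ∨
          (p = A.accept ∧ q = 2 * r + 1) ∨ (p = B.accept ∧ q = 2 * r + 1)))
      start := 2 * r
      accept := 2 * r + 1 }
  | star S, o =>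
    let A := S.thompson o
    let r := o + S.size
    { states := A.states ∪ {2 * r, 2 * r + 1}
      edge := fun p l q => A.edge p l q ∨
        (l = none ∧ ((p = 2 * r ∧ q = A.start) ∨ (p = 2 * r ∧ q = 2 * r + 1) ∨
          (p = A.accept ∧ q = 2 * r + 1) ∨ (p = A.accept ∧ q = A.start)))
      start := 2 * r
      accept := 2 * r + 1 }

/-- The TNFA `N(R)`. -/
def tnfa {α : Type} (R : Regex α) : FA α := R.thompson 0

/-- The symbols of a regular expression in postfix order, two words per symbol: a tag (`0` for a
character, `1` for concatenation, `2` for union, `3` for star), and the character (`0` for an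
operator). Position `i` of this sequence describes node `i` of `thompson`. -/
def code {w : ℕ} : Regex (BitVec w) → List (BitVec w)
  | char a => [0, a]
  | cat S T => S.code ++ T.code ++ [BitVec.ofNat w 1, 0]
  | alt S T => S.code ++ T.code ++ [BitVec.ofNat w 2, 0]
  | star S => S.code ++ [BitVec.ofNat w 3, 0]

end Regex

/-! ### The unit-cost word RAM -/

namespace WordRAM

/-- The arithmetic, bitwise, shift and (unsigned) comparison instructions. -/
inductive BinOp : Type where
  | add | sub | mul | and | or | xor | shl | shr | eq | lt

/-- The effect of an instruction on `w`-bit words. -/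
def BinOp.eval {w : ℕ} : BinOp → BitVec w → BitVec w → BitVec w
  | add, a, b => a + b
  | sub, a, b => a - b
  | mul, a, b => a * b
  | and, a, b => a &&& b
  | or, a, b => a ||| b
  | xor, a, b => a ^^^ b
  | shl, a, b => a <<< b.toNat
  | shr, a, b => a >>> b.toNat
  | eq, a, b => if a = b then BitVec.ofNat w 1 else 0
  | lt, a, b => if a.toNat < b.toNat then BitVec.ofNat w 1 else 0

/-- Programs. The numbers `r`, `a`, `b`, `i` are names of registers. A program does not depend on
the word length. -/
inductive Cmd : Type where
  | skip : Cmd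
  /-- `r := k` -/
  | const (r k : ℕ) : Cmd
  /-- `r := a op b` -/
  | bin (op : BinOp) (r a b : ℕ) : Cmd
  /-- `r := mem[a]` -/
  | load (r a : ℕ) : Cmd
  /-- `mem[a] := r` -/
  | store (a r : ℕ) : Cmd
  /-- `r :=` entry number `i` of the read-only input array `k` -/
  | input (k r i : ℕ) : Cmd
  | seq (c d : Cmd) : Cmd
  /-- if `r ≠ 0` then `c` else `d` -/
  | ite (r : ℕ) (c d : Cmd) : Cmd
  /-- while `r ≠ 0` do `c` -/
  | loop (r : ℕ) (c : Cmd) : Cmd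

/-- Contents of the registers and of the working memory. A program names finitely many registers. -/
structure State (w : ℕ) where
  reg : ℕ → BitVec w
  mem : BitVec w → BitVec w

/-- `σ` with register `r` set to `v`. -/
def State.setReg {w : ℕ} (σ : State w) (r : ℕ) (v : BitVec w) : State w :=
  { σ with reg := Function.update σ.reg r v }

/-- `σ` with memory cell `a` set to `v`. -/
def State.setMem {w : ℕ} (σ : State w) (a v : BitVec w) : State w :=
  { σ with mem := Function.update σ.mem a v }

/-- `Exec inp M c σ k τ`: on the read-only input arrays `inp`, the program `c` started in state `σ`
halts in state `τ` after `k` steps, and every access to the working memory is to a cell in `M`. -/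
inductive Exec {w : ℕ} (inp : ℕ → List (BitVec w)) (M : Set (BitVec w)) :
    Cmd → State w → ℕ → State w → Prop where
  | skip (σ : State w) : Exec inp M .skip σ 1 σ
  | const (σ : State w) (r k : ℕ) :
      Exec inp M (.const r k) σ 1 (σ.setReg r (BitVec.ofNat w k))
  | bin (σ : State w) (op : BinOp) (r a b : ℕ) :
      Exec inp M (.bin op r a b) σ 1 (σ.setReg r (op.eval (σ.reg a) (σ.reg b)))
  | load (σ : State w) (r a : ℕ) (h : σ.reg a ∈ M) :
      Exec inp M (.load r a) σ 1 (σ.setReg r (σ.mem (σ.reg a)))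
  | store (σ : State w) (a r : ℕ) (h : σ.reg a ∈ M) :
      Exec inp M (.store a r) σ 1 (σ.setMem (σ.reg a) (σ.reg r))
  | input (σ : State w) (k r i : ℕ) :
      Exec inp M (.input k r i) σ 1 (σ.setReg r ((inp k).getD (σ.reg i).toNat 0))
  | seq {c d : Cmd} {σ τ υ : State w} {k l : ℕ}
      (h : Exec inp M c σ k τ) (h' : Exec inp M d τ l υ) :
      Exec inp M (.seq c d) σ (k + l) υ
  | iteTrue {r : ℕ} {c d : Cmd} {σ τ : State w} {k : ℕ}
      (hr : σ.reg r ≠ 0) (h : Exec inp M c σ k τ) : Exec inp M (.ite r c d) σ (k + 1) τ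
  | iteFalse {r : ℕ} {c d : Cmd} {σ τ : State w} {k : ℕ}
      (hr : σ.reg r = 0) (h : Exec inp M d σ k τ) : Exec inp M (.ite r c d) σ (k + 1) τ
  | loopDone {r : ℕ} {c : Cmd} {σ : State w} (hr : σ.reg r = 0) :
      Exec inp M (.loop r c) σ 1 σ
  | loopStep {r : ℕ} {c : Cmd} {σ τ υ : State w} {k l : ℕ}
      (hr : σ.reg r ≠ 0) (h : Exec inp M c σ k τ) (h' : Exec inp M (.loop r c) τ l υ) :
      Exec inp M (.loop r c) σ (k + l + 1) υ

/-- The memory cells with addresses in `[lo, hi)`. -/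
def block (w lo hi : ℕ) : Set (BitVec w) := {a | lo ≤ a.toNat ∧ a.toNat < hi}

end WordRAM

/-! ### Simulation data structures -/

open WordRAM in
/-- The programs of a simulation data structure: preprocessing and the four operations. -/
structure SimDS where
  pre : Cmd
  move : Cmd
  close : Cmd
  member : Cmd
  insert : Cmd

open WordRAM in
/-- `D.Supports w x Sig β t s p`: on a word RAM with `w`-bit words, `D` is a simulation data
structure for all TNFAs with at most `x` states over the alphabet `Sig ∪ {β}`, with time at most `t`
for each operation, space at most `s` and preprocessing time at most `p`.

A copy of the data structure maintains one TNFA `A = N(R)` and a state-set of `A`, initially empty,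
in a block of memory cells `[b, e)` of its own, which is all the memory its programs access.
`Rep R b e Z mem` says that the block holds the data structure for `N(R)` with state-set `Z`.

* Preprocessing finds the code of `R` at the beginning of a block of fresh (zero) cells, and
  `b`, the length of `R`, `x` and `β` in registers `0`, `1`, `2` and `3`. It returns `e` in
  register `0`.
* The operations find `b` in register `0`, and their argument (a character or a state) in
  register `1`. The answer of `member` is yes iff register `0` is nonzero in the end.

Registers that hold no argument have arbitrary contents when a program starts, and all registers
may be overwritten. -/
def SimDS.Supports (D : SimDS) (w x : ℕ) (Sig : Set (BitVec w)) (β : BitVec w)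
    (t s p : ℝ) : Prop :=
  ∃ B : ℕ, (B : ℝ) ≤ s ∧
  ∃ Rep : Regex (BitVec w) → ℕ → ℕ → Set ℕ → (BitVec w → BitVec w) → Prop,
    -- representation depends on the cells of the block only
    (∀ R b e Z mem mem', (∀ a ∈ block w b e, mem a = mem' a) →
      Rep R b e Z mem → Rep R b e Z mem') ∧
    ∀ (inp : ℕ → List (BitVec w)) (R : Regex (BitVec w)) (b : ℕ) (σ : State w),
      R.chars ⊆ Sig ∪ {β} → R.tnfa.states.card ≤ x → σ.reg 0 = BitVec.ofNat w b →
      -- preprocessing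
      (b + B < 2 ^ w → σ.reg 1 = BitVec.ofNat w R.size → σ.reg 2 = BitVec.ofNat w x →
        σ.reg 3 = β →
        (∀ i < R.code.length, σ.mem (BitVec.ofNat w (b + i)) = R.code.getD i 0) →
        (∀ a ∈ block w (b + R.code.length) (b + B), σ.mem a = 0) →
        ∃ (k e : ℕ) (τ : State w), (k : ℝ) ≤ p ∧ b + R.code.length ≤ e ∧ e ≤ b + B ∧
          Exec inp (block w b e) D.pre σ k τ ∧ τ.reg 0 = BitVec.ofNat w e ∧
          Rep R b e ∅ τ.mem) ∧
      -- operations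
      ∀ (e : ℕ) (Z : Set ℕ), Z ⊆ (R.tnfa.states : Set ℕ) → Rep R b e Z σ.mem →
        (∀ a ∈ Sig, σ.reg 1 = a →
          ∃ (k : ℕ) (τ : State w), (k : ℝ) ≤ t ∧ Exec inp (block w b e) D.move σ k τ ∧
            Rep R b e (R.tnfa.move Z a) τ.mem) ∧
        (∃ (k : ℕ) (τ : State w), (k : ℝ) ≤ t ∧ Exec inp (block w b e) D.close σ k τ ∧
            Rep R b e (R.tnfa.close Z) τ.mem) ∧
        (∀ q ∈ R.tnfa.states, σ.reg 1 = BitVec.ofNat w q →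
          ∃ (k : ℕ) (τ : State w), (k : ℝ) ≤ t ∧ Exec inp (block w b e) D.member σ k τ ∧
            (τ.reg 0 ≠ 0 ↔ q ∈ Z) ∧ Rep R b e Z τ.mem) ∧
        (∀ q ∈ R.tnfa.states, σ.reg 1 = BitVec.ofNat w q →
          ∃ (k : ℕ) (τ : State w), (k : ℝ) ≤ t ∧ Exec inp (block w b e) D.insert σ k τ ∧
            Rep R b e (Z ∪ {q}) τ.mem)

/-! ### Regular expression matching -/

namespace WordRAM

/-- The read-only input: array `0` is the code of `R`, array `1` is the string `Q`. -/
def matchInput {w : ℕ} (R : Regex (BitVec w)) (Q : List (BitVec w)) : ℕ → List (BitVec w)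
  | 0 => R.code
  | 1 => Q
  | _ => []

/-- The initial state: the lengths of `R` and `Q`, the parameter `x` and the character `β` are in
registers `0`, `1`, `2` and `3`; everything else is zero. -/
def matchInit {w : ℕ} (R : Regex (BitVec w)) (Q : List (BitVec w)) (x : ℕ) (β : BitVec w) :
    State w where
  reg
    | 0 => BitVec.ofNat w R.size
    | 1 => BitVec.ofNat w Q.length
    | 2 => BitVec.ofNat w x
    | 3 => β
    | _ => 0
  mem := fun _ => 0

/-- The program `c`, run with parameters `x` and `β`, decides whether `Q` matches `R` (the answer is
yes iff register `0` is nonzero in the end) in time at most `t`, using at most `s` words of working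
memory. -/
def SolvesMatching {w : ℕ} (c : Cmd) (R : Regex (BitVec w)) (Q : List (BitVec w)) (x : ℕ)
    (β : BitVec w) (t s : ℝ) : Prop :=
  ∃ (k S : ℕ) (τ : State w), (k : ℝ) ≤ t ∧ (S : ℝ) ≤ s ∧
    Exec (matchInput R Q) (block w 0 S) c (matchInit R Q x β) k τ ∧
    (τ.reg 0 ≠ 0 ↔ Q ∈ R.lang)

end WordRAM

/-! Partition. Bottom up, a subexpression is cut out once what is left of it has at least `y = (x +
2) / 4` nodes, and a stub of one or two nodes takes its place (`Regex.split`). A part has fewer than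
`2 * y` nodes, hence at most `x` states; a cut removes at least `y - 2` nodes in net, so there are
`O(m / x)` parts (`Regex.size_split`). Each part gets its own copy of the data structure `D`.

Simulation. The stub of a hole is `β`, or `β*` if the expression cut out matches the empty word. As
`β` is never read, a stub is not crossed by reading; instead its entry state is linked to the start
state of the child, and the accepting state of the child to the exit state of the stub. A character
is read by one Move in every part. The closure under all `ε`-transitions and links takes two passes.
The upward pass closes each part and passes on to its parent that it has been matched; the downward
pass starts each part whose parent holds its entry state, and closes it again. The second pass may
reach further accepting states, but only if `ε`-transitions lead from the start state of the child
to its accepting state. Then the child matches the empty word, its stub has an `ε`-transition from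
entry to exit, and the parent holds the exit state already (`Cut.Layout.DownTo.step`). So a
character costs `O(m / x)` operations.

Correctness. No automaton for the whole expression is formed. For soundness, `Cut.pre` attaches to
every state of a part the words that lead to it; transitions respect these languages
(`Cut.pre_edge`), and so do links (`Cut.Layout.pre_ent`). For completeness, induction on a
subexpression shows that a matching word leads from its start state to its accepting state through
any closed state-sets that contain the moves (`Cut.Layout.path`). Both are combined in
`Cut.Layout.mem_lang_iff`.

Exceptions. For the empty string the bound leaves no room for the operations, and nullability
decides. For `x < 10` the stubs would be too large in comparison with the parts; then time `O(m)`
per character is affordable, and a direct simulation records at every subexpression whether the word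
read so far ends with a nonempty match of it (`WordRAM.direct_spec`).

Program. Structured programs are compiled to the RAM and verified by weakest preconditions over
stores with a clock (`Prog.wp_comp`). Variables live in registers beyond those that `D` writes, and
the parts in disjoint blocks, so that calls of `D` do not interfere (`Wp.callC`, `Setup.Live.call`).
One scan in postorder with a stack of symbols computes the partition; as a symbol is copied at most
once, the time amortises (`Setup.split_loop`). -/

namespace WordRAM

/-! ### Registers and memory cells that a program leaves alone -/

theorem Exec.mono {w : ℕ} {inp : ℕ → List (BitVec w)} {M M' : Set (BitVec w)} (hM : M ⊆ M')
    {c : Cmd} {σ τ : State w} {k : ℕ} (h : Exec inp M c σ k τ) : Exec inp M' c σ k τ := by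
  induction h with
  | skip => exact .skip _
  | const => exact .const ..
  | bin => exact .bin ..
  | load _ _ _ h => exact .load _ _ _ (hM h)
  | store _ _ _ h => exact .store _ _ _ (hM h)
  | input => exact .input ..
  | seq _ _ ih ih' => exact .seq ih ih'
  | iteTrue hr _ ih => exact .iteTrue hr ih
  | iteFalse hr _ ih => exact .iteFalse hr ih
  | loopDone hr => exact .loopDone hr
  | loopStep hr _ _ ih ih' => exact .loopStep hr ih ih'

/-- A strict upper bound on the registers that a program writes. -/
def Cmd.regBound : Cmd → ℕ
  | skip => 0
  | const r _ => r + 1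
  | bin _ r _ _ => r + 1
  | load r _ => r + 1
  | store _ _ => 0
  | input _ r _ => r + 1
  | seq c d => max c.regBound d.regBound
  | ite _ c d => max c.regBound d.regBound
  | loop _ c => c.regBound

/-- Variables in registers beyond the bounds of the programs of `D` survive every call of them. -/
theorem Exec.reg_eq {w : ℕ} {inp : ℕ → List (BitVec w)} {M : Set (BitVec w)}
    {c : Cmd} {σ τ : State w} {k : ℕ} (h : Exec inp M c σ k τ) {r : ℕ} (hr : c.regBound ≤ r) :
    τ.reg r = σ.reg r := by
  induction h with
  | skip => rfl
  | store => rfl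
  | const | bin | load | input =>
    simp only [Cmd.regBound] at hr
    exact Function.update_of_ne (by omega) _ _
  | seq _ _ ih ih' =>
    simp only [Cmd.regBound, max_le_iff] at hr
    rw [ih' hr.2, ih hr.1]
  | iteTrue _ _ ih => simp only [Cmd.regBound, max_le_iff] at hr; exact ih hr.1
  | iteFalse _ _ ih => simp only [Cmd.regBound, max_le_iff] at hr; exact ih hr.2
  | loopDone => rfl
  | loopStep _ _ _ ih ih' => rw [ih' hr, ih hr]

/-- A program confined to one block leaves the arrays and the blocks of the other parts alone. -/
theorem Exec.mem_eq {w : ℕ} {inp : ℕ → List (BitVec w)} {M : Set (BitVec w)}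
    {c : Cmd} {σ τ : State w} {k : ℕ} (h : Exec inp M c σ k τ) {a : BitVec w} (ha : a ∉ M) :
    τ.mem a = σ.mem a := by
  induction h with
  | store _ _ _ h => exact Function.update_of_ne (by rintro rfl; exact ha h) _ _
  | seq _ _ ih ih' => rw [ih', ih]
  | loopStep _ _ _ ih ih' => rw [ih', ih]
  | iteTrue _ _ ih => exact ih
  | iteFalse _ _ ih => exact ih
  | _ => rfl

/-! ### Structured states

A program of ours keeps `64` variables in the registers from `r` on, sixteen arrays with indices
below `N` interleaved in the first `16 * N` memory cells, and data of the simulation data structures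
in the remaining memory. Expressions are evaluated in the registers from `r + 64` on. -/

/-- The setting of a computation: input, first register in use, size of the arrays and of the
working memory. -/
structure Env (w : ℕ) where
  inp : ℕ → List (BitVec w)
  r : ℕ
  N : ℕ
  S : ℕ
  arrays_le : 16 * N ≤ S
  space_le : S ≤ 2 ^ w

/-- Variables, arrays, the remaining memory, and the time used so far. -/
structure Store (w : ℕ) where
  v : ℕ → ℕ
  a : ℕ → ℕ → ℕ
  m : BitVec w → BitVec w
  clk : ℕ

namespace Store

/-- Let time pass. -/
def tick {w : ℕ} (h : Store w) (k : ℕ) : Store w := { h with clk := h.clk + k }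

/-- Set a variable. -/
def setV {w : ℕ} (h : Store w) (i x : ℕ) : Store w := { h with v := Function.update h.v i x }

/-- Set an array entry. -/
def setA {w : ℕ} (h : Store w) (k i x : ℕ) : Store w :=
  { h with a := Function.update h.a k (Function.update (h.a k) i x) }

/-- Set a cell of the remaining memory. -/
def setM {w : ℕ} (h : Store w) (i x : ℕ) : Store w :=
  { h with m := Function.update h.m (BitVec.ofNat w i) (BitVec.ofNat w x) }

section
variable {w : ℕ} (h : Store w) (i k x : ℕ)
@[simp] theorem tick_v : (h.tick k).v = h.v := rfl
@[simp] theorem tick_a : (h.tick k).a = h.a := rfl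
@[simp] theorem tick_m : (h.tick k).m = h.m := rfl
@[simp] theorem tick_clk : (h.tick k).clk = h.clk + k := rfl
@[simp] theorem setV_v : (h.setV i x).v = Function.update h.v i x := rfl
@[simp] theorem setV_a : (h.setV i x).a = h.a := rfl
@[simp] theorem setV_m : (h.setV i x).m = h.m := rfl
@[simp] theorem setV_clk : (h.setV i x).clk = h.clk := rfl
@[simp] theorem setA_v : (h.setA k i x).v = h.v := rfl
@[simp] theorem setA_a :
    (h.setA k i x).a = Function.update h.a k (Function.update (h.a k) i x) := rfl
@[simp] theorem setA_m : (h.setA k i x).m = h.m := rfl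
@[simp] theorem setA_clk : (h.setA k i x).clk = h.clk := rfl
@[simp] theorem setM_v : (h.setM i x).v = h.v := rfl
@[simp] theorem setM_a : (h.setM i x).a = h.a := rfl
@[simp] theorem setM_m :
    (h.setM i x).m = Function.update h.m (BitVec.ofNat w i) (BitVec.ofNat w x) := rfl
@[simp] theorem setM_clk : (h.setM i x).clk = h.clk := rfl
end

end Store

/-- The machine state `σ` holds the store `h`. -/
structure Holds {w : ℕ} (E : Env w) (σ : State w) (h : Store w) : Prop where
  var : ∀ i < 64, σ.reg (E.r + i) = BitVec.ofNat w (h.v i)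
  arr : ∀ k < 16, ∀ i < E.N, σ.mem (BitVec.ofNat w (16 * i + k)) = BitVec.ofNat w (h.a k i)
  mem : ∀ x : BitVec w, 16 * E.N ≤ x.toNat → σ.mem x = h.m x

/-! ### Expressions -/

inductive Expr : Type where
  | var (i : ℕ) : Expr
  | nat (k : ℕ) : Expr
  | add (e f : Expr) : Expr
  | sub (e f : Expr) : Expr
  | mul (e f : Expr) : Expr
  | lt (e f : Expr) : Expr
  | eq (e f : Expr) : Expr
  | shr (e f : Expr) : Expr
  | arr (k : ℕ) (e : Expr) : Expr
  | inp (k : ℕ) (e : Expr) : Expr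

namespace Expr

def val {w : ℕ} (E : Env w) (h : Store w) : Expr → ℕ
  | var i => h.v i
  | nat k => k
  | add e f => e.val E h + f.val E h
  | sub e f => e.val E h - f.val E h
  | mul e f => e.val E h * f.val E h
  | lt e f => if e.val E h < f.val E h then 1 else 0
  | eq e f => if e.val E h = f.val E h then 1 else 0
  | shr e f => e.val E h / 2 ^ f.val E h
  | arr k e => h.a k (e.val E h)
  | inp k e => ((E.inp k).getD (e.val E h) 0).toNat

/-- No overflow affects the value of an expression. -/
def Ok {w : ℕ} (E : Env w) (h : Store w) : Expr → Prop
  | var i => i < 64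
  | nat _ => True
  -- Sums and products need no bound, since `BitVec.ofNat` is compatible with them. Overflow matters
  -- only where a value is compared, shifted or used as an index; a difference must not be
  -- truncated.
  | add e f => e.Ok E h ∧ f.Ok E h
  | sub e f => e.Ok E h ∧ f.Ok E h ∧ f.val E h ≤ e.val E h
  | mul e f => e.Ok E h ∧ f.Ok E h
  | lt e f => e.Ok E h ∧ f.Ok E h ∧ e.val E h < 2 ^ w ∧ f.val E h < 2 ^ w
  | eq e f => e.Ok E h ∧ f.Ok E h ∧ e.val E h < 2 ^ w ∧ f.val E h < 2 ^ w
  | shr e f => e.Ok E h ∧ f.Ok E h ∧ e.val E h < 2 ^ w ∧ f.val E h < 2 ^ w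
  | arr k e => e.Ok E h ∧ k < 16 ∧ e.val E h < E.N
  | inp _ e => e.Ok E h ∧ e.val E h < 2 ^ w

def cost : Expr → ℕ
  | var _ => 1
  | nat _ => 1
  | add e f | sub e f | mul e f | lt e f | eq e f | shr e f => e.cost + f.cost + 1
  | arr _ e => e.cost + 5
  | inp _ e => e.cost + 1

/-- Code that computes an expression into register `r + 64 + d`. -/
def comp (r : ℕ) : Expr → ℕ → Cmd
  -- There is no instruction that moves a register; the conjunction of a word with itself does this,
  -- here and below.
  | var i, d => .bin .and (r + 64 + d) (r + i) (r + i)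
  | nat k, d => .const (r + 64 + d) k
  | add e f, d => .seq (e.comp r d) (.seq (f.comp r (d + 1))
      (.bin .add (r + 64 + d) (r + 64 + d) (r + 64 + (d + 1))))
  | sub e f, d => .seq (e.comp r d) (.seq (f.comp r (d + 1))
      (.bin .sub (r + 64 + d) (r + 64 + d) (r + 64 + (d + 1))))
  | mul e f, d => .seq (e.comp r d) (.seq (f.comp r (d + 1))
      (.bin .mul (r + 64 + d) (r + 64 + d) (r + 64 + (d + 1))))
  | lt e f, d => .seq (e.comp r d) (.seq (f.comp r (d + 1))
      (.bin .lt (r + 64 + d) (r + 64 + d) (r + 64 + (d + 1))))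
  | eq e f, d => .seq (e.comp r d) (.seq (f.comp r (d + 1))
      (.bin .eq (r + 64 + d) (r + 64 + d) (r + 64 + (d + 1))))
  | shr e f, d => .seq (e.comp r d) (.seq (f.comp r (d + 1))
      (.bin .shr (r + 64 + d) (r + 64 + d) (r + 64 + (d + 1))))
  | arr k e, d => .seq (e.comp r d) (.seq (.const (r + 64 + (d + 1)) 16)
      (.seq (.bin .mul (r + 64 + d) (r + 64 + (d + 1)) (r + 64 + d))
      (.seq (.const (r + 64 + (d + 1)) k)
      (.seq (.bin .add (r + 64 + d) (r + 64 + d) (r + 64 + (d + 1)))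
        (.load (r + 64 + d) (r + 64 + d))))))
  | inp k e, d => .seq (e.comp r d) (.input k (r + 64 + d) (r + 64 + d))

end Expr

/-- `τ` differs from `σ` at most in the registers from `n` on. -/
def SameBelow {w : ℕ} (n : ℕ) (σ τ : State w) : Prop :=
  (∀ i < n, τ.reg i = σ.reg i) ∧ τ.mem = σ.mem

theorem SameBelow.refl {w : ℕ} (n : ℕ) (σ : State w) : SameBelow n σ σ := ⟨fun _ _ => rfl, rfl⟩

theorem SameBelow.trans {w n n' : ℕ} {σ τ υ : State w} (h : SameBelow n σ τ)
    (h' : SameBelow n' τ υ) (hn : n ≤ n') : SameBelow n σ υ :=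
  ⟨fun i hi => (h'.1 i (by omega)).trans (h.1 i hi), h'.2.trans h.2⟩

theorem SameBelow.setReg {w n r : ℕ} {σ τ : State w} (h : SameBelow n σ τ) (hr : n ≤ r)
    (x : BitVec w) : SameBelow n σ (τ.setReg r x) :=
  ⟨fun i hi => (Function.update_of_ne (by omega) _ _).trans (h.1 i hi), h.2⟩

theorem Holds.of_sameBelow {w : ℕ} {E : Env w} {σ τ : State w} {h : Store w} (H : Holds E σ h)
    {d : ℕ} (hs : SameBelow (E.r + 64 + d) σ τ) : Holds E τ h where
  var i hi := by rw [hs.1 _ (by omega), H.var i hi]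
  arr k hk i hi := by rw [hs.2, H.arr k hk i hi]
  mem x hx := by rw [hs.2, H.mem x hx]

section State
variable {w : ℕ} (σ : State w) (r : ℕ) (x : BitVec w)
@[simp] theorem State.setReg_mem : (σ.setReg r x).mem = σ.mem := rfl
theorem State.setReg_self : (σ.setReg r x).reg r = x := Function.update_self ..
theorem State.setReg_ne {s : ℕ} (h : s ≠ r) : (σ.setReg r x).reg s = σ.reg s :=
  Function.update_of_ne h ..
end State

theorem Exec.cast {w : ℕ} {inp : ℕ → List (BitVec w)} {M : Set (BitVec w)} {c : Cmd}
    {σ τ : State w} {k k' : ℕ} (h : Exec inp M c σ k τ) (hk : k = k') : Exec inp M c σ k' τ :=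
  hk ▸ h

/-- The registers from `E.r + 64` on are used as a stack: the second operand is evaluated one place
higher and leaves the first one intact. -/
theorem Expr.exec_bin {w : ℕ} {E : Env w} {M : Set (BitVec w)} {h : Store w} {ca cb : Cmd}
    {ka kb x y z : ℕ} {op : BinOp} {d : ℕ}
    (ha : ∀ σ, Holds E σ h → ∃ τ, Exec E.inp M ca σ ka τ ∧
      τ.reg (E.r + 64 + d) = BitVec.ofNat w x ∧ SameBelow (E.r + 64 + d) σ τ)
    (hb : ∀ σ, Holds E σ h → ∃ τ, Exec E.inp M cb σ kb τ ∧
      τ.reg (E.r + 64 + (d + 1)) = BitVec.ofNat w y ∧ SameBelow (E.r + 64 + (d + 1)) σ τ)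
    (hz : op.eval (BitVec.ofNat w x) (BitVec.ofNat w y) = BitVec.ofNat w z)
    (σ : State w) (H : Holds E σ h) :
    ∃ τ, Exec E.inp M (.seq ca (.seq cb (.bin op (E.r + 64 + d) (E.r + 64 + d)
      (E.r + 64 + (d + 1))))) σ (ka + kb + 1) τ ∧
      τ.reg (E.r + 64 + d) = BitVec.ofNat w z ∧ SameBelow (E.r + 64 + d) σ τ := by
  obtain ⟨τ, h1, h2, h3⟩ := ha σ H
  obtain ⟨υ, h4, h5, h6⟩ := hb τ (H.of_sameBelow h3)
  refine ⟨_, (h1.seq (h4.seq (.bin ..))).cast (by omega), ?_, ?_⟩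
  · rw [State.setReg_self, h5, h6.1 _ (by omega), h2, hz]
  · exact (h3.trans h6 (by omega)).setReg le_rfl _

end WordRAM

/-! ### Arithmetic of words and correctness of compiled expressions -/

namespace WordRAM

theorem ofNat_sub_ofNat {w a b : ℕ} (h : b ≤ a) :
    BitVec.ofNat w a - BitVec.ofNat w b = BitVec.ofNat w (a - b) := by
  have : BitVec.ofNat w (a - b) + BitVec.ofNat w b = BitVec.ofNat w a := by
    rw [← BitVec.ofNat_add]; congr 1; omega
  rw [← this, BitVec.add_sub_cancel]

theorem toNat_ofNat_of_lt {w a : ℕ} (h : a < 2 ^ w) : (BitVec.ofNat w a).toNat = a := by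
  rw [BitVec.toNat_ofNat, Nat.mod_eq_of_lt h]

theorem ofNat_inj {w a b : ℕ} (ha : a < 2 ^ w) (hb : b < 2 ^ w) :
    BitVec.ofNat w a = BitVec.ofNat w b ↔ a = b :=
  ⟨fun h => by rw [← toNat_ofNat_of_lt ha, h, toNat_ofNat_of_lt hb], fun h => h ▸ rfl⟩

theorem Expr.exec_comp {w : ℕ} (E : Env w) (h : Store w) : ∀ (e : Expr), e.Ok E h →
    ∀ (d : ℕ) (σ : State w), Holds E σ h → ∃ τ,
      Exec E.inp (block w 0 E.S) (e.comp E.r d) σ e.cost τ ∧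
      τ.reg (E.r + 64 + d) = BitVec.ofNat w (e.val E h) ∧ SameBelow (E.r + 64 + d) σ τ
  | var i, ok, d, σ, H => by
    refine ⟨_, .bin .., ?_, (SameBelow.refl _ _).setReg le_rfl _⟩
    rw [State.setReg_self, H.var i ok]; simp [BinOp.eval, val]
  | nat k, _, d, σ, H =>
    ⟨_, .const .., State.setReg_self .., (SameBelow.refl _ _).setReg le_rfl _⟩
  | add e f, ok, d, σ, H =>
    exec_bin (exec_comp E h e ok.1 d) (exec_comp E h f ok.2 (d + 1))
      (by simp [BinOp.eval, val, BitVec.ofNat_add]) σ H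
  | sub e f, ok, d, σ, H =>
    exec_bin (exec_comp E h e ok.1 d) (exec_comp E h f ok.2.1 (d + 1))
      (by simpa [BinOp.eval, val] using ofNat_sub_ofNat ok.2.2) σ H
  | mul e f, ok, d, σ, H =>
    exec_bin (exec_comp E h e ok.1 d) (exec_comp E h f ok.2 (d + 1))
      (by simp [BinOp.eval, val, BitVec.ofNat_mul]) σ H
  | lt e f, ok, d, σ, H =>
    exec_bin (exec_comp E h e ok.1 d) (exec_comp E h f ok.2.1 (d + 1))
      (by
        simp only [BinOp.eval, val, toNat_ofNat_of_lt ok.2.2.1, toNat_ofNat_of_lt ok.2.2.2]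
        split_ifs <;> rfl) σ H
  | eq e f, ok, d, σ, H =>
    exec_bin (exec_comp E h e ok.1 d) (exec_comp E h f ok.2.1 (d + 1))
      (by
        simp only [BinOp.eval, val, ofNat_inj ok.2.2.1 ok.2.2.2]
        split_ifs <;> rfl) σ H
  | shr e f, ok, d, σ, H =>
    exec_bin (exec_comp E h e ok.1 d) (exec_comp E h f ok.2.1 (d + 1))
      (by
        apply BitVec.eq_of_toNat_eq
        rw [BinOp.eval, BitVec.toNat_ushiftRight, toNat_ofNat_of_lt ok.2.2.1,
          toNat_ofNat_of_lt ok.2.2.2, Nat.shiftRight_eq_div_pow, val, toNat_ofNat_of_lt]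
        exact (Nat.div_le_self _ _).trans_lt ok.2.2.1) σ H
  | arr k e, ok, d, σ, H => by
    obtain ⟨τ, h1, h2, h3⟩ := exec_comp E h e ok.1 d σ H
    have hN : 16 * e.val E h + k < E.S := by have := E.arrays_le; have := ok.2; omega
    have key : ∀ υ : State w, υ.reg (E.r + 64 + d) = BitVec.ofNat w (16 * e.val E h + k) →
        υ.reg (E.r + 64 + d) ∈ block w 0 E.S := by
      intro υ hυ
      rw [hυ]
      exact ⟨Nat.zero_le _, by rw [toNat_ofNat_of_lt (hN.trans_le E.space_le)]; exact hN⟩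
    refine ⟨_, (h1.seq <| .seq (.const ..) <| .seq (.bin ..) <| .seq (.const ..) <|
      .seq (.bin ..) <| .load _ _ _ (key _ ?_)), ?_, ?_⟩
    · rw [State.setReg_self, State.setReg_ne _ _ _ (by omega), State.setReg_self,
        State.setReg_self, State.setReg_self, State.setReg_ne _ _ _ (by omega), h2]
      simp only [BinOp.eval]
      rw [← BitVec.ofNat_mul, ← BitVec.ofNat_add]
    · rw [State.setReg_self, State.setReg_self]
      rw [State.setReg_ne (s := E.r + 64 + d) _ (E.r + 64 + (d + 1)) _ (by omega),
        State.setReg_self, h2]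
      simp only [BinOp.eval, State.setReg_mem]
      rw [State.setReg_self, State.setReg_ne _ _ _ (by omega), State.setReg_self,
        ← BitVec.ofNat_mul, ← BitVec.ofNat_add, h3.2]
      exact H.arr k ok.2.1 _ ok.2.2
    · iterate 5 refine SameBelow.setReg ?_ (by omega) _
      exact h3
  | inp k e, ok, d, σ, H => by
    obtain ⟨τ, h1, h2, h3⟩ := exec_comp E h e ok.1 d σ H
    refine ⟨_, h1.seq (.input ..), ?_, h3.setReg le_rfl _⟩
    rw [State.setReg_self, h2, toNat_ofNat_of_lt ok.2]
    simp [val]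

/-! ### Programs -/

/-- Started in `h`, the program halts in a store with `Q`, and the clock there accounts for the time
used. -/
def Wp {w : ℕ} (E : Env w) (c : Cmd) (Q : Store w → Prop) (h : Store w) : Prop :=
  ∀ σ, Holds E σ h → ∃ k τ h', Exec E.inp (block w 0 E.S) c σ k τ ∧ Holds E τ h' ∧
    h.clk + k ≤ h'.clk ∧ Q h'

theorem Wp.mono {w : ℕ} {E : Env w} {c : Cmd} {Q Q' : Store w → Prop} {h : Store w}
    (H : Wp E c Q h) (hQ : ∀ h', Q h' → Q' h') : Wp E c Q' h := by
  intro σ hσ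
  obtain ⟨k, τ, h', h1, h2, h3, h4⟩ := H σ hσ
  exact ⟨k, τ, h', h1, h2, h3, hQ _ h4⟩

theorem Holds.tick {w : ℕ} {E : Env w} {σ : State w} {h : Store w} (H : Holds E σ h) (k : ℕ) :
    Holds E σ (h.tick k) := ⟨H.var, H.arr, H.mem⟩

theorem Wp.seq {w : ℕ} {E : Env w} {c d : Cmd} {Q : Store w → Prop} {h : Store w}
    (H : Wp E c (Wp E d Q) h) : Wp E (.seq c d) Q h := by
  intro σ hσ
  obtain ⟨k, τ, h', h1, h2, h3, h4⟩ := H σ hσ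
  obtain ⟨l, υ, h'', h5, h6, h7, h8⟩ := h4 τ h2
  exact ⟨_, υ, h'', h1.seq h5, h6, by omega, h8⟩

/-- Structured programs. -/
inductive Prog : Type where
  | skip : Prog
  /-- variable `i` becomes `e` -/
  | set (i : ℕ) (e : Expr) : Prog
  /-- entry `e` of array `k` becomes `f` -/
  | put (k : ℕ) (e f : Expr) : Prog
  /-- memory cell `e` becomes `f` -/
  | poke (e f : Expr) : Prog
  | seq (p q : Prog) : Prog
  | ite (e : Expr) (p q : Prog) : Prog
  | raw (c : Cmd) : Prog

infixr:60 ";;" => Prog.seq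

namespace Prog

def comp (r : ℕ) : Prog → Cmd
  | skip => .skip
  | set i e => .seq (e.comp r 0) (.bin .and (r + i) (r + 64 + 0) (r + 64 + 0))
  | put k e f => .seq (e.comp r 0) (.seq (f.comp r 1) (.seq (.const (r + 64 + 2) 16)
      (.seq (.bin .mul (r + 64 + 0) (r + 64 + 2) (r + 64 + 0)) (.seq (.const (r + 64 + 2) k)
      (.seq (.bin .add (r + 64 + 0) (r + 64 + 0) (r + 64 + 2))
        (.store (r + 64 + 0) (r + 64 + 1)))))))
  | poke e f => .seq (e.comp r 0) (.seq (f.comp r 1) (.store (r + 64 + 0) (r + 64 + 1)))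
  | seq p q => .seq (p.comp r) (q.comp r)
  | ite e p q => .seq (e.comp r 0) (.ite (r + 64 + 0) (p.comp r) (q.comp r))
  | raw c => c

/-- Weakest precondition. -/
def wp {w : ℕ} (E : Env w) : Prog → (Store w → Prop) → Store w → Prop
  | skip, Q, h => Q (h.tick 1)
  | set i e, Q, h => i < 64 ∧ e.Ok E h ∧ Q ((h.setV i (e.val E h)).tick (e.cost + 1))
  | put k e f, Q, h => e.Ok E h ∧ f.Ok E h ∧ k < 16 ∧ e.val E h < E.N ∧
      Q ((h.setA k (e.val E h) (f.val E h)).tick (e.cost + f.cost + 5))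
  | poke e f, Q, h => e.Ok E h ∧ f.Ok E h ∧ 16 * E.N ≤ e.val E h ∧ e.val E h < E.S ∧
      Q ((h.setM (e.val E h) (f.val E h)).tick (e.cost + f.cost + 1))
  | seq p q, Q, h => p.wp E (q.wp E Q) h
  | ite e p q, Q, h => e.Ok E h ∧ e.val E h < 2 ^ w ∧
      (e.val E h ≠ 0 → p.wp E Q (h.tick (e.cost + 1))) ∧
      (e.val E h = 0 → q.wp E Q (h.tick (e.cost + 1)))
  | raw c, Q, h => Wp E c Q h

end Prog

theorem ofNat_ne_zero_iff {w a : ℕ} (h : a < 2 ^ w) : BitVec.ofNat w a ≠ 0 ↔ a ≠ 0 := by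
  have := ofNat_inj h (Nat.two_pow_pos w)
  exact this.not

theorem Holds.setV {w : ℕ} {E : Env w} {σ τ : State w} {h : Store w} (H : Holds E σ h) {i x : ℕ}
    (hi : τ.reg (E.r + i) = BitVec.ofNat w x)
    (hv : ∀ j < 64, j ≠ i → τ.reg (E.r + j) = σ.reg (E.r + j)) (hm : τ.mem = σ.mem) :
    Holds E τ (h.setV i x) where
  var j hj := by
    by_cases hji : j = i
    · subst hji; simp [hi]
    · simp [Function.update_of_ne hji, hv j hj hji, H.var j hj]
  arr k hk j hj := by rw [hm, H.arr k hk j hj]; rfl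
  mem x hx := by rw [hm, H.mem x hx]; rfl

/-- With this, verification of straight-line code is a computation of `wp`, which can be left to
`simp`. Only loops and calls, embedded by `raw`, need statements of their own. -/
theorem Prog.wp_comp {w : ℕ} {E : Env w} : ∀ {p : Prog} {Q : Store w → Prop} {h : Store w},
    p.wp E Q h → Wp E (p.comp E.r) Q h
  | skip, Q, h, H, σ, hσ => ⟨1, σ, h.tick 1, .skip _, hσ.tick 1, le_rfl, H⟩
  | set i e, Q, h, ⟨hi, ok, H⟩, σ, hσ => by
    obtain ⟨τ, h1, h2, h3⟩ := e.exec_comp E h ok 0 σ hσ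
    refine ⟨_, _, (h.setV i (e.val E h)).tick (e.cost + 1), h1.seq (.bin ..),
      Holds.tick (hσ.setV ?_ ?_ ?_) _, le_rfl, H⟩
    · rw [State.setReg_self, h2]; simp [BinOp.eval]
    · intro j hj hji
      rw [State.setReg_ne _ _ _ (by omega), h3.1 _ (by omega)]
    · exact h3.2
  | put k e f, Q, h, ⟨oke, okf, hk, hN, H⟩, σ, hσ => by
    obtain ⟨τ, h1, h2, h3⟩ := e.exec_comp E h oke 0 σ hσ
    obtain ⟨υ, h4, h5, h6⟩ := f.exec_comp E h okf 1 τ (hσ.of_sameBelow h3)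
    have hS : 16 * e.val E h + k < E.S := by have := E.arrays_le; omega
    have hw := hS.trans_le E.space_le
    have h7 := h6.1 (E.r + 64 + 0) (by omega)
    set υ' := ((((υ.setReg (E.r + 64 + 2) (BitVec.ofNat w 16)).setReg (E.r + 64 + 0)
      (BitVec.ofNat w 16 * BitVec.ofNat w (e.val E h))).setReg (E.r + 64 + 2)
      (BitVec.ofNat w k)).setReg (E.r + 64 + 0) (BitVec.ofNat w (16 * e.val E h + k))) with hυ
    have ra : υ'.reg (E.r + 64 + 0) = BitVec.ofNat w (16 * e.val E h + k) := State.setReg_self ..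
    have rv : υ'.reg (E.r + 64 + 1) = BitVec.ofNat w (f.val E h) := by
      rw [hυ]
      iterate 4 rw [State.setReg_ne _ _ _ (by omega)]
      exact h5
    have hs : SameBelow (E.r + 64 + 0) σ υ' := by
      iterate 4 refine SameBelow.setReg ?_ (by omega) _
      exact h3.trans h6 (by omega)
    have H' := hσ.of_sameBelow hs
    have hx : Exec E.inp (block w 0 E.S) ((put k e f).comp E.r) σ (e.cost + f.cost + 5)
        (υ'.setMem (υ'.reg (E.r + 64 + 0)) (υ'.reg (E.r + 64 + 1))) := by
      refine Exec.cast (h1.seq (h4.seq (.seq (.const ..) (.seq (l := 3) (k := 1) (τ :=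
        ((υ.setReg (E.r + 64 + 2) (BitVec.ofNat w 16)).setReg (E.r + 64 + 0)
          (BitVec.ofNat w 16 * BitVec.ofNat w (e.val E h)))) ?_ (.seq (.const ..)
          (.seq (l := 1) (k := 1) (τ := υ') ?_ (.store _ _ _ ?_))))))) (by omega)
      · have := Exec.bin (inp := E.inp) (M := block w 0 E.S)
          (υ.setReg (E.r + 64 + 2) (BitVec.ofNat w 16)) .mul (E.r + 64 + 0) (E.r + 64 + 2)
          (E.r + 64 + 0)
        rw [State.setReg_self, State.setReg_ne _ _ _ (by omega), h7, h2] at this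
        exact this
      · have := Exec.bin (inp := E.inp) (M := block w 0 E.S)
          (((υ.setReg (E.r + 64 + 2) (BitVec.ofNat w 16)).setReg (E.r + 64 + 0)
          (BitVec.ofNat w 16 * BitVec.ofNat w (e.val E h))).setReg (E.r + 64 + 2)
          (BitVec.ofNat w k)) .add (E.r + 64 + 0) (E.r + 64 + 0) (E.r + 64 + 2)
        rw [State.setReg_self, State.setReg_ne _ _ _ (by omega), State.setReg_self] at this
        simp only [BinOp.eval] at this
        rw [← BitVec.ofNat_mul, ← BitVec.ofNat_add, BitVec.ofNat_mul] at this
        exact this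
      · rw [ra]
        exact ⟨Nat.zero_le _, by rw [toNat_ofNat_of_lt hw]; exact hS⟩
    refine ⟨_, _, (h.setA k (e.val E h) (f.val E h)).tick (e.cost + f.cost + 5), hx,
      Holds.tick ?_ _, le_rfl, H⟩
    rw [ra, rv]
    refine ⟨H'.var, fun l hl j hj => ?_, fun x hx => ?_⟩
    · have hjw : 16 * j + l < 2 ^ w := by have := E.arrays_le; have := E.space_le; omega
      simp only [State.setMem, Store.setA_a, Function.update_apply, ofNat_inj hjw hw]
      -- As `l, k < 16`, the address `16 * j + l` determines the array and the index.
      by_cases hl' : l = k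
      · subst hl'
        by_cases hj' : j = e.val E h
        · simp [hj']
        · rw [if_neg (by omega), H'.arr l hl j hj]; simp [hj', Function.update_of_ne]
      · rw [if_neg (by omega), H'.arr l hl j hj, if_neg hl']
    · have : x ≠ BitVec.ofNat w (16 * e.val E h + k) := by
        rintro rfl
        rw [toNat_ofNat_of_lt hw] at hx
        omega
      exact (Function.update_of_ne this _ _).trans (H'.mem x hx)
  | poke e f, Q, h, ⟨oke, okf, hN, hS, H⟩, σ, hσ => by
    obtain ⟨τ, h1, h2, h3⟩ := e.exec_comp E h oke 0 σ hσ
    obtain ⟨υ, h4, h5, h6⟩ := f.exec_comp E h okf 1 τ (hσ.of_sameBelow h3)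
    have hw := hS.trans_le E.space_le
    have h7 := (h6.1 (E.r + 64 + 0) (by omega)).trans h2
    have H' := hσ.of_sameBelow (h3.trans h6 (by omega))
    refine ⟨e.cost + f.cost + 1, _, (h.setM (e.val E h) (f.val E h)).tick (e.cost + f.cost + 1),
      (h1.seq (h4.seq (.store _ _ _ ?_))).cast (by omega), Holds.tick ?_ _, le_rfl, H⟩
    · rw [h7]
      exact ⟨Nat.zero_le _, by rw [toNat_ofNat_of_lt hw]; exact hS⟩
    · rw [h7, h5]
      refine ⟨H'.var, fun l hl j hj => ?_, fun x hx => ?_⟩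
      · have hjw : 16 * j + l < 2 ^ w := by have := E.arrays_le; have := E.space_le; omega
        have : BitVec.ofNat w (16 * j + l) ≠ BitVec.ofNat w (e.val E h) := by
          rw [Ne, ofNat_inj hjw hw]; omega
        exact (Function.update_of_ne this _ _).trans (H'.arr l hl j hj)
      · simp only [State.setMem, Store.setM_m, Function.update_apply, H'.mem x hx]
  | seq p q, Q, h, H, σ, hσ =>
    Wp.seq (Wp.mono (wp_comp (p := p) H) fun _ => wp_comp (p := q)) σ hσ
  | ite e p q, Q, h, ⟨ok, hw, H1, H2⟩, σ, hσ => by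
    obtain ⟨τ, h1, h2, h3⟩ := e.exec_comp E h ok 0 σ hσ
    have hτ := (hσ.of_sameBelow h3).tick (e.cost + 1)
    by_cases h0 : e.val E h = 0
    · obtain ⟨k, υ, h', h4, h5, h6, h7⟩ := wp_comp (H2 h0) τ hτ
      refine ⟨_, υ, h', h1.seq (.iteFalse (by rw [h2, h0]; rfl) h4), h5, ?_, h7⟩
      rw [Store.tick_clk] at h6; omega
    · obtain ⟨k, υ, h', h4, h5, h6, h7⟩ := wp_comp (H1 h0) τ hτ
      refine ⟨_, υ, h', h1.seq (.iteTrue (by rw [h2]; exact (ofNat_ne_zero_iff hw).2 h0) h4),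
        h5, ?_, h7⟩
      rw [Store.tick_clk] at h6; omega
  | raw c, Q, h, H, σ, hσ => H σ hσ

theorem Prog.wp_mono {w : ℕ} {E : Env w} : ∀ {p : Prog} {Q Q' : Store w → Prop} {h : Store w},
    p.wp E Q h → (∀ h', Q h' → Q' h') → p.wp E Q' h
  | skip, _, _, _, H, hQ => hQ _ H
  | set _ _, _, _, _, ⟨a, b, H⟩, hQ => ⟨a, b, hQ _ H⟩
  | put _ _ _, _, _, _, ⟨a, b, c, d, H⟩, hQ => ⟨a, b, c, d, hQ _ H⟩
  | poke _ _, _, _, _, ⟨a, b, c, d, H⟩, hQ => ⟨a, b, c, d, hQ _ H⟩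
  | seq p q, _, _, _, H, hQ => wp_mono (p := p) H fun _ H' => wp_mono (p := q) H' hQ
  | ite _ _ _, _, _, _, ⟨a, b, H1, H2⟩, hQ =>
    ⟨a, b, fun h0 => wp_mono (H1 h0) hQ, fun h0 => wp_mono (H2 h0) hQ⟩
  | raw _, _, _, _, H, hQ => Wp.mono H hQ

/-! ### Loops -/

/-- While `e` is nonzero do `p`. -/
def whileC (r : ℕ) (e : Expr) (p : Prog) : Cmd :=
  .seq (e.comp r 0) (.loop (r + 64 + 0) (.seq (p.comp r) (e.comp r 0)))

theorem Wp.whileC_done {w : ℕ} {E : Env w} {e : Expr} {p : Prog} {Q : Store w → Prop}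
    {h : Store w} (ok : e.Ok E h) (h0 : e.val E h = 0) (H : Q (h.tick (e.cost + 1))) :
    Wp E (whileC E.r e p) Q h := by
  intro σ hσ
  obtain ⟨τ, h1, h2, h3⟩ := e.exec_comp E h ok 0 σ hσ
  exact ⟨_, τ, _, h1.seq (.loopDone (by rw [h2, h0]; rfl)), (hσ.of_sameBelow h3).tick _,
    le_rfl, H⟩

theorem Wp.whileC_step {w : ℕ} {E : Env w} {e : Expr} {p : Prog} {Q : Store w → Prop}
    {h : Store w} (ok : e.Ok E h) (hw : e.val E h < 2 ^ w) (h0 : e.val E h ≠ 0)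
    (H : p.wp E (Wp E (whileC E.r e p) Q) (h.tick (e.cost + 1))) :
    Wp E (whileC E.r e p) Q h := by
  intro σ hσ
  obtain ⟨τ, h1, h2, h3⟩ := e.exec_comp E h ok 0 σ hσ
  obtain ⟨k, υ, h', h4, h5, h6, h7⟩ := Prog.wp_comp H τ ((hσ.of_sameBelow h3).tick _)
  obtain ⟨l, υ', h'', h8, h9, h10, h11⟩ := h7 υ h5
  rw [Store.tick_clk] at h6
  -- A run of the remaining loop starts with an evaluation of `e`. This is the end of the present
  -- round of the inner loop, whose body ends with the test.
  cases h8 with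
  | seq ha hb =>
    exact ⟨_, υ', h'', h1.seq (.loopStep (by rw [h2]; exact (ofNat_ne_zero_iff hw).2 h0)
      (h4.seq ha) hb), h9, by omega, h11⟩

/-- `for` loops: the counter is variable `i`, the bound is variable `b`; `I j` is the invariant. -/
theorem Wp.whileC_lt {w : ℕ} {E : Env w} {i b n : ℕ} {p : Prog} {Q : Store w → Prop}
    {I : ℕ → Store w → Prop} {h : Store w} {j : ℕ} (hi : i < 64) (hb : b < 64) (hn : n < 2 ^ w)
    (hj : j ≤ n) (hI : I j h)
    (hv : ∀ j h, I j h → h.v i = j ∧ h.v b = n)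
    -- Four steps are the cost of the test: three for the comparison of two variables and one for
    -- the branch.
    (step : ∀ j < n, ∀ h, I j h → p.wp E (I (j + 1)) (h.tick 4))
    (done : ∀ h, I n h → Q (h.tick 4)) : Wp E (whileC E.r (.lt (.var i) (.var b)) p) Q h := by
  induction hj using Nat.decreasingInduction generalizing h with
  | self =>
    obtain ⟨h1, h2⟩ := hv _ _ hI
    exact whileC_done ⟨hi, hb, by simp [Expr.val, h1, hn], by simp [Expr.val, h2, hn]⟩
      (by simp [Expr.val, h1, h2]) (done h hI)
  | of_succ j hj ih =>
    obtain ⟨h1, h2⟩ := hv _ _ hI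
    have hval : (Expr.lt (.var i) (.var b)).val E h = 1 := by simp [Expr.val, h1, h2, hj]
    refine whileC_step ⟨hi, hb, ?_, ?_⟩ ?_ ?_ (Prog.wp_mono (step j hj h hI) fun h' => ih)
    · simp only [Expr.val, h1]; omega
    · simp [Expr.val, h2, hn]
    · rw [hval]; omega
    · rw [hval]; omega

end WordRAM

namespace WordRAM

/-! ### Calls of foreign programs -/

/-- Run `c` with arguments `e₀, …, e₃` in registers `0, …, 3`, and put register `0` of the result
into variable `i`. -/
def callC (r : ℕ) (c : Cmd) (e₀ e₁ e₂ e₃ : Expr) (i : ℕ) : Cmd :=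
  .seq (e₀.comp r 0) (.seq (e₁.comp r 1) (.seq (e₂.comp r 2) (.seq (e₃.comp r 3)
    (.seq (.bin .and 0 (r + 64 + 0) (r + 64 + 0)) (.seq (.bin .and 1 (r + 64 + 1) (r + 64 + 1))
    (.seq (.bin .and 2 (r + 64 + 2) (r + 64 + 2)) (.seq (.bin .and 3 (r + 64 + 3) (r + 64 + 3))
    (.seq c (.bin .and (r + i) 0 0)))))))))

theorem SameBelow.holds {w : ℕ} {E : Env w} {σ τ : State w} {h : Store w} (H : Holds E σ h)
    (hr : ∀ i < 64, τ.reg (E.r + i) = σ.reg (E.r + i)) (hm : τ.mem = σ.mem) : Holds E τ h where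
  var i hi := by rw [hr i hi, H.var i hi]
  arr k hk i hi := by rw [hm, H.arr k hk i hi]
  mem x hx := by rw [hm, H.mem x hx]

/-- The called program writes registers below `E.r` and cells beyond the arrays only, so all
variables and arrays survive. The clock is advanced by the bound `kb` and not by the time `k` of the
run, which makes the resulting time independent of the run. -/
theorem Wp.callC {w : ℕ} {E : Env w} {c : Cmd} {e₀ e₁ e₂ e₃ : Expr} {i : ℕ} {h : Store w}
    {Q : Store w → Prop} (hc : c.regBound ≤ E.r) (h4 : 4 ≤ E.r)
    (ok₀ : e₀.Ok E h) (ok₁ : e₁.Ok E h) (ok₂ : e₂.Ok E h) (ok₃ : e₃.Ok E h)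
    (H : ∀ σ : State w, σ.reg 0 = BitVec.ofNat w (e₀.val E h) →
      σ.reg 1 = BitVec.ofNat w (e₁.val E h) → σ.reg 2 = BitVec.ofNat w (e₂.val E h) →
      σ.reg 3 = BitVec.ofNat w (e₃.val E h) →
      (∀ x : BitVec w, 16 * E.N ≤ x.toNat → σ.mem x = h.m x) →
      ∃ k kb lo hi τ, k ≤ kb ∧ 16 * E.N ≤ lo ∧ hi ≤ E.S ∧
        Exec E.inp (block w lo hi) c σ k τ ∧
        Q (({ h with m := τ.mem }.setV i (τ.reg 0).toNat).tick
          -- Four moves of arguments and one move of the result make up the summand `5`.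
          (kb + (e₀.cost + e₁.cost + e₂.cost + e₃.cost + 5)))) :
    Wp E (callC E.r c e₀ e₁ e₂ e₃ i) Q h := by
  intro σ hσ
  obtain ⟨σ0, x0, y0, z0⟩ := e₀.exec_comp E h ok₀ 0 σ hσ
  have hσ0 := hσ.of_sameBelow z0
  obtain ⟨σ1, x1, y1, z1⟩ := e₁.exec_comp E h ok₁ 1 σ0 hσ0
  have hσ1 := hσ0.of_sameBelow z1
  obtain ⟨σ2, x2, y2, z2⟩ := e₂.exec_comp E h ok₂ 2 σ1 hσ1
  have hσ2 := hσ1.of_sameBelow z2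
  obtain ⟨σ3, x3, y3, z3⟩ := e₃.exec_comp E h ok₃ 3 σ2 hσ2
  have hσ3 := hσ2.of_sameBelow z3
  have r0 : σ3.reg (E.r + 64 + 0) = BitVec.ofNat w (e₀.val E h) := by
    rw [z3.1 _ (by omega), z2.1 _ (by omega), z1.1 _ (by omega), y0]
  have r1 : σ3.reg (E.r + 64 + 1) = BitVec.ofNat w (e₁.val E h) := by
    rw [z3.1 _ (by omega), z2.1 _ (by omega), y1]
  have r2 : σ3.reg (E.r + 64 + 2) = BitVec.ofNat w (e₂.val E h) := by
    rw [z3.1 _ (by omega), y2]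
  have step : ∀ (υ : State w) (s t : ℕ),
      Exec E.inp (block w 0 E.S) (.bin .and s t t) υ 1 (υ.setReg s (υ.reg t)) := by
    intro υ s t
    have := Exec.bin (inp := E.inp) (M := block w 0 E.S) υ .and s t t
    simpa [BinOp.eval] using this
  set υ := (((σ3.setReg 0 (σ3.reg (E.r + 64 + 0))).setReg 1 (σ3.reg (E.r + 64 + 1))).setReg 2
    (σ3.reg (E.r + 64 + 2))).setReg 3 (σ3.reg (E.r + 64 + 3)) with hυ
  have hreg : ∀ j, 4 ≤ j → υ.reg j = σ3.reg j := by
    intro j hj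
    rw [hυ]
    iterate 4 rw [State.setReg_ne _ _ _ (by omega)]
  have hυh : Holds E υ h := SameBelow.holds hσ3 (fun j _ => hreg _ (by omega)) rfl
  obtain ⟨k, kb, lo, hi', τ, hk, hlo, hhi, hx, hQ⟩ := H υ
    (by rw [hυ, State.setReg_ne _ _ _ (by omega), State.setReg_ne _ _ _ (by omega),
          State.setReg_ne _ _ _ (by omega), State.setReg_self, r0])
    (by rw [hυ, State.setReg_ne _ _ _ (by omega), State.setReg_ne _ _ _ (by omega),
          State.setReg_self, r1])
    (by rw [hυ, State.setReg_ne _ _ _ (by omega), State.setReg_self, r2])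
    (by rw [hυ, State.setReg_self, y3])
    hυh.mem
  have hout : ∀ x : BitVec w, x.toNat < lo → τ.mem x = υ.mem x := fun x hx' =>
    hx.mem_eq fun hm => by have := hm.1; omega
  have hτ : Holds E τ { h with m := τ.mem } := by
    refine ⟨fun j hj => ?_, fun l hl j hj => ?_, fun x _ => rfl⟩
    · rw [hx.reg_eq (by omega), hυh.var j hj]
    · have h5 : 16 * j + l < 2 ^ w := by have := E.arrays_le; have := E.space_le; omega
      rw [hout _ (by rw [toNat_ofNat_of_lt h5]; omega), hυh.arr l hl j hj]
  have hM : block w lo hi' ⊆ block w 0 E.S := fun x hx' => ⟨Nat.zero_le _, hx'.2.trans_le hhi⟩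
  have m0 := step σ3 0 (E.r + 64 + 0)
  have m1 := step (σ3.setReg 0 (σ3.reg (E.r + 64 + 0))) 1 (E.r + 64 + 1)
  rw [State.setReg_ne (s := E.r + 64 + 1) _ _ _ (by omega)] at m1
  have m2 := step ((σ3.setReg 0 (σ3.reg (E.r + 64 + 0))).setReg 1 (σ3.reg (E.r + 64 + 1))) 2
    (E.r + 64 + 2)
  rw [State.setReg_ne (s := E.r + 64 + 2) _ _ _ (by omega),
    State.setReg_ne (s := E.r + 64 + 2) _ _ _ (by omega)] at m2
  have m3 := step (((σ3.setReg 0 (σ3.reg (E.r + 64 + 0))).setReg 1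
    (σ3.reg (E.r + 64 + 1))).setReg 2 (σ3.reg (E.r + 64 + 2))) 3 (E.r + 64 + 3)
  rw [State.setReg_ne (s := E.r + 64 + 3) _ _ _ (by omega),
    State.setReg_ne (s := E.r + 64 + 3) _ _ _ (by omega),
    State.setReg_ne (s := E.r + 64 + 3) _ _ _ (by omega)] at m3
  refine ⟨_, τ.setReg (E.r + i) (τ.reg 0),
    ({ h with m := τ.mem }.setV i (τ.reg 0).toNat).tick
      (kb + (e₀.cost + e₁.cost + e₂.cost + e₃.cost + 5)),
    (x0.seq (x1.seq (x2.seq (x3.seq (m0.seq (m1.seq (m2.seq (m3.seq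
      ((hx.mono hM).seq (step _ _ _)))))))))), Holds.tick (hτ.setV ?_ ?_ ?_) _, ?_, hQ⟩
  · rw [State.setReg_self]; simp
  · intro j hj hji
    exact State.setReg_ne _ _ _ (by omega)
  · rfl
  · simp only [Store.tick_clk, Store.setV_clk]; omega

end WordRAM

/-! ### Thompson automata -/

namespace Regex

variable {α : Type}

theorem size_pos (R : Regex α) : 0 < R.size := by cases R <;> simp [size]

/-- Whether the empty word matches. -/
def nullable : Regex α → Bool
  | char _ => false
  | cat S T => S.nullable && T.nullable
  | alt S T => S.nullable || T.nullable
  | star _ => true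

theorem nullable_iff (R : Regex α) : R.nullable = true ↔ [] ∈ R.lang := by
  induction R with
  | char a => simp only [nullable, lang]; exact ⟨by simp, fun h => by cases h⟩
  | cat S T hS hT =>
    simp only [nullable, lang, Bool.and_eq_true, hS, hT, Language.mem_mul]
    constructor
    · rintro ⟨h1, h2⟩; exact ⟨[], h1, [], h2, rfl⟩
    · rintro ⟨a, ha, b, hb, hab⟩
      rw [List.append_eq_nil_iff] at hab
      obtain ⟨rfl, rfl⟩ := hab
      exact ⟨ha, hb⟩
  | alt S T hS hT => simp only [nullable, lang, Bool.or_eq_true, hS, hT, Language.mem_add]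
  | star S _ => simp only [nullable, lang, Language.nil_mem_kstar]

/-- In postorder the root is the last node, with number `o + R.size - 1`. The additive form avoids
truncated subtraction. -/
theorem thompson_start (R : Regex α) (o : ℕ) : (R.thompson o).start + 2 = 2 * (o + R.size) := by
  cases R <;> simp only [thompson, size] <;> omega

theorem thompson_accept (R : Regex α) (o : ℕ) : (R.thompson o).accept + 1 = 2 * (o + R.size) := by
  cases R <;> simp only [thompson, size] <;> omega

theorem thompson_edge_range (R : Regex α) {o p q : ℕ} {l : Option α}
    (h : (R.thompson o).edge p l q) :
    2 * o ≤ p ∧ p < 2 * (o + R.size) ∧ 2 * o ≤ q ∧ q < 2 * (o + R.size) := by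
  induction R generalizing o with
  | char a => simp only [thompson, size] at h ⊢; omega
  | cat S T hS hT =>
    have := S.thompson_start o; have := S.thompson_accept o
    have := T.thompson_start (o + S.size); have := T.thompson_accept (o + S.size)
    have := S.size_pos; have := T.size_pos
    simp only [thompson, size] at h ⊢
    rcases h with h | h | h
    · have := hS h; omega
    · have := hT h; omega
    · omega
  | alt S T hS hT =>
    have := S.thompson_start o; have := S.thompson_accept o
    have := T.thompson_start (o + S.size); have := T.thompson_accept (o + S.size)
    have := S.size_pos; have := T.size_pos
    simp only [thompson, size] at h ⊢
    rcases h with h | h | h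
    · have := hS h; omega
    · have := hT h; omega
    · omega
  | star S hS =>
    have := S.thompson_start o; have := S.thompson_accept o
    have := S.size_pos
    simp only [thompson, size] at h ⊢
    rcases h with h | h
    · have := hS h; omega
    · omega

theorem mem_thompson_states (R : Regex α) (o q : ℕ) :
    q ∈ (R.thompson o).states ↔ 2 * o ≤ q ∧ q < 2 * (o + R.size) := by
  induction R generalizing o with
  | char a => simp only [thompson, size, Finset.mem_insert, Finset.mem_singleton]; omega
  | cat S T hS hT =>
    simp only [thompson, size, Finset.mem_union, Finset.mem_insert, Finset.mem_singleton, hS, hT]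
    omega
  | alt S T hS hT =>
    simp only [thompson, size, Finset.mem_union, Finset.mem_insert, Finset.mem_singleton, hS, hT]
    omega
  | star S hS =>
    simp only [thompson, size, Finset.mem_union, Finset.mem_insert, Finset.mem_singleton, hS]
    omega

theorem mem_tnfa_states (R : Regex α) (q : ℕ) : q ∈ R.tnfa.states ↔ q < 2 * R.size := by
  rw [tnfa, mem_thompson_states]; omega

theorem card_tnfa_states (R : Regex α) : R.tnfa.states.card = 2 * R.size := by
  have : R.tnfa.states = Finset.range (2 * R.size) := by
    ext q; rw [mem_tnfa_states, Finset.mem_range]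
  rw [this, Finset.card_range]

theorem length_code {w : ℕ} (R : Regex (BitVec w)) : R.code.length = 2 * R.size := by
  induction R <;> simp only [code, size, List.length_append, List.length_cons, List.length_nil] <;>
    omega

end Regex

/-! ### Regular expressions with holes -/

/-- A regular expression some of whose subexpressions are cut out. -/
inductive Cut (α : Type) : Type where
  | char (a : α) : Cut α
  | cat (S T : Cut α) : Cut α
  | alt (S T : Cut α) : Cut α
  | star (S : Cut α) : Cut α
  | hole (S : Cut α) : Cut α

namespace Cut

variable {α : Type}

/-- The regular expression itself. -/
def erase : Cut α → Regex α
  | char a => .char a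
  | cat S T => .cat S.erase T.erase
  | alt S T => .alt S.erase T.erase
  | star S => .star S.erase
  | hole S => S.erase

/-- What stands in for a hole: a fresh character, under a star if the hole can be skipped. -/
def stub (β : α) (S : Cut α) : Regex α :=
  if S.erase.nullable then .star (.char β) else .char β

/-- The regular expression with stubs in place of the holes. -/
def micro (β : α) : Cut α → Regex α
  | char a => .char a
  | cat S T => .cat (S.micro β) (T.micro β)
  | alt S T => .alt (S.micro β) (T.micro β)
  | star S => .star (S.micro β)
  | hole S => S.stub β

/-- The length of `micro`. -/
def size : Cut α → ℕ
  | char _ => 1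
  | cat S T => S.size + T.size + 1
  | alt S T => S.size + T.size + 1
  | star S => S.size + 1
  | hole S => if S.erase.nullable then 2 else 1

/-- The number of holes, including those inside of holes. -/
def cnt : Cut α → ℕ
  | char _ => 0
  | cat S T => S.cnt + T.cnt
  | alt S T => S.cnt + T.cnt
  | star S => S.cnt
  | hole S => S.cnt + 1

theorem size_micro (β : α) (S : Cut α) : (S.micro β).size = S.size := by
  induction S with
  | hole S _ => simp only [micro, stub, size]; split_ifs <;> rfl
  | _ => simp_all [micro, size, Regex.size]

theorem size_pos (S : Cut α) : 0 < S.size := by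
  cases S <;> simp only [size] <;> (try split_ifs) <;> omega

theorem chars_micro (β : α) (S : Cut α) : (S.micro β).chars ⊆ S.erase.chars ∪ {β} := by
  induction S with
  | char a => exact Set.subset_union_left
  | cat S T hS hT | alt S T hS hT =>
    simp only [micro, Regex.chars, erase]
    exact Set.union_subset (hS.trans (by gcongr; exact Set.subset_union_left))
      (hT.trans (by gcongr; exact Set.subset_union_right))
  | star S hS => exact hS
  | hole S _ =>
    simp only [micro, stub]
    split_ifs <;> exact Set.subset_union_right

/-! #### Words leading to a state -/

/-- The words that lead to state `q` of `micro`, numbered from node `o` on, if those in `A` lead to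
its start state, and the words of a hole lead from one side of its stub to the other. -/
def pre : Cut α → ℕ → Language α → ℕ → Language α
  | char a, o, A, q => if q = 2 * o then A else A * {[a]}
  | cat S T, o, A, q =>
    if q < 2 * (o + S.size) then S.pre o A q
    else if q < 2 * (o + S.size + T.size) then T.pre (o + S.size) (A * S.erase.lang) q
    else if q = 2 * (o + S.size + T.size) then A
    else A * (S.erase.lang * T.erase.lang)
  | alt S T, o, A, q =>
    if q < 2 * (o + S.size) then S.pre o A q
    else if q < 2 * (o + S.size + T.size) then T.pre (o + S.size) A q
    else if q = 2 * (o + S.size + T.size) then A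
    else A * (S.erase.lang + T.erase.lang)
  | star S, o, A, q =>
    if q < 2 * (o + S.size) then S.pre o (A * KStar.kstar S.erase.lang) q
    else if q = 2 * (o + S.size) then A
    else A * KStar.kstar S.erase.lang
  | hole S, o, A, q =>
    if S.erase.nullable then
      -- The states of `β` are `2 * o` and `2 * o + 1`, those of the star around it are the next
      -- two. As `β` is never read, no word leads to `2 * o + 1`.
      if q = 2 * o ∨ q = 2 * (o + 1) then A
      else if q = 2 * o + 1 then 0 else A * S.erase.lang
    else if q = 2 * o then A else A * S.erase.lang

theorem pre_start (S : Cut α) (o : ℕ) (A : Language α) {q : ℕ} (hq : q + 2 = 2 * (o + S.size)) :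
    S.pre o A q = A := by
  cases S with
  | char a => simp only [size, pre] at hq ⊢; rw [if_pos (by omega)]
  | cat S T | alt S T =>
    simp only [size, pre] at hq ⊢
    rw [if_neg (by omega), if_neg (by omega), if_pos (by omega)]
  | star S => simp only [size, pre] at hq ⊢; rw [if_neg (by omega), if_pos (by omega)]
  | hole S =>
    simp only [size, pre] at hq ⊢
    split_ifs at hq ⊢ <;> first | rfl | omega

theorem pre_accept (S : Cut α) (o : ℕ) (A : Language α) {q : ℕ} (hq : q + 1 = 2 * (o + S.size)) :
    S.pre o A q = A * S.erase.lang := by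
  cases S with
  | char a => simp only [size, pre] at hq ⊢; rw [if_neg (by omega)]; rfl
  | cat S T | alt S T =>
    simp only [size, pre] at hq ⊢
    rw [if_neg (by omega), if_neg (by omega), if_neg (by omega)]
    rfl
  | star S => simp only [size, pre] at hq ⊢; rw [if_neg (by omega), if_neg (by omega)]; rfl
  | hole S =>
    simp only [size, pre] at hq ⊢
    split_ifs at hq ⊢ <;> first | rfl | omega

theorem micro_start (β : α) (S : Cut α) (o : ℕ) :
    ((S.micro β).thompson o).start + 2 = 2 * (o + S.size) := by
  rw [Regex.thompson_start, size_micro]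

theorem micro_accept (β : α) (S : Cut α) (o : ℕ) :
    ((S.micro β).thompson o).accept + 1 = 2 * (o + S.size) := by
  rw [Regex.thompson_accept, size_micro]

theorem micro_edge_range {β : α} {S : Cut α} {o p q : ℕ} {l : Option α}
    (h : ((S.micro β).thompson o).edge p l q) :
    2 * o ≤ p ∧ p < 2 * (o + S.size) ∧ 2 * o ≤ q ∧ q < 2 * (o + S.size) := by
  rw [← size_micro β]; exact Regex.thompson_edge_range _ h

/-- The words that a transition reads. -/
def step : Option α → Language α
  | none => 1
  | some a => {[a]}

/-- This is soundness of a single transition, by the algebra of languages. A star needs `A * L∗ * L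
≤ A * L∗`; the `ε`-transition past a skippable hole needs `A ≤ A * L`, which holds because the hole
matches the empty word. Transitions with label `β` are excluded, as nothing is known about them. -/
theorem pre_edge {β : α} {l : Option α} (hl : l ≠ some β) (S : Cut α) {o p q : ℕ}
    {A : Language α} (h : ((S.micro β).thompson o).edge p l q) :
    S.pre o A p * step l ≤ S.pre o A q := by
  induction S generalizing o A with
  | char a =>
    obtain ⟨rfl, rfl, rfl⟩ := h
    simp [pre, step]
  | cat S T hS hT =>
    have s1 := S.micro_start β o; have s2 := S.micro_accept β o
    have t1 := T.micro_start β (o + S.size); have t2 := T.micro_accept β (o + S.size)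
    have := S.size_pos; have := T.size_pos
    simp only [micro, Regex.thompson, size_micro] at h
    rcases h with h | h | ⟨rfl, ⟨rfl, rfl⟩ | ⟨rfl, rfl⟩ | ⟨rfl, rfl⟩⟩
    · have := micro_edge_range h
      simp only [pre]
      rw [if_pos (by omega), if_pos (by omega)]
      exact hS h
    · have := micro_edge_range h
      simp only [pre]
      rw [if_neg (by omega), if_pos (by omega), if_neg (by omega), if_pos (by omega)]
      exact hT h
    · simp only [pre, step, mul_one]
      rw [if_neg (by omega), if_neg (by omega), if_pos trivial, if_pos (by omega), pre_start _ _ _ s1]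
    · simp only [pre, step, mul_one]
      rw [if_pos (by omega), if_neg (by omega), if_pos (by omega), pre_start _ _ _ t1,
        pre_accept _ _ _ s2]
    · simp only [pre, step, mul_one]
      rw [if_neg (by omega), if_pos (by omega), if_neg (by omega), if_neg (by omega),
        if_neg (by omega), pre_accept _ _ _ t2, mul_assoc]
  | alt S T hS hT =>
    have s1 := S.micro_start β o; have s2 := S.micro_accept β o
    have t1 := T.micro_start β (o + S.size); have t2 := T.micro_accept β (o + S.size)
    have := S.size_pos; have := T.size_pos
    simp only [micro, Regex.thompson, size_micro] at h
    rcases h with h | h | ⟨rfl, ⟨rfl, rfl⟩ | ⟨rfl, rfl⟩ | ⟨rfl, rfl⟩ | ⟨rfl, rfl⟩⟩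
    · have := micro_edge_range h
      simp only [pre]
      rw [if_pos (by omega), if_pos (by omega)]
      exact hS h
    · have := micro_edge_range h
      simp only [pre]
      rw [if_neg (by omega), if_pos (by omega), if_neg (by omega), if_pos (by omega)]
      exact hT h
    · simp only [pre, step, mul_one]
      rw [if_neg (by omega), if_neg (by omega), if_pos trivial, if_pos (by omega), pre_start _ _ _ s1]
    · simp only [pre, step, mul_one]
      rw [if_neg (by omega), if_neg (by omega), if_pos trivial, if_neg (by omega), if_pos (by omega),
        pre_start _ _ _ t1]
    · simp only [pre, step, mul_one]
      rw [if_pos (by omega), if_neg (by omega), if_neg (by omega), if_neg (by omega),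
        pre_accept _ _ _ s2, mul_add]
      exact le_sup_left
    · simp only [pre, step, mul_one]
      rw [if_neg (by omega), if_pos (by omega), if_neg (by omega), if_neg (by omega),
        if_neg (by omega), pre_accept _ _ _ t2, mul_add]
      exact le_sup_right
  | star S hS =>
    have s1 := S.micro_start β o; have s2 := S.micro_accept β o
    have := S.size_pos
    have hk : A * KStar.kstar S.erase.lang * S.erase.lang ≤ A * KStar.kstar S.erase.lang := by
      rw [mul_assoc]; gcongr; exact kstar_mul_le_kstar
    have h1 : A ≤ A * KStar.kstar S.erase.lang := by
      conv_lhs => rw [← mul_one A]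
      gcongr; exact one_le_kstar
    simp only [micro, Regex.thompson, size_micro] at h
    rcases h with h | ⟨rfl, ⟨rfl, rfl⟩ | ⟨rfl, rfl⟩ | ⟨rfl, rfl⟩ | ⟨rfl, rfl⟩⟩
    · have := micro_edge_range h
      simp only [pre]
      rw [if_pos (by omega), if_pos (by omega)]
      exact hS h
    · simp only [pre, step, mul_one]
      rw [if_neg (by omega), if_pos trivial, if_pos (by omega), pre_start _ _ _ s1]
      exact h1
    · simp only [pre, step, mul_one]
      rw [if_neg (by omega), if_pos trivial, if_neg (by omega), if_neg (by omega)]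
      exact h1
    · simp only [pre, step, mul_one]
      rw [if_pos (by omega), if_neg (by omega), if_neg (by omega), pre_accept _ _ _ s2]
      exact hk
    · simp only [pre, step, mul_one]
      rw [if_pos (by omega), if_pos (by omega), pre_accept _ _ _ s2, pre_start _ _ _ s1]
      exact hk
  | hole S _ =>
    simp only [micro, stub, pre] at h ⊢
    by_cases hn : S.erase.nullable
    · have hA : A ≤ A * S.erase.lang := by
        conv_lhs => rw [← mul_one A]
        gcongr
        rintro _ rfl
        exact (Regex.nullable_iff _).1 hn
      simp only [hn, if_true, Regex.thompson, Regex.size] at h ⊢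
      rcases h with ⟨-, rfl, -⟩ | ⟨rfl, ⟨rfl, rfl⟩ | ⟨rfl, rfl⟩ | ⟨rfl, rfl⟩ | ⟨rfl, rfl⟩⟩
      · exact absurd rfl hl
      · rw [if_pos (by omega), if_pos (by omega), step, mul_one]
      · rw [if_pos (by omega), if_neg (by omega), if_neg (by omega), step, mul_one]
        exact hA
      -- The two remaining transitions leave the state behind `β`, to which no word leads.
      · rw [if_neg (by omega), if_pos (by omega), zero_mul]
        exact bot_le
      · rw [if_neg (by omega), if_pos (by omega), zero_mul]
        exact bot_le
    · simp only [hn] at h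
      exact absurd h.2.1 hl

/-! #### Occurrences -/

/-- `T.Occ κ₀ A₀ S κ o A`: the expression `S` occurs in `T` outside of its holes, from node `o` of
`micro` on, with `κ - κ₀` holes before it, and the words in `A` lead to its start state if those in
`A₀` lead to that of `T`. -/
inductive Occ (T : Cut α) (κ₀ : ℕ) (A₀ : Language α) : Cut α → ℕ → ℕ → Language α → Prop
  | root : Occ T κ₀ A₀ T κ₀ 0 A₀
  | catL {S S' : Cut α} {κ o : ℕ} {A : Language α} (h : Occ T κ₀ A₀ (.cat S S') κ o A) :
      Occ T κ₀ A₀ S κ o A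
  | catR {S S' : Cut α} {κ o : ℕ} {A : Language α} (h : Occ T κ₀ A₀ (.cat S S') κ o A) :
      Occ T κ₀ A₀ S' (κ + S.cnt) (o + S.size) (A * S.erase.lang)
  | altL {S S' : Cut α} {κ o : ℕ} {A : Language α} (h : Occ T κ₀ A₀ (.alt S S') κ o A) :
      Occ T κ₀ A₀ S κ o A
  | altR {S S' : Cut α} {κ o : ℕ} {A : Language α} (h : Occ T κ₀ A₀ (.alt S S') κ o A) :
      Occ T κ₀ A₀ S' (κ + S.cnt) (o + S.size) A
  | star {S : Cut α} {κ o : ℕ} {A : Language α} (h : Occ T κ₀ A₀ (.star S) κ o A) :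
      Occ T κ₀ A₀ S κ o (A * KStar.kstar S.erase.lang)

section Occ
variable {T S : Cut α} {κ₀ κ o : ℕ} {A₀ A : Language α}

theorem Occ.size_le (h : T.Occ κ₀ A₀ S κ o A) : o + S.size ≤ T.size := by
  induction h with
  | root => omega
  | catL _ ih | catR _ ih | altL _ ih | altR _ ih | star _ ih => simp only [size] at ih; omega

theorem Occ.cnt_le (h : T.Occ κ₀ A₀ S κ o A) : κ₀ ≤ κ ∧ κ + S.cnt ≤ κ₀ + T.cnt := by
  induction h with
  | root => omega
  | catL _ ih | catR _ ih | altL _ ih | altR _ ih | star _ ih => simp only [cnt] at ih; omega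

theorem Occ.edge {β : α} (h : T.Occ κ₀ A₀ S κ o A) {p q : ℕ} {l : Option α}
    (he : ((S.micro β).thompson o).edge p l q) : (T.micro β).tnfa.edge p l q := by
  induction h with
  | root => exact he
  | catL h ih => exact ih (Or.inl he)
  | altL h ih => exact ih (Or.inl he)
  | catR h ih => exact ih (Or.inr (Or.inl (by rwa [size_micro])))
  | altR h ih => exact ih (Or.inr (Or.inl (by rwa [size_micro])))
  | star h ih => exact ih (Or.inl he)

/-- Languages of states can thus be computed at the occurrence, without regard to what surrounds it.
-/
theorem Occ.pre_eq (h : T.Occ κ₀ A₀ S κ o A) {q : ℕ} (h1 : 2 * o ≤ q) (h2 : q < 2 * (o + S.size)) :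
    T.pre 0 A₀ q = S.pre o A q := by
  induction h with
  | root => rfl
  | catL h ih | altL h ih =>
    rw [ih h1 (by simp only [size]; omega)]; simp only [pre]; rw [if_pos h2]
  | catR h ih | altR h ih =>
    rw [ih (by omega) (by simp only [size]; omega)]; simp only [pre]
    rw [if_neg (by omega), if_pos h2]
  | star h ih =>
    rw [ih h1 (by simp only [size]; omega)]; simp only [pre]; rw [if_pos h2]

end Occ

/-! #### Numbering of the holes -/

/-- What is known about a cut out expression: the expression, the number of holes that precede those
in it, the words that lead to it, the number of the expression that it is cut out of, and the state
there in its place. -/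
structure Info (α : Type) where
  tree : Cut α
  lo : ℕ
  ctx : Language α
  par : ℕ
  ent : ℕ

/-- The start state of an expression that ends before node `o`. -/
abbrev startAt (o : ℕ) : ℕ := 2 * (o - 1)

/-- The holes of `S` and those inside of them in postorder, numbered from `κ` on, where `S` occurs
at node `o` of expression number `k` and the words in `A` lead to it. -/
def infos : Cut α → ℕ → ℕ → ℕ → Language α → List (Info α)
  | char _, _, _, _, _ => []
  | cat S T, κ, k, o, A =>
    S.infos κ k o A ++ T.infos (κ + S.cnt) k (o + S.size) (A * S.erase.lang)
  | alt S T, κ, k, o, A => S.infos κ k o A ++ T.infos (κ + S.cnt) k (o + S.size) A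
  | star S, κ, k, o, A => S.infos κ k o (A * KStar.kstar S.erase.lang)
  | hole S, κ, k, o, A =>
    S.infos κ (κ + S.cnt) 0 A ++ [⟨S, κ, A, k, startAt (o + (hole S).size)⟩]

theorem length_infos (S : Cut α) (κ k o : ℕ) (A : Language α) :
    (S.infos κ k o A).length = S.cnt := by
  induction S generalizing κ k o A <;> simp_all [infos, cnt]

/-- The function `g` describes the holes of `S`, numbered from `κ` on. -/
def Linked (g : ℕ → Info α) : Cut α → ℕ → ℕ → ℕ → Language α → Prop
  | char _, _, _, _, _ => True
  | cat S T, κ, k, o, A =>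
    S.Linked g κ k o A ∧ T.Linked g (κ + S.cnt) k (o + S.size) (A * S.erase.lang)
  | alt S T, κ, k, o, A => S.Linked g κ k o A ∧ T.Linked g (κ + S.cnt) k (o + S.size) A
  | star S, κ, k, o, A => S.Linked g κ k o (A * KStar.kstar S.erase.lang)
  | hole S, κ, k, o, A =>
    S.Linked g κ (κ + S.cnt) 0 A ∧
      g (κ + S.cnt) = ⟨S, κ, A, k, startAt (o + (hole S).size)⟩

/-- The list is the form in which the numbering is constructed, the function the form in which it is
used. In postorder all `S.cnt` holes inside of a hole precede it, so that its own number is `κ +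
S.cnt`. -/
theorem linked_of_infos (g : ℕ → Info α) (S : Cut α) (κ k o : ℕ) (A : Language α)
    (h : ∀ i < S.cnt, (S.infos κ k o A)[i]? = some (g (κ + i))) : S.Linked g κ k o A := by
  induction S generalizing κ k o A with
  | char a => trivial
  | cat S T hS hT | alt S T hS hT =>
    simp only [infos, cnt] at h
    refine ⟨hS _ _ _ _ fun i hi => ?_, hT _ _ _ _ fun i hi => ?_⟩
    · rw [← h i (by omega), List.getElem?_append_left (by rwa [length_infos])]
    · have := h (S.cnt + i) (by omega)
      rw [List.getElem?_append_right (by rw [length_infos]; omega), length_infos,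
        Nat.add_sub_cancel_left, ← add_assoc] at this
      exact this
  | star S hS => exact hS _ _ _ _ h
  | hole S hS =>
    simp only [infos, cnt] at h
    refine ⟨hS _ _ _ _ fun i hi => ?_, ?_⟩
    · rw [← h i (by omega), List.getElem?_append_left (by rwa [length_infos])]
    · have := h S.cnt (by omega)
      rw [List.getElem?_append_right (by rw [length_infos]), length_infos, Nat.sub_self] at this
      exact (Option.some.inj this).symm

theorem Linked.occ {g : ℕ → Info α} {T S : Cut α} {κ₀ κ o k : ℕ} {A₀ A : Language α}
    (hl : T.Linked g κ₀ k 0 A₀) (h : T.Occ κ₀ A₀ S κ o A) : S.Linked g κ k o A := by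
  induction h with
  | root => exact hl
  | catL h ih => exact ih.1
  | catR h ih => exact ih.2
  | altL h ih => exact ih.1
  | altR h ih => exact ih.2
  | star h ih => exact ih

/-- The function `g` describes `T` (under number `K - 1`) and all its holes. -/
structure Layout (T : Cut α) (K : ℕ) (g : ℕ → Info α) : Prop where
  pos : 0 < K
  tree_root : (g (K - 1)).tree = T
  ctx_root : (g (K - 1)).ctx = 1
  lo : ∀ k < K, (g k).lo + (g k).tree.cnt = k
  -- Parents come after their children, so that increasing order of the numbers is bottom-up and
  -- decreasing order is top-down.
  par_gt : ∀ j, j + 1 < K → j < (g j).par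
  par_lt : ∀ j, j + 1 < K → (g j).par < K
  occ : ∀ j, j + 1 < K → ∃ o, (g j).ent = startAt (o + (hole (g j).tree).size) ∧
    (g (g j).par).tree.Occ (g (g j).par).lo (g (g j).par).ctx (hole (g j).tree) (g j).lo o (g j).ctx
  hole : ∀ k < K, ∀ S κ o A, (g k).tree.Occ (g k).lo (g k).ctx (hole S) κ o A →
    g (κ + S.cnt) = ⟨S, κ, A, k, startAt (o + (hole S).size)⟩

/-- A predicate holds for all cut out expressions. -/
def AllHoles (P : Cut α → Prop) : Cut α → Prop
  | char _ => True
  | cat S T => S.AllHoles P ∧ T.AllHoles P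
  | alt S T => S.AllHoles P ∧ T.AllHoles P
  | star S => S.AllHoles P
  | hole S => P S ∧ S.AllHoles P

/-- All facts about a hole `j` of `S` are proved in one induction. If `j` lies strictly inside of a
hole of `S`, the induction goes on with the root occurrence of the part for this hole. The predicate
`P` carries the bounds on the parts along. -/
theorem Linked.info {g : ℕ → Info α} {K : ℕ} {P : Cut α → Prop} {S : Cut α} :
    ∀ {κ k o : ℕ} {A : Language α}, S.Linked g κ k o A → S.AllHoles P → κ + S.cnt ≤ k → k < K →
    (g k).tree.Occ (g k).lo (g k).ctx S κ o A → ∀ j, κ ≤ j → j < κ + S.cnt →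
    ((g j).lo + (g j).tree.cnt = j ∧ (g j).tree.Linked g (g j).lo j 0 (g j).ctx ∧ P (g j).tree) ∧
    j < (g j).par ∧ (g j).par < K ∧ ∃ o, (g j).ent = startAt (o + (Cut.hole (g j).tree).size) ∧
      (g (g j).par).tree.Occ (g (g j).par).lo (g (g j).par).ctx (Cut.hole (g j).tree)
        (g j).lo o (g j).ctx := by
  induction S with
  | char a => intros; simp only [cnt] at *; omega
  | cat S T hS hT =>
    intro κ k o A hl hP hκ hk ho j h1 h2
    simp only [cnt] at hκ h2
    by_cases hj : j < κ + S.cnt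
    · exact hS hl.1 hP.1 (by omega) hk ho.catL j h1 hj
    · exact hT hl.2 hP.2 (by omega) hk ho.catR j (by omega) (by omega)
  | alt S T hS hT =>
    intro κ k o A hl hP hκ hk ho j h1 h2
    simp only [cnt] at hκ h2
    by_cases hj : j < κ + S.cnt
    · exact hS hl.1 hP.1 (by omega) hk ho.altL j h1 hj
    · exact hT hl.2 hP.2 (by omega) hk ho.altR j (by omega) (by omega)
  | star S hS =>
    intro κ k o A hl hP hκ hk ho j h1 h2
    exact hS hl hP hκ hk ho.star j h1 h2
  | hole S hS =>
    intro κ k o A hl hP hκ hk ho j h1 h2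
    simp only [cnt] at hκ h2
    by_cases hj : j < κ + S.cnt
    · refine hS hl.1 hP.2 le_rfl (by omega) ?_ j h1 hj
      rw [hl.2]; exact .root
    · obtain rfl : j = κ + S.cnt := by omega
      rw [hl.2]
      exact ⟨⟨rfl, hl.1, hP.1⟩, by simpa using by omega, hk, o, rfl, ho⟩

theorem exists_layout (T : Cut α) (P : Cut α → Prop) (h : P T) (hP : T.AllHoles P) :
    ∃ g : ℕ → Info α, Layout T (T.cnt + 1) g ∧ ∀ k < T.cnt + 1, P (g k).tree := by
  -- The expression itself is treated as a hole of an imaginary part with number `T.cnt + 1`, in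
  -- order to be numbered like the others. Its parent and entry state mean nothing, which is why
  -- links are considered for `j + 1 < K` only.
  set L := (hole T).infos 0 (T.cnt + 1) 0 1 with hL
  have hlen : L.length = T.cnt + 1 := length_infos ..
  set g : ℕ → Info α := fun i => L.getD i ⟨T, 0, 1, 0, 0⟩
  have hl : (hole T).Linked g 0 (T.cnt + 1) 0 1 := by
    apply linked_of_infos
    intro i hi
    have : i < L.length := by rw [hlen]; exact hi
    simp [g, ← hL, this]
  have hroot := hl.2
  rw [zero_add] at hroot
  have H : ∀ j < T.cnt, _ := fun j hj => Linked.info (K := T.cnt + 1) (P := P) hl.1 hP (by omega)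
    (by omega) (by rw [zero_add, hroot]; exact .root) j (by omega) (by omega)
  have H' : ∀ k < T.cnt + 1, (g k).lo + (g k).tree.cnt = k ∧
      (g k).tree.Linked g (g k).lo k 0 (g k).ctx ∧ P (g k).tree := by
    intro k hk
    by_cases hkt : k < T.cnt
    · exact (H k hkt).1
    · obtain rfl : k = T.cnt := by omega
      rw [hroot]
      refine ⟨zero_add _, ?_, h⟩
      have := hl.1
      rwa [zero_add] at this
  refine ⟨g, ⟨by omega, by simp [hroot], by simp [hroot], fun k hk => (H' k hk).1,
    fun j hj => (H j (by omega)).2.1, fun j hj => (H j (by omega)).2.2.1,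
    fun j hj => (H j (by omega)).2.2.2, fun k hk S κ o A ho => ?_⟩, fun k hk => (H' k hk).2.2⟩
  exact ((H' k hk).2.1.occ ho).2

end Cut

/-! ### Partition of an expression -/

namespace Regex

variable {α : Type}

/-- Cut out `S` if `micro` would have at least `y` nodes. -/
def cutOff (y : ℕ) (S : Cut α) : Cut α := if y ≤ S.size then .hole S else S

/-- Cut out subexpressions greedily from the bottom up, except for the expression itself. -/
def split (y : ℕ) : Regex α → Cut α
  | char a => .char a
  | cat S T => .cat (cutOff y (S.split y)) (cutOff y (T.split y))
  | alt S T => .alt (cutOff y (S.split y)) (cutOff y (T.split y))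
  | star S => .star (cutOff y (S.split y))

theorem erase_cutOff (y : ℕ) (S : Cut α) : (cutOff y S).erase = S.erase := by
  rw [cutOff]; split_ifs <;> rfl

@[simp] theorem erase_split (y : ℕ) (R : Regex α) : (R.split y).erase = R := by
  induction R <;> simp_all [split, Cut.erase, erase_cutOff]

/-- At least `y` nodes are cut out and a stub of at most two is put back, which pays `y - 2` for the
new hole. -/
theorem size_cutOff {y n : ℕ} (hy : 3 ≤ y) {S : Cut α} (h : S.size + (y - 2) * S.cnt ≤ n) :
    (cutOff y S).size + (y - 2) * (cutOff y S).cnt ≤ n ∧ (cutOff y S).size < y := by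
  rw [cutOff]
  split_ifs with hS
  · have h1 : (Cut.hole S).size ≤ 2 := by simp only [Cut.size]; split_ifs <;> omega
    have h2 : (y - 2) * (S.cnt + 1) = (y - 2) * S.cnt + (y - 2) := by ring
    simp only [Cut.cnt]
    omega
  · omega

/-- The first part counts the cuts. For the second, both operands have fewer than `y` nodes after
they have been cut off, and the operator adds one. -/
theorem size_split {y : ℕ} (hy : 3 ≤ y) (R : Regex α) :
    (R.split y).size + (y - 2) * (R.split y).cnt ≤ R.size ∧ (R.split y).size < 2 * y := by
  induction R with
  | char a => simp only [split, Cut.size, Cut.cnt, size]; omega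
  | cat S T hS hT | alt S T hS hT =>
    have h1 := size_cutOff hy hS.1
    have h2 := size_cutOff hy hT.1
    simp only [split, Cut.size, Cut.cnt, size, mul_add]
    omega
  | star S hS =>
    have h1 := size_cutOff hy hS.1
    simp only [split, Cut.size, Cut.cnt, size]
    omega

theorem allHoles_cutOff {y : ℕ} {P : Cut α → Prop} {S : Cut α} (h : P S) (hS : S.AllHoles P) :
    (cutOff y S).AllHoles P := by
  rw [cutOff]; split_ifs
  · exact ⟨h, hS⟩
  · exact hS

theorem split_spec {y : ℕ} (hy : 3 ≤ y) {s : Set α} (R : Regex α) (hR : R.chars ⊆ s) :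
    ((R.split y).size < 2 * y ∧ (R.split y).erase.chars ⊆ s) ∧
      (R.split y).AllHoles fun S => S.size < 2 * y ∧ S.erase.chars ⊆ s := by
  refine ⟨⟨(size_split hy R).2, by rwa [erase_split]⟩, ?_⟩
  induction R with
  | char a => trivial
  | cat S T hS hT | alt S T hS hT =>
    simp only [chars, Set.union_subset_iff] at hR
    exact ⟨allHoles_cutOff ⟨(size_split hy S).2, by rw [erase_split]; exact hR.1⟩ (hS hR.1),
      allHoles_cutOff ⟨(size_split hy T).2, by rw [erase_split]; exact hR.2⟩ (hT hR.2)⟩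
  | star S hS =>
    exact allHoles_cutOff ⟨(size_split hy S).2, by rw [erase_split]; exact hR⟩ (hS hR)

end Regex

/-! ### Simulation of an expression by its parts -/

namespace Cut

variable {α : Type} {T : Cut α} {K : ℕ} {g : ℕ → Info α} {β : α}

/-- The start state of expression number `j`. -/
abbrev start (g : ℕ → Info α) (j : ℕ) : ℕ := startAt (g j).tree.size

/-- The automaton of expression number `j`. -/
abbrev auto (g : ℕ → Info α) (β : α) (j : ℕ) : FA α := ((g j).tree.micro β).tnfa

/-- State-sets of the parts, closed under all `ε`-transitions of the whole. -/
structure IsClosed (K : ℕ) (g : ℕ → Info α) (β : α) (Z : ℕ → Set ℕ) : Prop where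
  eps : ∀ j < K, ∀ p ∈ Z j, ∀ q, (auto g β j).edge p none q → q ∈ Z j
  entry : ∀ j, j + 1 < K → (g j).ent ∈ Z (g j).par → start g j ∈ Z j
  exit : ∀ j, j + 1 < K → start g j + 1 ∈ Z j → (g j).ent + 1 ∈ Z (g j).par

/-- All states in the sets are reached by the word `u`. -/
def Reached (K : ℕ) (g : ℕ → Info α) (u : List α) (Z : ℕ → Set ℕ) : Prop :=
  ∀ j < K, ∀ q ∈ Z j, u ∈ (g j).tree.pre 0 (g j).ctx q

theorem startAt_add (S : Cut α) (o : ℕ) :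
    startAt (o + S.size) + 2 = 2 * (o + S.size) := by
  have := S.size_pos; simp only [startAt]; omega

theorem start_add (g : ℕ → Info α) (j : ℕ) : start g j + 2 = 2 * (g j).tree.size := by
  have := (g j).tree.size_pos; simp only [start, startAt]; omega

theorem Reached.edge {u v : List α} {Z : ℕ → Set ℕ} (h : Reached K g u Z) {j p q : ℕ} (hj : j < K)
    (hp : p ∈ Z j) {l : Option α} (hl : l ≠ some β) (he : (auto g β j).edge p l q)
    (hv : v ∈ step l) : u ++ v ∈ (g j).tree.pre 0 (g j).ctx q :=
  pre_edge hl _ he (Language.append_mem_mul (h j hj p hp) hv)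

theorem pre_close {A : Language α} {u : List α} {S : Cut α} {X : Set ℕ}
    (h : ∀ p ∈ X, u ∈ S.pre 0 A p) : ∀ q ∈ (S.micro β).tnfa.close X, u ∈ S.pre 0 A q := by
  rintro q ⟨p, hp, hpq⟩
  induction hpq with
  | refl => exact h p hp
  | tail _ he ih =>
    have := pre_edge (β := β) (l := none) (by simp) S he
      (Language.append_mem_mul ih (show [] ∈ step none from rfl))
    rw [List.append_nil] at this
    exact this

/-- If the accepting state is reachable by `ε`-transitions, the empty word matches. -/
theorem nullable_of_close {S : Cut α}
    (h : 2 * S.size - 1 ∈ (S.micro β).tnfa.close {2 * S.size - 2}) : S.erase.nullable := by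
  have hS := S.size_pos
  have := pre_close (A := 1) (u := []) (X := {2 * S.size - 2}) (by
    rintro p rfl
    rw [pre_start _ _ _ (by omega)]
    rfl) _ h
  rw [pre_accept _ _ _ (by omega), one_mul] at this
  exact (Regex.nullable_iff _).2 this

theorem hole_edge (S : Cut α) (h : S.erase.nullable) (o : ℕ) :
    (((hole S).micro β).thompson o).edge (startAt (o + (hole S).size)) none
      (startAt (o + (hole S).size) + 1) := by
  simp only [micro, stub, h, if_true, Regex.thompson, Regex.size, size, startAt]
  right
  exact ⟨trivial, .inr (.inl ⟨by omega, by omega⟩)⟩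

namespace Layout

/-- The languages at the two ends of a stub are those at the start and at the accepting state of the
child, so that following a link is sound. -/
theorem pre_ent (L : Layout T K g) {j : ℕ} (hj : j + 1 < K) :
    (g (g j).par).tree.pre 0 (g (g j).par).ctx (g j).ent = (g j).ctx ∧
    (g (g j).par).tree.pre 0 (g (g j).par).ctx ((g j).ent + 1) =
      (g j).ctx * (g j).tree.erase.lang := by
  obtain ⟨o, h1, h2⟩ := L.occ j hj
  have h3 := startAt_add (Cut.hole (g j).tree) o
  have h4 := (Cut.hole (g j).tree).size_pos
  rw [h2.pre_eq (by omega) (by omega), h2.pre_eq (by omega) (by omega),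
    pre_start _ _ _ (by omega), pre_accept _ _ _ (by omega)]
  exact ⟨rfl, rfl⟩

theorem ent_lt (L : Layout T K g) {j : ℕ} (hj : j + 1 < K) :
    (g j).ent + 1 < 2 * (g (g j).par).tree.size := by
  obtain ⟨o, h1, h2⟩ := L.occ j hj
  have h3 := startAt_add (Cut.hole (g j).tree) o
  have := h2.size_le
  omega

theorem bypass (L : Layout T K g) {j : ℕ} (hj : j + 1 < K) (h : (g j).tree.erase.nullable) :
    (auto g β (g j).par).edge (g j).ent none ((g j).ent + 1) := by
  obtain ⟨o, h1, h2⟩ := L.occ j hj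
  rw [h1]
  exact h2.edge (hole_edge _ h o)

theorem pre_start (j : ℕ) : (g j).tree.pre 0 (g j).ctx (start g j) = (g j).ctx :=
  Cut.pre_start _ _ _ (by rw [start_add, zero_add])

theorem pre_accept (j : ℕ) :
    (g j).tree.pre 0 (g j).ctx (start g j + 1) = (g j).ctx * (g j).tree.erase.lang :=
  Cut.pre_accept _ _ _ (by have := start_add g j; omega)

/-- A word that matches a subexpression leads from its start state to its accepting state. -/
theorem path (L : Layout T K g) {Q : List α} {H : ℕ → ℕ → Set ℕ}
    (hH : ∀ s ≤ Q.length, IsClosed K g β (H s))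
    (hm : ∀ s (h : s < Q.length), ∀ j < K, ∀ p ∈ H s j, ∀ q, (auto g β j).edge p (some Q[s]) q →
      q ∈ H (s + 1) j) (S : Cut α) :
    ∀ {k κ o : ℕ} {A : Language α}, k < K → (g k).tree.Occ (g k).lo (g k).ctx S κ o A →
    ∀ (s : ℕ) (z : List α), s ≤ Q.length → z <+: Q.drop s → z ∈ S.erase.lang →
    startAt (o + S.size) ∈ H s k → startAt (o + S.size) + 1 ∈ H (s + z.length) k := by
  have hlen : ∀ {s : ℕ} {z : List α}, s ≤ Q.length → z <+: Q.drop s → s + z.length ≤ Q.length := by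
    intro s z hs hz
    have := hz.length_le
    rw [List.length_drop] at this
    omega
  have happ : ∀ {s : ℕ} {x y : List α}, x ++ y <+: Q.drop s →
      x <+: Q.drop s ∧ y <+: Q.drop (s + x.length) := by
    rintro s x y ⟨t, ht⟩
    refine ⟨⟨y ++ t, by rw [← ht, List.append_assoc]⟩, t, ?_⟩
    rw [← List.drop_drop, ← ht, List.append_assoc, List.drop_left]
  have hedge : ∀ {S : Cut α} {k κ o : ℕ} {A : Language α}, k < K →
      (g k).tree.Occ (g k).lo (g k).ctx S κ o A → ∀ {s p q : ℕ}, s ≤ Q.length → p ∈ H s k →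
      ((S.micro β).thompson o).edge p none q → q ∈ H s k :=
    fun hk ho _ _ _ hs hp he => (hH _ hs).eps _ hk _ hp _ (ho.edge he)
  induction S with
  | char a =>
    rintro k κ o A hk ho s z hs hz rfl h
    obtain ⟨t, ht⟩ := hz
    have hs' : s < Q.length := by
      by_contra hcon
      rw [List.drop_eq_nil_of_le (by omega)] at ht
      simp at ht
    have : Q[s] = a := by
      have := List.drop_eq_getElem_cons hs'
      rw [← ht] at this
      exact (List.cons.inj this).1.symm
    refine hm s hs' k hk _ h _ (ho.edge ?_)
    simp only [micro, Regex.thompson, size, startAt]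
    exact ⟨by omega, by rw [this], by omega⟩
  | cat S T hS hT =>
    rintro k κ o A hk ho s z hs hz ⟨x, hx, y, hy, rfl⟩ h
    obtain ⟨hx', hy'⟩ := happ hz
    have e1 := S.micro_start β o; have e2 := S.micro_accept β o
    have e3 := T.micro_start β (o + S.size); have e4 := T.micro_accept β (o + S.size)
    have a1 := startAt_add S o; have a2 := startAt_add T (o + S.size)
    have a3 := startAt_add (S.cat T) o
    simp only [size] at a3 h ⊢
    have f1 : startAt (o + S.size) ∈ H s k := by
      refine hedge hk ho hs h (.inr (.inr ⟨rfl, .inl ⟨?_, ?_⟩⟩)) <;>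
        (try simp only [size_micro]) <;> omega
    have f2 := hS hk ho.catL s x hs hx' hx f1
    have hs2 := hlen hs hx'
    have f3 : startAt (o + S.size + T.size) ∈ H (s + x.length) k := by
      refine hedge hk ho hs2 f2 (.inr (.inr ⟨rfl, .inr (.inl ⟨?_, ?_⟩)⟩)) <;>
        (try simp only [size_micro]) <;> omega
    have f4 := hT hk ho.catR _ y hs2 hy' hy f3
    have hs3 := hlen hs2 hy'
    rw [List.length_append, ← add_assoc]
    refine hedge hk ho hs3 f4 (.inr (.inr ⟨rfl, .inr (.inr ⟨?_, ?_⟩)⟩)) <;>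
        (try simp only [size_micro]) <;> omega
  | alt S T hS hT =>
    rintro k κ o A hk ho s z hs hz hz' h
    have e1 := S.micro_start β o; have e2 := S.micro_accept β o
    have e3 := T.micro_start β (o + S.size); have e4 := T.micro_accept β (o + S.size)
    have a1 := startAt_add S o; have a2 := startAt_add T (o + S.size)
    have a3 := startAt_add (S.alt T) o
    have hs2 := hlen hs hz
    simp only [size] at a3 h ⊢
    rcases hz' with hz' | hz'
    · have f1 : startAt (o + S.size) ∈ H s k := by
        refine hedge hk ho hs h (.inr (.inr ⟨rfl, .inl ⟨?_, ?_⟩⟩)) <;>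
          (try simp only [size_micro]) <;> omega
      have f2 := hS hk ho.altL s z hs hz hz' f1
      refine hedge hk ho hs2 f2 (.inr (.inr ⟨rfl, .inr (.inr (.inl ⟨?_, ?_⟩))⟩)) <;>
        (try simp only [size_micro]) <;> omega
    · have f1 : startAt (o + S.size + T.size) ∈ H s k := by
        refine hedge hk ho hs h (.inr (.inr ⟨rfl, .inr (.inl ⟨?_, ?_⟩)⟩)) <;>
          (try simp only [size_micro]) <;> omega
      have f2 := hT hk ho.altR s z hs hz hz' f1
      refine hedge hk ho hs2 f2 (.inr (.inr ⟨rfl, .inr (.inr (.inr ⟨?_, ?_⟩))⟩)) <;>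
        (try simp only [size_micro]) <;> omega
  | star S hS =>
    rintro k κ o A hk ho s z hs hz hz' h
    have e1 := S.micro_start β o; have e2 := S.micro_accept β o
    have a1 := startAt_add S o
    have a3 := startAt_add S.star o
    simp only [size] at a3 h ⊢
    obtain ⟨l, rfl, hl⟩ := Language.mem_kstar.1 hz'
    clear hz'
    -- Between two factors both the start state of the operand and the accepting state of the star
    -- are in the set, so that one may either go on or stop.
    have key : ∀ (l : List (List α)) (s : ℕ), s ≤ Q.length → l.flatten <+: Q.drop s →
        (∀ y ∈ l, y ∈ S.erase.lang) → startAt (o + S.size) ∈ H s k →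
        startAt (o + (S.size + 1)) + 1 ∈ H s k →
        startAt (o + (S.size + 1)) + 1 ∈ H (s + l.flatten.length) k := by
      intro l
      induction l with
      | nil => intro s _ _ _ _ h; exact h
      | cons y l ih =>
        intro s hs hz hl h1 h2
        rw [List.flatten_cons] at hz ⊢
        obtain ⟨hy', hz'⟩ := happ hz
        have hs2 := hlen hs hy'
        have f2 := hS hk ho.star s y hs hy' (hl y (by simp)) h1
        rw [List.length_append, ← add_assoc]
        refine ih _ hs2 hz' (fun y hy => hl y (by simp [hy])) ?_ ?_
        · refine hedge hk ho hs2 f2 (.inr ⟨rfl, .inr (.inr (.inr ⟨?_, ?_⟩))⟩) <;>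
            omega
        · refine hedge hk ho hs2 f2 (.inr ⟨rfl, .inr (.inr (.inl ⟨?_, ?_⟩))⟩) <;>
            (try simp only [size_micro]) <;> omega
    refine key l s hs hz hl ?_ ?_
    · refine hedge hk ho hs h (.inr ⟨rfl, .inl ⟨?_, ?_⟩⟩) <;>
        (try simp only [size_micro]) <;> omega
    · refine hedge hk ho hs h (.inr ⟨rfl, .inr (.inl ⟨?_, ?_⟩)⟩) <;>
        (try simp only [size_micro]) <;> omega
  | hole S hS =>
    rintro k κ o A hk ho s z hs hz hz' h
    have hj := L.hole k hk _ _ _ _ ho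
    have hc := ho.cnt_le
    have hlo := L.lo k hk
    simp only [cnt] at hc
    have hjk : κ + S.cnt + 1 < K := by omega
    -- The word is read inside of the part for the hole, whose number is `κ + S.cnt`: through the
    -- entry link, along the path there, and back through the exit link. For this step the claim is
    -- made for all parts `k` at once.
    have h1 := (hH s hs).entry (κ + S.cnt) hjk
    have h2 := (hH _ (hlen hs hz)).exit (κ + S.cnt) hjk
    have h3 := hS (k := κ + S.cnt) (κ := κ) (o := 0) (A := A) (by omega)
      (by rw [hj]; exact .root) s z hs hz hz'
    simp only [start, hj] at h1 h2
    rw [zero_add] at h3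
    exact h2 (h3 (h1 h))

/-- Completeness only needs sets that are large enough, and soundness only sets all of whose states
are reached. So the sets need not be described exactly. -/
theorem mem_lang_iff (L : Layout T K g) {Q : List α} {H : ℕ → ℕ → Set ℕ}
    (hH : ∀ s ≤ Q.length, IsClosed K g β (H s))
    (hm : ∀ s (h : s < Q.length), ∀ j < K, ∀ p ∈ H s j, ∀ q, (auto g β j).edge p (some Q[s]) q →
      q ∈ H (s + 1) j)
    (h0 : start g (K - 1) ∈ H 0 (K - 1)) (hR : Reached K g Q (H Q.length)) :
    start g (K - 1) + 1 ∈ H Q.length (K - 1) ↔ Q ∈ T.erase.lang := by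
  have hK : K - 1 < K := by have := L.pos; omega
  constructor
  · intro h
    have := hR _ hK _ h
    rwa [pre_accept, L.tree_root, L.ctx_root, one_mul] at this
  · intro h
    have := L.path hH hm _ hK .root 0 Q (Nat.zero_le _) (by simp)
      (by rwa [L.tree_root]) (by rwa [zero_add])
    rwa [zero_add, zero_add] at this

/-! #### The two passes over the parts -/

/-- The parts below `j` have been closed from the bottom up, starting from `Y`. -/
structure UpTo (K : ℕ) (g : ℕ → Info α) (β : α) (Y : ℕ → Set ℕ) (u : List α) (j : ℕ)
    (Z : ℕ → Set ℕ) : Prop where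
  sub : ∀ i < K, Y i ⊆ Z i
  reached : Reached K g u Z
  eps : ∀ i < K, i < j → ∀ p ∈ Z i, ∀ q, (auto g β i).edge p none q → q ∈ Z i
  exit : ∀ i, i + 1 < K → i < j → start g i + 1 ∈ Z i → (g i).ent + 1 ∈ Z (g i).par

/-- All parts have been closed from the bottom up, and the parts from `j` on from the top down. -/
structure DownTo (K : ℕ) (g : ℕ → Info α) (β : α) (Y : ℕ → Set ℕ) (u : List α) (j : ℕ)
    (Z : ℕ → Set ℕ) : Prop extends UpTo K g β Y u K Z where
  entry : ∀ i, i + 1 < K → j ≤ i → (g i).ent ∈ Z (g i).par → start g i ∈ Z i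

theorem subset_close (A : FA α) (X : Set ℕ) : X ⊆ A.close X := fun p hp => ⟨p, hp, .refl⟩

theorem close_edge {A : FA α} {X : Set ℕ} {p q : ℕ} (hp : p ∈ A.close X) (h : A.edge p none q) :
    q ∈ A.close X := by
  obtain ⟨r, hr, hrp⟩ := hp
  exact ⟨r, hr, hrp.tail h⟩

variable {Y Z : ℕ → Set ℕ} {u : List α} {j : ℕ}

theorem UpTo.close (h : UpTo K g β Y u j Z) (hj : j < K) :
    let Z' := Function.update Z j ((auto g β j).close (Z j))
    (∀ i < K, Y i ⊆ Z' i) ∧ Reached K g u Z' ∧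
    (∀ i < K, i < j + 1 → ∀ p ∈ Z' i, ∀ q, (auto g β i).edge p none q → q ∈ Z' i) := by
  refine ⟨fun i hi => ?_, fun i hi => ?_, fun i hi hij => ?_⟩
  · by_cases hij : i = j
    · subst hij; rw [Function.update_self]; exact (h.sub i hi).trans (subset_close _ _)
    · rw [Function.update_of_ne hij]; exact h.sub i hi
  · by_cases hij : i = j
    · subst hij; rw [Function.update_self]; exact pre_close (h.reached i hi)
    · rw [Function.update_of_ne hij]; exact h.reached i hi
  · by_cases hij' : i = j
    · subst hij'; rw [Function.update_self]; exact fun p hp q => close_edge hp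
    · rw [Function.update_of_ne hij']; exact h.eps i hi (by omega)

theorem UpTo.succ (h : UpTo K g β Y u j Z) (hj : j < K)
    (hn : ¬(j + 1 < K ∧ start g j + 1 ∈ (auto g β j).close (Z j))) :
    UpTo K g β Y u (j + 1) (Function.update Z j ((auto g β j).close (Z j))) := by
  obtain ⟨h1, h2, h3⟩ := h.close hj
  refine ⟨h1, h2, h3, fun i hi hij hs => ?_⟩
  by_cases hij' : i = j
  · subst hij'; rw [Function.update_self] at hs; exact absurd ⟨hi, hs⟩ hn
  · rw [Function.update_of_ne hij'] at hs
    have := h.exit i hi (by omega) hs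
    by_cases hp : (g i).par = j
    · rw [hp] at this ⊢; rw [Function.update_self]; exact subset_close _ _ this
    · rwa [Function.update_of_ne hp]

/-- The parent has a larger number than `j`, so the inserted state does not spoil the closedness of
the parts up to `j`. -/
theorem UpTo.succ_insert (L : Layout T K g) (h : UpTo K g β Y u j Z) (hj : j + 1 < K)
    (hs : start g j + 1 ∈ (auto g β j).close (Z j)) :
    let Z' := Function.update Z j ((auto g β j).close (Z j))
    UpTo K g β Y u (j + 1)
      (Function.update Z' (g j).par (Z' (g j).par ∪ {(g j).ent + 1})) := by
  intro Z'
  obtain ⟨h1, h2, h3⟩ := h.close (by omega : j < K)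
  change ∀ i < K, Y i ⊆ Z' i at h1
  change Reached K g u Z' at h2
  change ∀ i < K, i < j + 1 → ∀ p ∈ Z' i, ∀ q, (auto g β i).edge p none q → q ∈ Z' i at h3
  have hpar := L.par_gt j hj
  have hmono : ∀ i, Z' i ⊆ Function.update Z' (g j).par (Z' (g j).par ∪ {(g j).ent + 1}) i := by
    intro i
    by_cases hi : i = (g j).par
    · rw [hi, Function.update_self]; exact Set.subset_union_left
    · rw [Function.update_of_ne hi]
  refine ⟨fun i hi => (h1 i hi).trans (hmono i), fun i hi q hq => ?_, fun i hi hij => ?_,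
    fun i hi hij hs' => ?_⟩
  · by_cases hip : i = (g j).par
    · subst hip
      rw [Function.update_self] at hq
      rcases hq with hq | rfl
      · exact h2 _ hi q hq
      · rw [(L.pre_ent hj).2, ← pre_accept]
        exact h2 j (by omega) _ (by simpa only [Z', Function.update_self] using hs)
    · rw [Function.update_of_ne hip] at hq; exact h2 i hi q hq
  · rw [Function.update_of_ne (by omega)]; exact h3 i hi hij
  · rw [Function.update_of_ne (by omega)] at hs'
    by_cases hij' : i = j
    · subst hij'; rw [Function.update_self]; exact .inr rfl
    · apply hmono
      simp only [Z', Function.update_of_ne hij'] at hs'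
      have := h.exit i hi (by omega) hs'
      by_cases hp : (g i).par = j
      · rw [hp] at this ⊢; simp only [Z', Function.update_self]; exact subset_close _ _ this
      · simpa only [Z', Function.update_of_ne hp]

theorem UpTo.downTo (h : UpTo K g β Y u K Z) : DownTo K g β Y u K Z :=
  ⟨h, fun i hi hij => by omega⟩

theorem close_union_singleton {A : FA α} {X : Set ℕ} {p : ℕ}
    (hX : ∀ p ∈ X, ∀ q, A.edge p none q → q ∈ X) :
    A.close (X ∪ {p}) ⊆ X ∪ A.close {p} := by
  rintro q ⟨r, hr, hrq⟩
  rcases hr with hr | rfl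
  · left
    induction hrq with
    | refl => exact hr
    | tail _ he ih => exact hX _ ih _ he
  · exact .inr ⟨r, rfl, hrq⟩

/-- This is why a single downward pass suffices. What is new in part `j` is reached from its start
state by `ε`-transitions. If the accepting state is among it, the part matches the empty word by
`nullable_of_close`, hence its stub has an `ε`-transition from entry to exit. The parent is closed
and holds the entry state, so it holds the exit state too, and nothing has to be passed up. The set
`X` is what part `j` contains just before it is closed. -/
theorem DownTo.step (L : Layout T K g) (h : DownTo K g β Y u (j + 1) Z) (hj : j < K)
    {X : Set ℕ} (hX : X = Z j ∨ j + 1 < K ∧ X = Z j ∪ {start g j} ∧ (g j).ent ∈ Z (g j).par)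
    (hX' : j + 1 < K → (g j).ent ∈ Z (g j).par → start g j ∈ X) :
    DownTo K g β Y u j (Function.update Z j ((auto g β j).close X)) := by
  have hZX : Z j ⊆ X := by
    rcases hX with rfl | ⟨-, rfl, -⟩
    · exact subset_rfl
    · exact Set.subset_union_left
  have hmono : ∀ i, Z i ⊆ Function.update Z j ((auto g β j).close X) i := by
    intro i
    by_cases hi : i = j
    · subst hi; rw [Function.update_self]; exact hZX.trans (subset_close _ _)
    · rw [Function.update_of_ne hi]
  refine ⟨⟨fun i hi => (h.sub i hi).trans (hmono i), fun i hi => ?_, fun i hi _ => ?_,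
    fun i hi _ hs => ?_⟩, fun i hi hji he => ?_⟩
  · by_cases hij : i = j
    · subst hij; rw [Function.update_self]
      refine pre_close fun p hp => ?_
      rcases hX with rfl | ⟨hi', rfl, he⟩
      · exact h.reached i hi p hp
      · rcases hp with hp | rfl
        · exact h.reached i hi p hp
        · rw [pre_start, ← (L.pre_ent hi').1]
          exact h.reached _ (L.par_lt i hi') _ he
    · rw [Function.update_of_ne hij]; exact h.reached i hi
  · by_cases hij : i = j
    · subst hij; rw [Function.update_self]; exact fun p hp q => close_edge hp
    · rw [Function.update_of_ne hij]; exact h.eps i hi hi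
  · have hpar := L.par_gt i hi
    by_cases hij : i = j
    · subst hij
      rw [Function.update_of_ne (by omega)]
      rw [Function.update_self] at hs
      have old := h.exit i hi (by omega)
      rcases hX with rfl | ⟨hi', rfl, he⟩
      · obtain ⟨p, hp, hpq⟩ := hs
        apply old
        generalize start g i + 1 = q at hpq
        induction hpq with
        | refl => exact hp
        | tail _ he ih => exact h.eps i hj hj _ ih _ he
      · rcases close_union_singleton (h.eps i hj hj) hs with hs | hs
        · exact old hs
        · have := start_add g i
          have hn : (g i).tree.erase.nullable := by
            refine nullable_of_close (β := β) ?_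
            rw [show 2 * (g i).tree.size - 1 = start g i + 1 by omega,
              show 2 * (g i).tree.size - 2 = start g i by omega]
            exact hs
          exact h.eps _ (L.par_lt i hi) (L.par_lt i hi) _ he _ (L.bypass hi hn)
    · rw [Function.update_of_ne hij] at hs
      exact hmono _ (h.exit i hi (by omega) hs)
  · have hpar := L.par_gt i hi
    rw [Function.update_of_ne (by omega)] at he
    by_cases hij : i = j
    · subst hij; rw [Function.update_self]; exact subset_close _ _ (hX' hi he)
    · rw [Function.update_of_ne hij]; exact h.entry i hi (by omega) he

theorem DownTo.isClosed (h : DownTo K g β Y u 0 Z) : IsClosed K g β Z :=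
  ⟨fun i hi => h.eps i hi hi, fun i hi => h.entry i hi (Nat.zero_le _),
    fun i hi => h.exit i hi (by omega)⟩

theorem upTo_zero (h : Reached K g u Y) : UpTo K g β Y u 0 Y :=
  ⟨fun _ _ => subset_rfl, h, fun _ _ h => absurd h (Nat.not_lt_zero _),
    fun _ _ h => absurd h (Nat.not_lt_zero _)⟩

end Layout

end Cut

/-! ### Codes of subexpressions and tables of sizes and nullability -/

namespace Regex

/-- The list `l` holds the code of the expression from node `o` on. -/
def CodeAt {w : ℕ} (l : List (BitVec w)) : Regex (BitVec w) → ℕ → Prop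
  | char a, o => (l.getD (2 * o) (BitVec.ofNat w 0)).toNat = 0 ∧ l.getD (2 * o + 1) (BitVec.ofNat w 0) = a
  | cat S T, o => S.CodeAt l o ∧ T.CodeAt l (o + S.size) ∧
      (l.getD (2 * (o + S.size + T.size)) (BitVec.ofNat w 0)).toNat = 1 ∧
      l.getD (2 * (o + S.size + T.size) + 1) (BitVec.ofNat w 0) = 0
  | alt S T, o => S.CodeAt l o ∧ T.CodeAt l (o + S.size) ∧
      (l.getD (2 * (o + S.size + T.size)) (BitVec.ofNat w 0)).toNat = 2 ∧
      l.getD (2 * (o + S.size + T.size) + 1) (BitVec.ofNat w 0) = 0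
  | star S, o => S.CodeAt l o ∧ (l.getD (2 * (o + S.size)) (BitVec.ofNat w 0)).toNat = 3 ∧
      l.getD (2 * (o + S.size) + 1) (BitVec.ofNat w 0) = 0

theorem getD_append_pair {β : Type} (l s l' : List β) (x y d : β) {i : ℕ}
    (hi : i = l.length + s.length) :
    (l ++ (s ++ [x, y] ++ l')).getD i d = x ∧ (l ++ (s ++ [x, y] ++ l')).getD (i + 1) d = y := by
  subst hi
  rw [← List.append_assoc, ← List.append_assoc, ← List.length_append, List.append_assoc]
  constructor
  · rw [List.getD_append_right _ _ _ _ le_rfl, Nat.sub_self]; rfl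
  · rw [List.getD_append_right _ _ _ _ (by omega), Nat.add_sub_cancel_left]; rfl

/-- A prefix and a suffix around the code make the induction go through. The words must be long
enough to tell the tags apart. -/
theorem codeAt_append {w : ℕ} (R : Regex (BitVec w)) (l l' : List (BitVec w)) (o : ℕ)
    (hl : l.length = 2 * o) (hw : 3 < 2 ^ w) : R.CodeAt (l ++ (R.code ++ l')) o := by
  induction R generalizing l l' o with
  | char a =>
    simp only [CodeAt, code]
    constructor <;> rw [List.getD_append_right _ _ _ _ (by omega)] <;> simp [hl]
  | cat S T hS hT =>
    have h1 := S.length_code; have h2 := T.length_code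
    have h3 := getD_append_pair l (S.code ++ T.code) l' (BitVec.ofNat w 1) 0 0
      (i := 2 * (o + S.size + T.size)) (by rw [List.length_append]; omega)
    refine ⟨?_, ?_, ?_, h3.2⟩
    · have := hS l (T.code ++ ([BitVec.ofNat w 1, 0] ++ l')) o hl
      simpa only [code, List.append_assoc] using this
    · have := hT (l ++ S.code) ([BitVec.ofNat w 1, 0] ++ l') (o + S.size)
        (by rw [List.length_append]; omega)
      simpa only [code, List.append_assoc] using this
    · exact (congrArg BitVec.toNat h3.1).trans (WordRAM.toNat_ofNat_of_lt (by omega))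
  | alt S T hS hT =>
    have h1 := S.length_code; have h2 := T.length_code
    have h3 := getD_append_pair l (S.code ++ T.code) l' (BitVec.ofNat w 2) 0 0
      (i := 2 * (o + S.size + T.size)) (by rw [List.length_append]; omega)
    refine ⟨?_, ?_, ?_, h3.2⟩
    · have := hS l (T.code ++ ([BitVec.ofNat w 2, 0] ++ l')) o hl
      simpa only [code, List.append_assoc] using this
    · have := hT (l ++ S.code) ([BitVec.ofNat w 2, 0] ++ l') (o + S.size)
        (by rw [List.length_append]; omega)
      simpa only [code, List.append_assoc] using this
    · exact (congrArg BitVec.toNat h3.1).trans (WordRAM.toNat_ofNat_of_lt (by omega))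
  | star S hS =>
    have h1 := S.length_code
    have h3 := getD_append_pair l S.code l' (BitVec.ofNat w 3) 0 0
      (i := 2 * (o + S.size)) (by omega)
    refine ⟨?_, (congrArg BitVec.toNat h3.1).trans (WordRAM.toNat_ofNat_of_lt hw), h3.2⟩
    have := hS l ([BitVec.ofNat w 3, 0] ++ l') o hl
    simpa only [code, List.append_assoc] using this

theorem codeAt_code {w : ℕ} (R : Regex (BitVec w)) (hw : 3 < 2 ^ w) : R.CodeAt R.code 0 := by
  simpa using R.codeAt_append [] [] 0 rfl hw

/-- Arrays `0` and `1` hold the size and the nullability of all subexpressions, at the number of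
their last nodes. -/
def Table {α : Type} (a : ℕ → ℕ → ℕ) : Regex α → ℕ → Prop
  | char _, o => a 0 o = 1 ∧ a 1 o = 0
  | cat S T, o => S.Table a o ∧ T.Table a (o + S.size) ∧
      a 0 (o + S.size + T.size) = S.size + T.size + 1 ∧
      a 1 (o + S.size + T.size) = (S.nullable && T.nullable).toNat
  | alt S T, o => S.Table a o ∧ T.Table a (o + S.size) ∧
      a 0 (o + S.size + T.size) = S.size + T.size + 1 ∧
      a 1 (o + S.size + T.size) = (S.nullable || T.nullable).toNat
  | star S, o => S.Table a o ∧ a 0 (o + S.size) = S.size + 1 ∧ a 1 (o + S.size) = 1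

theorem Table.root {α : Type} {a : ℕ → ℕ → ℕ} {R : Regex α} {o : ℕ} (h : R.Table a o) :
    a 0 (o + R.size - 1) = R.size ∧ a 1 (o + R.size - 1) = R.nullable.toNat := by
  cases R with
  | char _ => exact h
  | cat S T | alt S T =>
    simp only [size]
    rw [show o + (S.size + T.size + 1) - 1 = o + S.size + T.size by omega]
    exact h.2.2
  | star S => exact h.2

theorem Table.congr {α : Type} {a a' : ℕ → ℕ → ℕ} {R : Regex α} {o : ℕ} (h : R.Table a o)
    (h0 : ∀ i, o ≤ i → i < o + R.size → a' 0 i = a 0 i)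
    (h1 : ∀ i, o ≤ i → i < o + R.size → a' 1 i = a 1 i) : R.Table a' o := by
  induction R generalizing o with
  | char _ =>
    simp only [Table, size] at *
    rw [h0 o (by omega) (by omega), h1 o (by omega) (by omega)]
    exact h
  | cat S T hS hT | alt S T hS hT =>
    simp only [Table, size] at *
    rw [h0 _ (by omega) (by omega), h1 _ (by omega) (by omega)]
    exact ⟨hS h.1 (fun i _ _ => h0 i (by omega) (by omega)) fun i _ _ => h1 i (by omega) (by omega),
      hT h.2.1 (fun i _ _ => h0 i (by omega) (by omega)) fun i _ _ => h1 i (by omega) (by omega),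
      h.2.2⟩
  | star S hS =>
    simp only [Table, size] at *
    rw [h0 _ (by omega) (by omega), h1 _ (by omega) (by omega)]
    exact ⟨hS h.1 (fun i _ _ => h0 i (by omega) (by omega)) fun i _ _ => h1 i (by omega) (by omega),
      h.2⟩

end Regex

namespace WordRAM

/-! ### Variables -/

abbrev vM : ℕ := 0
abbrev vN : ℕ := 1
abbrev vX : ℕ := 2
abbrev vB : ℕ := 3
abbrev vY : ℕ := 4
abbrev vI : ℕ := 5
abbrev vTop : ℕ := 6
abbrev vK : ℕ := 7
abbrev vBlk : ℕ := 8
abbrev vTag : ℕ := 9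
abbrev vL : ℕ := 10
abbrev vT : ℕ := 11
abbrev vC : ℕ := 12
abbrev vJ : ℕ := 13
abbrev vR : ℕ := 14
abbrev vG : ℕ := 15

theorem Wp.whileC_lt_step {w : ℕ} {E : Env w} {i b : ℕ} {p : Prog} {Q : Store w → Prop}
    {h : Store w} (hi : i < 64) (hb : b < 64) (hn : h.v b < 2 ^ w) (hj : h.v i < h.v b)
    (H : p.wp E (Wp E (whileC E.r (.lt (.var i) (.var b)) p) Q) (h.tick 4)) :
    Wp E (whileC E.r (.lt (.var i) (.var b)) p) Q h := by
  have hval : (Expr.lt (.var i) (.var b)).val E h = 1 := by simp [Expr.val, hj]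
  refine whileC_step ⟨hi, hb, ?_, hn⟩ ?_ ?_ H
  · simp only [Expr.val]; omega
  · rw [hval]; omega
  · rw [hval]; omega

theorem Wp.whileC_lt_done {w : ℕ} {E : Env w} {i b : ℕ} {p : Prog} {Q : Store w → Prop}
    {h : Store w} (hi : i < 64) (hb : b < 64) (hn : h.v b < 2 ^ w) (hj : h.v i = h.v b)
    (H : Q (h.tick 4)) : Wp E (whileC E.r (.lt (.var i) (.var b)) p) Q h :=
  whileC_done ⟨hi, hb, by simp [Expr.val, hj, hn], by simp [Expr.val, hn]⟩
    (by simp [Expr.val, hj]) H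

/-! ### Sizes and nullability of the subexpressions -/

open WordRAM.Expr WordRAM.Prog in
-- In postorder the right operand ends at node `vI - 1`, and the left one ends before it, at `vI -
-- 1` minus the size of the right operand, which the table already holds.
def tableBody : Prog :=
  set vTag (inp 0 (mul (nat 2) (var vI))) ;;
  ite (eq (var vTag) (nat 0))
    (put 0 (var vI) (nat 1) ;; put 1 (var vI) (nat 0))
    (ite (eq (var vTag) (nat 3))
      (put 0 (var vI) (add (arr 0 (sub (var vI) (nat 1))) (nat 1)) ;; put 1 (var vI) (nat 1))
      (set vL (sub (sub (var vI) (nat 1)) (arr 0 (sub (var vI) (nat 1)))) ;;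
        put 0 (var vI) (add (add (arr 0 (var vL)) (arr 0 (sub (var vI) (nat 1)))) (nat 1)) ;;
        ite (eq (var vTag) (nat 1))
          (put 1 (var vI) (mul (arr 1 (var vL)) (arr 1 (sub (var vI) (nat 1)))))
          (put 1 (var vI)
            (lt (nat 0) (add (arr 1 (var vL)) (arr 1 (sub (var vI) (nat 1)))))))) ;;
  set vI (add (var vI) (nat 1))

def tableC (r : ℕ) : Cmd := whileC r (.lt (.var vI) (.var vM)) tableBody

/-- The program fragment from `h` to `h'` changes only variables from `n` on, and arrays in `s`. -/
structure Keeps {w : ℕ} (n : ℕ) (s : Set ℕ) (h h' : Store w) : Prop where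
  v : ∀ i < n, h'.v i = h.v i
  a : ∀ k ∉ s, h'.a k = h.a k
  m : h'.m = h.m

theorem Keeps.refl {w : ℕ} (n : ℕ) (s : Set ℕ) (h : Store w) : Keeps n s h h :=
  ⟨fun _ _ => rfl, fun _ _ => rfl, rfl⟩

theorem Keeps.trans {w n : ℕ} {s : Set ℕ} {h h' h'' : Store w} (H : Keeps n s h h')
    (H' : Keeps n s h' h'') : Keeps n s h h'' :=
  ⟨fun i hi => (H'.v i hi).trans (H.v i hi), fun k hk => (H'.a k hk).trans (H.a k hk),
    H'.m.trans H.m⟩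

theorem Keeps.tick {w n : ℕ} {s : Set ℕ} {h h' : Store w} (H : Keeps n s h h') {k : ℕ} :
    Keeps n s h (h'.tick k) := ⟨H.v, H.a, H.m⟩

theorem Keeps.setV {w n : ℕ} {s : Set ℕ} {h h' : Store w} (H : Keeps n s h h') {i x : ℕ}
    (hi : n ≤ i) : Keeps n s h (h'.setV i x) :=
  ⟨fun j hj => (Function.update_of_ne (by omega) _ _).trans (H.v j hj), H.a, H.m⟩

theorem Keeps.setA {w n : ℕ} {s : Set ℕ} {h h' : Store w} (H : Keeps n s h h') {k i x : ℕ}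
    (hk : k ∈ s) : Keeps n s h (h'.setA k i x) :=
  ⟨H.v, fun l hl => (Function.update_of_ne (by rintro rfl; exact hl hk) _ _).trans (H.a l hl), H.m⟩

attribute [simp] vM vN vX vB vY vI vTop vK vBlk vTag vL vT vC vJ vR vG

/-- The loop is flat while the proof is by recursion on `S`. The two are reconciled by
continuations: it suffices to treat the rest of the loop from any store in which `S` has been
processed. The claims for the operands then chain, and one more round treats the operator. The later
loops over the nodes are verified in the same way. -/
theorem table_loop {w : ℕ} {E : Env w} (hw : 64 ≤ 2 ^ w) {m : ℕ} (hm : 2 * m < 2 ^ w)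
    (hmN : m ≤ E.N) (S : Regex (BitVec w)) : ∀ (o : ℕ) (h : Store w) (Q : Store w → Prop),
    S.CodeAt (E.inp 0) o → h.v vI = o → h.v vM = m → o + S.size ≤ m →
    (∀ h', h'.v vI = o + S.size → Keeps 5 {0, 1} h h' → S.Table h'.a o →
      (∀ k, ∀ i < o, h'.a k i = h.a k i) → h'.clk ≤ h.clk + 200 * S.size →
      Wp E (tableC E.r) Q h') →
    Wp E (tableC E.r) Q h := by
  have h1l : 1 < 2 ^ w := by omega
  have h2l : 2 < 2 ^ w := by omega
  have h3l : 3 < 2 ^ w := by omega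
  induction S with
  | char a =>
    intro o h Q hc hI hM ho H
    simp only [Regex.size] at ho H
    refine Wp.whileC_lt_step (by norm_num) (by norm_num) (by omega) (by omega) ?_
    change tableBody.wp E (Wp E (tableC E.r) Q) _
    have hoN : o < E.N := by omega
    have ho2 : 2 * o < 2 ^ w := by omega
    have t1 := hc.1
    simp only [vI] at hI
    simp [tableBody, Prog.wp, Expr.val, Expr.Ok, Expr.cost, -List.getD_eq_getElem?_getD, t1, hI,
      hoN, ho2, h1l]
    refine H _ ?_ ?_ ?_ ?_ ?_
    · simp
    · repeat' first
        | exact Keeps.refl _ _ _ | refine Keeps.tick ?_ | refine Keeps.setV ?_ (by norm_num)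
        | refine Keeps.setA ?_ (by simp)
    · simp [Regex.Table]
    · intro k i hi
      simp [Function.update_apply]
      grind
    · simp
  | star S hS =>
    intro o h Q hc hI hM ho H
    simp only [Regex.size] at ho H
    refine hS o h Q hc.1 hI hM (by omega) fun h1 a1 a2 a3 a4 a5 => ?_
    have := S.size_pos
    have hM1 := (a2.v vM (by norm_num)).trans hM
    refine Wp.whileC_lt_step (by norm_num) (by norm_num) (by omega) (by omega) ?_
    change tableBody.wp E (Wp E (tableC E.r) Q) _
    obtain ⟨r1, r2⟩ := a3.root
    have hoN : o + S.size < E.N := by omega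
    have ho2 : 2 * (o + S.size) < 2 ^ w := by omega
    have ho3 : 1 ≤ o + S.size := by omega
    have ho4 : o + S.size - 1 < E.N := by omega
    have t1 := hc.2.1
    simp only [vI] at a1
    simp [tableBody, Prog.wp, Expr.val, Expr.Ok, Expr.cost, -List.getD_eq_getElem?_getD, t1, a1,
      hoN, ho2, h1l, h3l, ho3, ho4, r1]
    refine H _ ?_ ?_ ?_ ?_ ?_
    · simp; omega
    · repeat' first
        | exact a2 | refine Keeps.tick ?_ | refine Keeps.setV ?_ (by norm_num)
        | refine Keeps.setA ?_ (by simp)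
    · refine ⟨a3.congr ?_ ?_, ?_, ?_⟩
      · intro i hi hi'; simp [hi'.ne]
      · intro i hi hi'; simp [hi'.ne]
      · simp
      · simp
    · intro k i hi
      have : i ≠ o + S.size := by omega
      simp [Function.update_apply]
      have := a4 k i hi
      grind
    · simp; omega
  | cat S T hS hT | alt S T hS hT =>
    intro o h Q hc hI hM ho H
    simp only [Regex.size] at ho H
    refine hS o h Q hc.1 hI hM (by omega) fun h1 a1 a2 a3 a4 a5 => ?_
    have := S.size_pos; have := T.size_pos
    have hM1 := (a2.v vM (by norm_num)).trans hM
    refine hT (o + S.size) h1 Q hc.2.1 a1 hM1 (by omega) fun h2 b1 b2 b3 b4 b5 => ?_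
    have hM2 := (b2.v vM (by norm_num)).trans hM1
    refine Wp.whileC_lt_step (by norm_num) (by norm_num) (by omega) (by omega) ?_
    change tableBody.wp E (Wp E (tableC E.r) Q) _
    have a3' : S.Table h2.a o := a3.congr (fun i _ hi => b4 0 i hi) fun i _ hi => b4 1 i hi
    obtain ⟨r1, r2⟩ := a3'.root
    obtain ⟨r3, r4⟩ := b3.root
    have hoN : o + S.size + T.size < E.N := by omega
    have ho2 : 2 * (o + S.size + T.size) < 2 ^ w := by omega
    have ho3 : 1 ≤ o + S.size + T.size := by omega
    have ho4 : o + S.size + T.size - 1 < E.N := by omega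
    have ho5 : T.size ≤ o + S.size + T.size - 1 := by omega
    have ho6 : o + S.size + T.size - 1 - T.size = o + S.size - 1 := by omega
    have ho7 : o + S.size - 1 < E.N := by omega
    have t1 := hc.2.2.1
    have hbS := Bool.toNat_lt S.nullable
    have hbT := Bool.toNat_lt T.nullable
    have hbST : S.nullable.toNat + T.nullable.toNat < 2 ^ w := by omega
    simp only [vI] at b1
    simp [tableBody, Prog.wp, Expr.val, Expr.Ok, Expr.cost, -List.getD_eq_getElem?_getD, t1, b1,
      hoN, ho2, h1l, h2l, h3l, ho3, ho4, ho5, ho6, ho7, r1, r2, r3, r4, hbST]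
    refine H _ ?_ ?_ ?_ ?_ ?_
    · simp; omega
    · repeat' first
        | exact a2.trans b2 | refine Keeps.tick ?_ | refine Keeps.setV ?_ (by norm_num)
        | refine Keeps.setA ?_ (by simp)
    · refine ⟨a3'.congr ?_ ?_, b3.congr ?_ ?_, ?_, ?_⟩
      · intro i hi hi'
        have : i ≠ o + S.size + T.size := by omega
        simp [this]
      · intro i hi hi'
        have : i ≠ o + S.size + T.size := by omega
        simp [this]
      · intro i hi hi'; simp [hi'.ne]
      · intro i hi hi'; simp [hi'.ne]
      · simp
      · cases S.nullable <;> cases T.nullable <;> simp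
    · intro k i hi
      have : i ≠ o + S.size + T.size := by omega
      simp [Function.update_apply]
      have := a4 k i hi
      have := b4 k i (by omega)
      grind
    · simp; omega

end WordRAM

/-! ### Recursion for nonempty matches -/

namespace Regex

variable {α : Type}

/-- The nonempty words of an expression. -/
def proper (R : Regex α) : Language α := {z | z ∈ R.lang ∧ z ≠ []}

/-- The empty match is separated because it depends on nullability alone. A nonempty match of an
operator comes from a nonempty match of an operand, so that marks can be computed in one pass even
through stars. -/
theorem mem_mul_lang_iff (R : Regex α) (A : Language α) (u : List α) :
    u ∈ A * R.lang ↔ (u ∈ A ∧ R.nullable = true) ∨ u ∈ A * R.proper := by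
  rw [nullable_iff]
  constructor
  · rintro ⟨x, hx, y, hy, rfl⟩
    by_cases h : y = []
    · subst h; exact .inl ⟨by simpa using (show x ∈ A from hx), hy⟩
    · exact .inr ⟨x, hx, y, ⟨hy, h⟩, rfl⟩
  · rintro (⟨h1, h2⟩ | ⟨x, hx, y, hy, rfl⟩)
    · exact ⟨u, h1, [], h2, List.append_nil u⟩
    · exact ⟨x, hx, y, hy.1, rfl⟩

theorem mem_proper_char (a : α) (A : Language α) (u : List α) :
    u ∈ A * (char a).proper ↔ u ∈ A * {[a]} := by
  have : (char a).proper = {[a]} := by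
    ext z
    exact ⟨fun h => h.1, fun h => ⟨h, by rintro rfl; cases h⟩⟩
  rw [this]

/-- The cases are whether the word for `T` is nonempty or empty. -/
theorem mem_proper_cat (S T : Regex α) (A : Language α) (u : List α) :
    u ∈ A * (cat S T).proper ↔
      u ∈ A * S.lang * T.proper ∨ (u ∈ A * S.proper ∧ T.nullable = true) := by
  rw [nullable_iff]
  constructor
  · rintro ⟨x, hx, _, ⟨⟨y, hy, z, hz, rfl⟩, h⟩, rfl⟩
    by_cases h' : z = []
    · subst h'
      refine .inr ⟨⟨x, hx, y, ⟨hy, by simpa using h⟩, by simp⟩, hz⟩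
    · exact .inl ⟨x ++ y, ⟨x, hx, y, hy, rfl⟩, z, ⟨hz, h'⟩, by simp⟩
  · rintro (⟨_, ⟨x, hx, y, hy, rfl⟩, z, hz, rfl⟩ | ⟨⟨x, hx, y, hy, rfl⟩, hT⟩)
    · exact ⟨x, hx, y ++ z, ⟨⟨y, hy, z, hz.1, rfl⟩, by simp [hz.2]⟩, by simp⟩
    · exact ⟨x, hx, y, ⟨⟨y, hy.1, [], hT, by simp⟩, hy.2⟩, rfl⟩

theorem mem_proper_alt (S T : Regex α) (A : Language α) (u : List α) :
    u ∈ A * (alt S T).proper ↔ u ∈ A * S.proper ∨ u ∈ A * T.proper := by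
  constructor
  · rintro ⟨x, hx, y, ⟨h | h, h'⟩, rfl⟩
    · exact .inl ⟨x, hx, y, ⟨h, h'⟩, rfl⟩
    · exact .inr ⟨x, hx, y, ⟨h, h'⟩, rfl⟩
  · rintro (⟨x, hx, y, hy, rfl⟩ | ⟨x, hx, y, hy, rfl⟩)
    · exact ⟨x, hx, y, ⟨.inl hy.1, hy.2⟩, rfl⟩
    · exact ⟨x, hx, y, ⟨.inr hy.1, hy.2⟩, rfl⟩

/-- The last nonempty factor is a match of `S`; all earlier factors belong to the words that lead to
`S`. -/
theorem mem_proper_star (S : Regex α) (A : Language α) (u : List α) :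
    u ∈ A * (star S).proper ↔ u ∈ A * KStar.kstar S.lang * S.proper := by
  constructor
  · rintro ⟨x, hx, y, ⟨h, h'⟩, rfl⟩
    obtain ⟨l, rfl, hl⟩ := Language.mem_kstar_iff_exists_nonempty.1 h
    rcases List.eq_nil_or_concat l with rfl | ⟨l, z, rfl⟩
    · simp at h'
    · refine ⟨x ++ l.flatten, ⟨x, hx, l.flatten, ?_, rfl⟩, z, hl z (by simp), by simp⟩
      exact Language.join_mem_kstar fun y hy => (hl y (by simp [hy])).1
  · rintro ⟨_, ⟨x, hx, y, hy, rfl⟩, z, hz, rfl⟩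
    refine ⟨x, hx, y ++ z, ⟨?_, by simp [hz.2]⟩, by simp⟩
    exact kstar_mul_le_kstar (a := S.lang) ⟨y, hy, z, hz.1, rfl⟩

theorem mem_mul_kstar_iff (S : Regex α) (A : Language α) (u : List α) :
    u ∈ A * KStar.kstar S.lang ↔ u ∈ A ∨ u ∈ A * KStar.kstar S.lang * S.proper := by
  have := (star S).mem_mul_lang_iff A u
  rw [mem_proper_star] at this
  simpa [nullable, lang] using this

theorem append_mem_mul_singleton (A : Language α) (u : List α) (a c : α) :
    u ++ [c] ∈ A * {[a]} ↔ u ∈ A ∧ c = a := by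
  constructor
  · rintro ⟨x, hx, y, rfl, h⟩
    have := List.append_inj' h rfl
    obtain ⟨rfl, h⟩ := this
    exact ⟨hx, by simpa using h.symm⟩
  · rintro ⟨h, rfl⟩
    exact ⟨u, h, [c], rfl, rfl⟩

/-- The truth value of a proposition. -/
noncomputable def ind (p : Prop) : ℕ := open Classical in if p then 1 else 0

theorem ind_lt (p : Prop) : ind p < 2 := by unfold ind; split_ifs <;> omega

theorem ind_pos (p : Prop) : 0 < ind p ↔ p := by unfold ind; split_ifs <;> simp_all

theorem ind_true {p : Prop} (h : p) : ind p = 1 := by simp [ind, h]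

theorem ind_false {p : Prop} (h : ¬p) : ind p = 0 := by simp [ind, h]

/-- At the number of its last node, `f` tells for every subexpression whether the word `u` is the
concatenation of a word that leads to the subexpression and a nonempty word that matches it, if the
words in `A` lead to the expression itself. -/
def Marks (f : ℕ → ℕ) (u : List α) : Regex α → ℕ → Language α → Prop
  | char a, o, A => f o = ind (u ∈ A * (char a).proper)
  | cat S T, o, A => S.Marks f u o A ∧ T.Marks f u (o + S.size) (A * S.lang) ∧
      f (o + S.size + T.size) = ind (u ∈ A * (cat S T).proper)
  | alt S T, o, A => S.Marks f u o A ∧ T.Marks f u (o + S.size) A ∧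
      f (o + S.size + T.size) = ind (u ∈ A * (alt S T).proper)
  | star S, o, A => S.Marks f u o (A * KStar.kstar S.lang) ∧
      f (o + S.size) = ind (u ∈ A * (star S).proper)

/-- The same for the characters of the expression only. -/
def LeafMarks (f : ℕ → ℕ) (u : List α) : Regex α → ℕ → Language α → Prop
  | char a, o, A => f o = ind (u ∈ A * (char a).proper)
  | cat S T, o, A => S.LeafMarks f u o A ∧ T.LeafMarks f u (o + S.size) (A * S.lang)
  | alt S T, o, A => S.LeafMarks f u o A ∧ T.LeafMarks f u (o + S.size) A
  | star S, o, A => S.LeafMarks f u o (A * KStar.kstar S.lang)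

theorem Marks.root {f : ℕ → ℕ} {u : List α} {R : Regex α} {o : ℕ} {A : Language α}
    (h : R.Marks f u o A) : f (o + R.size - 1) = ind (u ∈ A * R.proper) := by
  cases R with
  | char _ => exact h
  | cat S T | alt S T =>
    simp only [size]
    rw [show o + (S.size + T.size + 1) - 1 = o + S.size + T.size by omega]
    exact h.2.2
  | star S => exact h.2

theorem Marks.congr {f f' : ℕ → ℕ} {u : List α} {R : Regex α} {o : ℕ} {A : Language α}
    (h : R.Marks f u o A) (hf : ∀ i, o ≤ i → i < o + R.size → f' i = f i) :
    R.Marks f' u o A := by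
  induction R generalizing o A with
  | char _ => simp only [Marks, size] at *; rw [hf o (by omega) (by omega), h]
  | cat S T hS hT | alt S T hS hT =>
    simp only [Marks, size] at *
    rw [hf _ (by omega) (by omega)]
    exact ⟨hS h.1 fun i _ _ => hf i (by omega) (by omega),
      hT h.2.1 fun i _ _ => hf i (by omega) (by omega), h.2.2⟩
  | star S hS =>
    simp only [Marks, size] at *
    rw [hf _ (by omega) (by omega)]
    exact ⟨hS h.1 fun i _ _ => hf i (by omega) (by omega), h.2⟩

theorem LeafMarks.congr {f f' : ℕ → ℕ} {u : List α} {R : Regex α} {o : ℕ} {A : Language α}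
    (h : R.LeafMarks f u o A) (hf : ∀ i, o ≤ i → i < o + R.size → f' i = f i) :
    R.LeafMarks f' u o A := by
  induction R generalizing o A with
  | char _ => simp only [LeafMarks, size] at *; rw [hf o (by omega) (by omega), h]
  | cat S T hS hT | alt S T hS hT =>
    simp only [LeafMarks, size] at *
    exact ⟨hS h.1 fun i _ _ => hf i (by omega) (by omega),
      hT h.2 fun i _ _ => hf i (by omega) (by omega)⟩
  | star S hS => exact hS h fun i _ _ => hf i (by omega) (by simp only [size]; omega)

theorem marks_nil {f : ℕ → ℕ} {R : Regex α} {o : ℕ} {A : Language α}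
    (hf : ∀ i, o ≤ i → i < o + R.size → f i = 0) : R.Marks f [] o A := by
  have key : ∀ (R : Regex α) (A : Language α), ind ([] ∈ A * R.proper) = 0 := by
    refine fun R A => ind_false ?_
    rintro ⟨x, -, y, hy, h⟩
    exact hy.2 (List.append_eq_nil_iff.1 h).2
  induction R generalizing o A with
  | char _ => simp only [Marks, size] at *; rw [hf o (by omega) (by omega), key]
  | cat S T hS hT | alt S T hS hT =>
    simp only [Marks, size] at *
    rw [hf _ (by omega) (by omega), key]
    exact ⟨hS fun i _ _ => hf i (by omega) (by omega),
      hT fun i _ _ => hf i (by omega) (by omega), rfl⟩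
  | star S hS =>
    simp only [Marks, size] at *
    rw [hf _ (by omega) (by omega), key]
    exact ⟨hS fun i _ _ => hf i (by omega) (by omega), rfl⟩

end Regex

namespace WordRAM

/-! ### Direct simulation -/

open WordRAM.Expr WordRAM.Prog in
/-- One step of the pass that propagates the marks downwards. -/
def downBody : Prog :=
  set vI (sub (var vI) (nat 1)) ;;
  set vTag (inp 0 (mul (nat 2) (var vI))) ;;
  ite (eq (var vTag) (nat 0))
    (ite (arr 3 (var vI))
      (put 4 (var vI) (eq (inp 0 (add (mul (nat 2) (var vI)) (nat 1))) (var vC)))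
      (put 4 (var vI) (nat 0)))
    (set vJ (sub (var vI) (nat 1)) ;;
      ite (eq (var vTag) (nat 3))
        -- Array `3` tells whether the word read so far leads to a subexpression. The marks in array
        -- `4` of the operand are not yet overwritten, so they refer to the same word.
        (put 3 (var vJ) (lt (nat 0) (add (arr 3 (var vI)) (arr 4 (var vJ)))))
        (set vL (sub (var vJ) (arr 0 (var vJ))) ;;
          put 3 (var vL) (arr 3 (var vI)) ;;
          ite (eq (var vTag) (nat 1))
            (put 3 (var vJ)
              (lt (nat 0) (add (mul (arr 3 (var vI)) (arr 1 (var vL))) (arr 4 (var vL)))))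
            (put 3 (var vJ) (arr 3 (var vI)))))

def downC (r : ℕ) : Cmd := whileC r (.var vI) downBody

theorem Wp.whileC_var_step {w : ℕ} {E : Env w} {i : ℕ} {p : Prog} {Q : Store w → Prop}
    {h : Store w} (hi : i < 64) (hn : h.v i < 2 ^ w) (hj : 0 < h.v i)
    (H : p.wp E (Wp E (whileC E.r (.var i) p) Q) (h.tick 2)) :
    Wp E (whileC E.r (.var i) p) Q h :=
  whileC_step hi hn hj.ne' H

open Regex

/-- Arrays of `h` and `h'` differ at most in entries from `o` to `e`. -/
def SameOff {w : ℕ} (o e : ℕ) (h h' : Store w) : Prop :=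
  ∀ k i, i < o ∨ e ≤ i → h'.a k i = h.a k i

/-- Reverse postorder sets the flag of a subexpression before it is visited, and visits the right
operand while the marks of the left one, on which its flag depends, still refer to `u`. Only the
characters get marks for `u ++ [c]`; the marks of operators become obsolete and are renewed by the
upward pass. -/
theorem down_loop {w : ℕ} {E : Env w} (hw : 64 ≤ 2 ^ w) {m : ℕ} (hm : 2 * m < 2 ^ w)
    (hmN : m ≤ E.N) {u : List (BitVec w)} {c : BitVec w} (S : Regex (BitVec w)) :
    ∀ (o : ℕ) (A : Language (BitVec w)) (h : Store w) (Q : Store w → Prop),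
    S.CodeAt (E.inp 0) o → S.Table h.a o → h.v vI = o + S.size → h.v vC = c.toNat →
    o + S.size ≤ m → S.Marks (h.a 4) u o A → h.a 3 (o + S.size - 1) = ind (u ∈ A) →
    (∀ h', h'.v vI = o → h'.v vC = c.toNat → h'.v vT = h.v vT → Keeps 5 {3, 4} h h' →
      S.LeafMarks (h'.a 4) (u ++ [c]) o A →
      SameOff o (o + S.size) h h' → h'.clk ≤ h.clk + 200 * S.size →
      Wp E (downC E.r) Q h') →
    Wp E (downC E.r) Q h := by
  have h1l : 1 < 2 ^ w := by omega
  have h2l : 2 < 2 ^ w := by omega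
  have h3l : 3 < 2 ^ w := by omega
  have hil : ∀ p : Prop, ind p < 2 ^ w := fun p => (ind_lt p).trans (by omega)
  induction S with
  | char a =>
    intro o A h Q hc hT hI hC ho hM hE H
    simp only [Regex.size] at ho H hI
    refine Wp.whileC_var_step (by norm_num) (by omega) (by omega) ?_
    change downBody.wp E (Wp E (downC E.r) Q) _
    have hoN : o < E.N := by omega
    have ho2 : 2 * o < 2 ^ w := by omega
    have ho3 : 2 * o + 1 < 2 ^ w := by omega
    obtain ⟨t1, t2⟩ := hc
    simp only [vI, vC] at hI hC
    replace hE : h.a 3 o = ind (u ∈ A) := hE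
    have hcl : c.toNat < 2 ^ w := c.isLt
    have hal : a.toNat < 2 ^ w := a.isLt
    by_cases hu : u ∈ A
    · simp [downBody, Prog.wp, Expr.val, Expr.Ok, Expr.cost, -List.getD_eq_getElem?_getD, t1, t2,
        hI, hoN, ho2, ho3, h1l, hE, hC, ind_true hu, hcl, hal]
      refine H _ ?_ ?_ ?_ ?_ ?_ ?_ ?_
      · simp
      · simp [hC]
      · simp
      · repeat' first
          | exact Keeps.refl _ _ _ | refine Keeps.tick ?_ | refine Keeps.setV ?_ (by norm_num)
          | refine Keeps.setA ?_ (by simp)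
      · simp only [LeafMarks, mem_proper_char, append_mem_mul_singleton]
        simp [ind, hu, BitVec.toNat_inj, eq_comm]
      · intro k i hi
        simp [Function.update_apply]
        grind
      · simp
    · simp [downBody, Prog.wp, Expr.val, Expr.Ok, Expr.cost, -List.getD_eq_getElem?_getD, t1, t2,
        hI, hoN, ho2, ho3, h1l, hE, hC, ind_false hu, hcl, hal]
      refine H _ ?_ ?_ ?_ ?_ ?_ ?_ ?_
      · simp
      · simp [hC]
      · simp
      · repeat' first
          | exact Keeps.refl _ _ _ | refine Keeps.tick ?_ | refine Keeps.setV ?_ (by norm_num)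
          | refine Keeps.setA ?_ (by simp)
      · simp only [LeafMarks, mem_proper_char, append_mem_mul_singleton]
        simp [ind, hu]
      · intro k i hi
        simp [Function.update_apply]
        grind
      · simp
  | star S hS =>
    intro o A h Q hc hT hI hC ho hM hE H
    simp only [Regex.size] at ho H hI
    refine Wp.whileC_var_step (by norm_num) (by omega) (by omega) ?_
    change downBody.wp E (Wp E (downC E.r) Q) _
    have hS0 := S.size_pos
    have hoN : o + S.size < E.N := by omega
    have ho2 : 2 * (o + S.size) < 2 ^ w := by omega
    have ho3 : 1 ≤ o + S.size := by omega
    have ho4 : o + S.size - 1 < E.N := by omega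
    have t1 := hc.2.1
    rw [← add_assoc] at hI
    simp only [vI, vC] at hI hC
    replace hE : h.a 3 (o + S.size) = ind (u ∈ A) := hE
    have hR := hM.1.root
    have hil2 : ∀ p q : Prop, ind p + ind q < 2 ^ w := fun p q => by
      have := ind_lt p; have := ind_lt q; omega
    simp [downBody, Prog.wp, Expr.val, Expr.Ok, Expr.cost, -List.getD_eq_getElem?_getD, t1,
      hI, hoN, ho2, ho3, ho4, h1l, h3l, hE, hil, hil2, hR]
    refine hS o _ _ Q hc.1 (hT.1.congr ?_ ?_) ?_ ?_ (by omega) (hM.1.congr ?_) ?_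
      fun h' b1 b2 b3 b4 b5 b6 b7 => H h' b1 b2 ?_ ?_ b5 ?_ ?_
    · intros; simp
    · intros; simp
    · simp
    · simp [hC]
    · intros; simp
    · simp only [mem_mul_kstar_iff]
      by_cases h1 : u ∈ A <;> by_cases h2 : u ∈ A * KStar.kstar S.lang * S.proper <;>
        simp [ind, h1, h2]
    · rw [b3]; simp
    · refine Keeps.trans ?_ b4
      repeat' first
        | exact Keeps.refl _ _ _ | refine Keeps.tick ?_ | refine Keeps.setV ?_ (by norm_num)
        | refine Keeps.setA ?_ (by simp)
    · intro k i hi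
      rw [b6 k i (by omega)]
      have : i ≠ o + S.size - 1 := by omega
      simp [Function.update_apply]
      grind
    · simp at b7; omega
  | cat S T hS hT' =>
    intro o A h Q hc hT hI hC ho hM hE H
    simp only [Regex.size] at ho H hI
    refine Wp.whileC_var_step (by norm_num) (by omega) (by omega) ?_
    change downBody.wp E (Wp E (downC E.r) Q) _
    have hS0 := S.size_pos
    have hT0 := T.size_pos
    have hoN : o + S.size + T.size < E.N := by omega
    have ho2 : 2 * (o + S.size + T.size) < 2 ^ w := by omega
    have ho3 : 1 ≤ o + S.size + T.size := by omega
    have ho4 : o + S.size + T.size - 1 < E.N := by omega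
    have ho5 : T.size ≤ o + S.size + T.size - 1 := by omega
    have ho6 : o + S.size + T.size - 1 - T.size = o + S.size - 1 := by omega
    have ho7 : o + S.size - 1 < E.N := by omega
    have ho9 : o + S.size + T.size ≠ o + S.size - 1 := by omega
    have ho10 : o + S.size - 1 ≠ o + S.size + T.size - 1 := by omega
    have t1 := hc.2.2.1
    rw [← add_assoc, ← add_assoc] at hI
    simp only [vI, vC] at hI hC
    replace hE : h.a 3 (o + S.size + T.size) = ind (u ∈ A) := by
      rw [← hE]; congr 1; simp only [Regex.size]; omega
    have hR := hM.1.root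
    obtain ⟨r1, r2⟩ := hT.1.root
    obtain ⟨r3, r4⟩ := hT.2.1.root
    have hil2 : ind (u ∈ A) * S.nullable.toNat + ind (u ∈ A * S.proper) < 2 ^ w := by
      have := ind_lt (u ∈ A * S.proper)
      have h3 := Nat.mul_le_mul (Nat.le_of_lt_succ (ind_lt (u ∈ A)))
        (Nat.le_of_lt_succ (Bool.toNat_lt S.nullable))
      omega
    simp [downBody, Prog.wp, Expr.val, Expr.Ok, Expr.cost, -List.getD_eq_getElem?_getD, t1,
      hI, hoN, ho2, ho3, ho4, ho5, ho6, ho7, ho9, h1l, h3l, hE, hil, hil2, hR, r2,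
      r3]
    refine hT' (o + S.size) _ _ Q hc.2.1 (hT.2.1.congr ?_ ?_) ?_ ?_ (by omega) (hM.2.1.congr ?_) ?_
      fun h1 b1 b2 b3 b4 b5 b6 b7 => hS o A h1 Q hc.1 (hT.1.congr ?_ ?_) b1 b2 (by omega)
        (hM.1.congr ?_) ?_ fun h2 c1 c2 c3 c4 c5 c6 c7 => H h2 c1 c2 ?_ ?_ ⟨c5, b5.congr ?_⟩ ?_ ?_
    · intros; simp
    · intros; simp
    · simp
    · simp [hC]
    · intros; simp
    · simp only [mem_mul_lang_iff]
      by_cases h1 : u ∈ A <;> by_cases h2 : u ∈ A * S.proper <;> cases hn : S.nullable <;>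
        simp [ind, h1, h2]
    · intro i hi hi'; rw [b4.a 0 (by simp)]; simp
    · intro i hi hi'; rw [b4.a 1 (by simp)]; simp
    · intro i hi hi'; rw [b6 4 i (by omega)]; simp
    · rw [b6 3 _ (by omega)]; simp [ho10]
    · rw [c3, b3]; simp
    · refine Keeps.trans (Keeps.trans ?_ b4) c4
      repeat' first
        | exact Keeps.refl _ _ _ | refine Keeps.tick ?_ | refine Keeps.setV ?_ (by norm_num)
        | refine Keeps.setA ?_ (by simp)
    · intro i hi hi'; exact c6 4 i (by omega)
    · intro k i hi
      rw [c6 k i (by omega), b6 k i (by omega)]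
      have : i ≠ o + S.size - 1 := by omega
      have : i ≠ o + S.size + T.size - 1 := by omega
      simp [Function.update_apply]
      grind
    · simp at b7; omega
  | alt S T hS hT' =>
    intro o A h Q hc hT hI hC ho hM hE H
    simp only [Regex.size] at ho H hI
    refine Wp.whileC_var_step (by norm_num) (by omega) (by omega) ?_
    change downBody.wp E (Wp E (downC E.r) Q) _
    have hS0 := S.size_pos
    have hT0 := T.size_pos
    have hoN : o + S.size + T.size < E.N := by omega
    have ho2 : 2 * (o + S.size + T.size) < 2 ^ w := by omega
    have ho3 : 1 ≤ o + S.size + T.size := by omega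
    have ho4 : o + S.size + T.size - 1 < E.N := by omega
    have ho5 : T.size ≤ o + S.size + T.size - 1 := by omega
    have ho6 : o + S.size + T.size - 1 - T.size = o + S.size - 1 := by omega
    have ho7 : o + S.size - 1 < E.N := by omega
    have ho9 : o + S.size + T.size ≠ o + S.size - 1 := by omega
    have ho10 : o + S.size - 1 ≠ o + S.size + T.size - 1 := by omega
    have t1 := hc.2.2.1
    rw [← add_assoc, ← add_assoc] at hI
    simp only [vI, vC] at hI hC
    replace hE : h.a 3 (o + S.size + T.size) = ind (u ∈ A) := by
      rw [← hE]; congr 1; simp only [Regex.size]; omega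
    have hR := hM.1.root
    obtain ⟨r1, r2⟩ := hT.1.root
    obtain ⟨r3, r4⟩ := hT.2.1.root
    simp [downBody, Prog.wp, Expr.val, Expr.Ok, Expr.cost, -List.getD_eq_getElem?_getD, t1,
      hI, hoN, ho2, ho3, ho4, ho5, ho6, ho7, ho9, h1l, h2l, h3l, hE, hil, hR, r2,
      r3]
    refine hT' (o + S.size) _ _ Q hc.2.1 (hT.2.1.congr ?_ ?_) ?_ ?_ (by omega) (hM.2.1.congr ?_) ?_
      fun h1 b1 b2 b3 b4 b5 b6 b7 => hS o A h1 Q hc.1 (hT.1.congr ?_ ?_) b1 b2 (by omega)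
        (hM.1.congr ?_) ?_ fun h2 c1 c2 c3 c4 c5 c6 c7 => H h2 c1 c2 ?_ ?_ ⟨c5, b5.congr ?_⟩ ?_ ?_
    · intros; simp
    · intros; simp
    · simp
    · simp [hC]
    · intros; simp
    · simp
    · intro i hi hi'; rw [b4.a 0 (by simp)]; simp
    · intro i hi hi'; rw [b4.a 1 (by simp)]; simp
    · intro i hi hi'; rw [b6 4 i (by omega)]; simp
    · rw [b6 3 _ (by omega)]; simp [ho10]
    · rw [c3, b3]; simp
    · refine Keeps.trans (Keeps.trans ?_ b4) c4
      repeat' first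
        | exact Keeps.refl _ _ _ | refine Keeps.tick ?_ | refine Keeps.setV ?_ (by norm_num)
        | refine Keeps.setA ?_ (by simp)
    · intro i hi hi'; exact c6 4 i (by omega)
    · intro k i hi
      rw [c6 k i (by omega), b6 k i (by omega)]
      have : i ≠ o + S.size - 1 := by omega
      have : i ≠ o + S.size + T.size - 1 := by omega
      simp [Function.update_apply]
      grind
    · simp at b7; omega

end WordRAM

namespace WordRAM

open Regex

open WordRAM.Expr WordRAM.Prog in
/-- One step of the pass that collects the marks upwards. -/
def upBody : Prog :=
  set vTag (inp 0 (mul (nat 2) (var vI))) ;;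
  ite (eq (var vTag) (nat 0)) skip
    (set vJ (sub (var vI) (nat 1)) ;;
      ite (eq (var vTag) (nat 3))
        (put 4 (var vI) (arr 4 (var vJ)))
        (set vL (sub (var vJ) (arr 0 (var vJ))) ;;
          ite (eq (var vTag) (nat 1))
            (put 4 (var vI)
              (lt (nat 0) (add (arr 4 (var vJ)) (mul (arr 4 (var vL)) (arr 1 (var vJ))))))
            (put 4 (var vI) (lt (nat 0) (add (arr 4 (var vJ)) (arr 4 (var vL))))))) ;;
  set vI (add (var vI) (nat 1))

def upC (r : ℕ) : Cmd := whileC r (.lt (.var vI) (.var vM)) upBody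

/-- Postorder provides the marks of the operands first; those of the operator follow by
`mem_proper_cat`, `mem_proper_alt` and `mem_proper_star`. -/
theorem up_loop {w : ℕ} {E : Env w} (hw : 64 ≤ 2 ^ w) {m : ℕ} (hm : 2 * m < 2 ^ w)
    (hmN : m ≤ E.N) {u : List (BitVec w)} (S : Regex (BitVec w)) :
    ∀ (o : ℕ) (A : Language (BitVec w)) (h : Store w) (Q : Store w → Prop),
    S.CodeAt (E.inp 0) o → S.Table h.a o → h.v vI = o → h.v vM = m →
    o + S.size ≤ m → S.LeafMarks (h.a 4) u o A →
    (∀ h', h'.v vI = o + S.size → h'.v vT = h.v vT → Keeps 5 {4} h h' →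
      S.Marks (h'.a 4) u o A →
      SameOff o (o + S.size) h h' → h'.clk ≤ h.clk + 200 * S.size →
      Wp E (upC E.r) Q h') →
    Wp E (upC E.r) Q h := by
  have h1l : 1 < 2 ^ w := by omega
  have h2l : 2 < 2 ^ w := by omega
  have h3l : 3 < 2 ^ w := by omega
  induction S with
  | char a =>
    intro o A h Q hc hT hI hM ho hL H
    simp only [Regex.size] at ho H
    refine Wp.whileC_lt_step (by norm_num) (by norm_num) (by omega) (by omega) ?_
    change upBody.wp E (Wp E (upC E.r) Q) _
    have ho2 : 2 * o < 2 ^ w := by omega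
    have t1 := hc.1
    simp only [vI] at hI
    simp [upBody, Prog.wp, Expr.val, Expr.Ok, Expr.cost, -List.getD_eq_getElem?_getD, t1, hI,
      ho2, h1l]
    refine H _ ?_ ?_ ?_ ?_ ?_ ?_
    · simp
    · simp
    · repeat' first
        | exact Keeps.refl _ _ _ | refine Keeps.tick ?_ | refine Keeps.setV ?_ (by norm_num)
    · simpa [Marks, LeafMarks] using hL
    · intro k i hi
      simp
    · simp
  | star S hS =>
    intro o A h Q hc hT hI hM ho hL H
    simp only [Regex.size] at ho H
    refine hS o _ h Q hc.1 hT.1 hI hM (by omega) hL fun h1 a1 a2 a3 a4 a5 a6 => ?_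
    have := S.size_pos
    have hM1 := (a3.v vM (by norm_num)).trans hM
    refine Wp.whileC_lt_step (by norm_num) (by norm_num) (by omega) (by omega) ?_
    change upBody.wp E (Wp E (upC E.r) Q) _
    have r1 := a4.root
    have hoN : o + S.size < E.N := by omega
    have ho2 : 2 * (o + S.size) < 2 ^ w := by omega
    have ho3 : 1 ≤ o + S.size := by omega
    have ho4 : o + S.size - 1 < E.N := by omega
    have t1 := hc.2.1
    simp only [vI] at a1
    simp [upBody, Prog.wp, Expr.val, Expr.Ok, Expr.cost, -List.getD_eq_getElem?_getD, t1, a1,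
      hoN, ho2, h1l, h3l, ho3, ho4, r1]
    refine H _ ?_ ?_ ?_ ?_ ?_ ?_
    · simp; omega
    · rw [← a2]; simp
    · repeat' first
        | exact a3 | refine Keeps.tick ?_ | refine Keeps.setV ?_ (by norm_num)
        | refine Keeps.setA ?_ (by simp)
    · refine ⟨a4.congr ?_, ?_⟩
      · intro i hi hi'; simp [hi'.ne]
      · simp [mem_proper_star]
    · intro k i hi
      rw [← a5 k i (by omega)]
      have : i ≠ o + S.size := by omega
      simp [Function.update_apply]
      grind
    · simp; omega
  | cat S T hS hT' | alt S T hS hT' =>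
    intro o A h Q hc hT hI hM ho hL H
    simp only [Regex.size] at ho H
    refine hS o _ h Q hc.1 hT.1 hI hM (by omega) hL.1 fun h1 a1 a2 a3 a4 a5 a6 => ?_
    have := S.size_pos; have := T.size_pos
    have hM1 := (a3.v vM (by norm_num)).trans hM
    refine hT' (o + S.size) _ h1 Q hc.2.1 (hT.2.1.congr ?_ ?_) a1 hM1 (by omega) (hL.2.congr ?_)
      fun h2 b1 b2 b3 b4 b5 b6 => ?_
    · intro i hi hi'; rw [a3.a 0 (by simp)]
    · intro i hi hi'; rw [a3.a 1 (by simp)]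
    · intro i hi hi'; exact a5 4 i (by omega)
    have hM2 := (b3.v vM (by norm_num)).trans hM1
    refine Wp.whileC_lt_step (by norm_num) (by norm_num) (by omega) (by omega) ?_
    change upBody.wp E (Wp E (upC E.r) Q) _
    have a4' := a4.congr (f' := h2.a 4) fun i _ _ => b5 4 i (by omega)
    obtain ⟨q3, q4⟩ := hT.2.1.root
    have q1 := a4'.root
    have q2 := b4.root
    rw [← a3.a 0 (by simp), ← b3.a 0 (by simp)] at q3
    rw [← a3.a 1 (by simp), ← b3.a 1 (by simp)] at q4
    have hoN : o + S.size + T.size < E.N := by omega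
    have ho2 : 2 * (o + S.size + T.size) < 2 ^ w := by omega
    have ho3 : 1 ≤ o + S.size + T.size := by omega
    have ho4 : o + S.size + T.size - 1 < E.N := by omega
    have ho5 : T.size ≤ o + S.size + T.size - 1 := by omega
    have ho6 : o + S.size + T.size - 1 - T.size = o + S.size - 1 := by omega
    have ho7 : o + S.size - 1 < E.N := by omega
    have t1 := hc.2.2.1
    have hil : ∀ p q r, ind p + ind q * Bool.toNat r < 2 ^ w := fun p q r => by
      have := ind_lt p
      have h3 := Nat.mul_le_mul (Nat.le_of_lt_succ (ind_lt q)) (Nat.le_of_lt_succ (Bool.toNat_lt r))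
      omega
    have hil' : ∀ p q, ind p + ind q < 2 ^ w := fun p q => by
      have := ind_lt p; have := ind_lt q; omega
    simp only [vI] at b1
    simp [upBody, Prog.wp, Expr.val, Expr.Ok, Expr.cost, -List.getD_eq_getElem?_getD, t1, b1,
      hoN, ho2, h1l, h2l, h3l, ho3, ho4, ho5, ho6, ho7, q1, q2, q3, q4, hil, hil']
    refine H _ ?_ ?_ ?_ ?_ ?_ ?_
    · simp; omega
    · rw [← a2, ← b2]; simp
    · repeat' first
        | exact a3.trans b3 | refine Keeps.tick ?_ | refine Keeps.setV ?_ (by norm_num)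
        | refine Keeps.setA ?_ (by simp)
    · refine ⟨a4'.congr ?_, b4.congr ?_, ?_⟩
      · intro i hi hi'
        have : i ≠ o + S.size + T.size := by omega
        simp [this]
      · intro i hi hi'; simp [hi'.ne]
      · simp only [mem_proper_cat, mem_proper_alt]
        first
          | by_cases h1 : u ∈ A * S.lang * T.proper <;> by_cases h2 : u ∈ A * S.proper <;>
              cases hn : T.nullable <;> simp [ind, h1, h2] <;> done
          | by_cases h1 : u ∈ A * T.proper <;> by_cases h2 : u ∈ A * S.proper <;>
              simp [ind, h1, h2]
    · intro k i hi
      rw [← a5 k i (by omega), ← b5 k i (by omega)]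
      have : i ≠ o + S.size + T.size := by omega
      simp [Function.update_apply]
      grind
    · simp; omega

open WordRAM.Expr WordRAM.Prog in
def directBody (r : ℕ) : Prog :=
  set vC (inp 1 (var vT)) ;;
  set vI (var vM) ;;
  raw (downC r) ;;
  set vI (nat 0) ;;
  raw (upC r) ;;
  -- The empty word alone leads to the whole expression, so after a character the flag of the root
  -- is off for good.
  put 3 (sub (var vM) (nat 1)) (nat 0) ;;
  set vT (add (var vT) (nat 1))

open WordRAM.Expr WordRAM.Prog in
/-- Simulation with marks at every subexpression. -/
def direct (r : ℕ) : Prog :=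
  put 3 (sub (var vM) (nat 1)) (nat 1) ;;
  set vT (nat 0) ;;
  raw (whileC r (.lt (.var vT) (.var vN)) (directBody r)) ;;
  set vR (arr 4 (sub (var vM) (nat 1)))

/-- The mark of the root tells of nonempty matches only; this decides membership because `u` is
nonempty. -/
theorem direct_spec {w : ℕ} {E : Env w} (hw : 64 ≤ 2 ^ w) {R : Regex (BitVec w)}
    {u : List (BitVec w)} (hR : E.inp 0 = R.code) (hu : E.inp 1 = u) (hm : 2 * R.size < 2 ^ w)
    (hmN : R.size ≤ E.N) (hn : u.length < 2 ^ w) (hu0 : u ≠ []) {h : Store w} {Q : Store w → Prop}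
    (hT : R.Table h.a 0) (hM : h.v vM = R.size) (hN : h.v vN = u.length)
    (h0 : ∀ i < R.size, h.a 4 i = 0)
    (H : ∀ h', (h'.v vR < 2 ^ w ∧ (h'.v vR ≠ 0 ↔ u ∈ R.lang)) →
      h'.clk ≤ h.clk + 1000 * R.size * (u.length + 1) → Q h') :
    (direct E.r).wp E Q h := by
  have hpos := R.size_pos
  have hc : R.CodeAt (E.inp 0) 0 := by rw [hR]; exact R.codeAt_code (by omega)
  have hm1 : R.size - 1 < E.N := by omega
  simp only [vM, vN] at hM hN
  have hpos' : 1 ≤ R.size := hpos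
  simp [direct, Prog.wp, Expr.val, Expr.Ok, Expr.cost, hM, hm1, hpos']
  refine Wp.whileC_lt (n := u.length) (j := 0) (I := fun t g =>
    (g.v vT = t ∧ g.v vN = u.length) ∧ g.v vM = R.size ∧ R.Table g.a 0 ∧
    R.Marks (g.a 4) (u.take t) 0 1 ∧ g.a 3 (R.size - 1) = ind (u.take t ∈ (1 : Language _)) ∧
    g.clk ≤ h.clk + 100 + 600 * R.size * t) (by norm_num) (by norm_num) hn (Nat.zero_le _) ?_
    (fun _ _ h => h.1) ?_ ?_
  · refine ⟨⟨by simp, by simpa using hN⟩, by simpa using hM, hT.congr ?_ ?_, marks_nil ?_, ?_, ?_⟩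
    · intros; simp
    · intros; simp
    · intro i _ hi; simpa using h0 i (by omega)
    · rw [ind_true]
      · simp
      · simp [Language.mem_one]
    · simp
  · rintro t ht g ⟨⟨g1, g2⟩, g3, g4, g5, g6, g7⟩
    simp only [vM, vN, vT] at g1 g2 g3
    have htw : t < 2 ^ w := by omega
    simp [directBody, Prog.wp, Expr.val, Expr.Ok, Expr.cost, g1, htw]
    have hut : (E.inp 1)[t]? = some u[t] := by rw [hu]; simp [ht]
    refine down_loop (u := u.take t) (c := u[t]) hw hm hmN R 0 1 _ _ hc (g4.congr ?_ ?_) ?_ ?_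
      (by omega) (g5.congr ?_) ?_ fun h1 a1 a2 a3 a4 a5 a6 a7 => ?_
    · intros; simp
    · intros; simp
    · simp [g3]
    · simp [hut]
    · intros; simp
    · simpa using g6
    refine Wp.whileC_done (by simp [Expr.Ok]) (by simpa [Expr.val] using a1) ?_
    simp [Expr.cost]
    have b1 : h1.v 0 = R.size := by rw [a4.v _ (by norm_num)]; simpa using g3
    refine up_loop (u := u.take t ++ [u[t]]) hw hm hmN R 0 1 _ _ hc (g4.congr ?_ ?_) ?_ ?_
      (by omega) (a5.congr ?_) fun h2 c1 c2 c3 c4 c5 c6 => ?_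
    · intros; simp [a4.a 0]
    · intros; simp [a4.a 1]
    · simp
    · simpa using b1
    · intros; simp
    have d1 : h2.v 0 = R.size := by rw [c3.v _ (by norm_num)]; simpa using b1
    have d2 : h2.v 1 = u.length := by
      rw [c3.v _ (by norm_num)]; simp; rw [a4.v _ (by norm_num)]; simpa using g2
    have d3 : h2.v 11 = t := by
      have e1 : h2.v 11 = h1.v 11 := by simpa using c2
      have e2 : h1.v 11 = g.v 11 := by simpa using a3
      rw [e1, e2, g1]
    refine Wp.whileC_lt_done (by norm_num) (by norm_num) (by simp [d1]; omega)
      (by simpa [d1] using c1) ?_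
    simp [d1, d2, d3, hm1, hpos']
    refine ⟨?_, ?_, ?_, ?_⟩
    · refine g4.congr ?_ ?_
      · intros; simp [c3.a 0, a4.a 0]
      · intros; simp [c3.a 1, a4.a 1]
    · have := List.take_concat_get' u t ht
      rw [this] at c4
      simpa using c4
    · rw [ind_false]
      intro hcon
      exact hu0 (by simpa using hcon)
    · simp at a7 c6
      have : 600 * R.size * (t + 1) = 600 * R.size * t + 600 * R.size := by ring
      omega
  · rintro g ⟨⟨g1, g2⟩, g3, g4, g5, g6, g7⟩
    simp only [vM] at g3
    simp [g3, hm1, hpos']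
    have := g5.root
    rw [List.take_length, zero_add, one_mul] at this
    refine H _ ⟨?_, ?_⟩ ?_
    · simp [this]
      have := ind_lt (u ∈ R.proper)
      omega
    · simp [this]
      have h1 := ind_pos (u ∈ R.proper)
      have h2 : u ∈ R.proper ↔ u ∈ R.lang := ⟨fun h => h.1, fun h => ⟨h, hu0⟩⟩
      exact ⟨fun h => h2.1 (h1.1 (Nat.pos_of_ne_zero h)), fun h => (h1.2 (h2.2 h)).ne'⟩
    · simp
      have h1 : 1000 * R.size * (u.length + 1) = 1000 * (R.size * u.length) + 1000 * R.size := by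
        ring
      have h2 : 600 * R.size * u.length = 600 * (R.size * u.length) := by ring
      omega

end WordRAM

/-! ### The symbols of the parts -/

namespace Cut

variable {w : ℕ} {β : BitVec w}

/-- The symbols of `micro`: tag, character and, at the last node of the stub of a hole, one more
than the number of this hole. -/
def entries (β : BitVec w) : Cut (BitVec w) → ℕ → List (ℕ × ℕ × ℕ)
  | char a, _ => [(0, a.toNat, 0)]
  | cat S T, κ => S.entries β κ ++ (T.entries β (κ + S.cnt) ++ [(1, 0, 0)])
  | alt S T, κ => S.entries β κ ++ (T.entries β (κ + S.cnt) ++ [(2, 0, 0)])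
  | star S, κ => S.entries β κ ++ [(3, 0, 0)]
  | hole S, κ =>
    if S.erase.nullable then [(0, β.toNat, 0), (3, 0, κ + S.cnt + 1)]
    else [(0, β.toNat, κ + S.cnt + 1)]

@[simp] theorem length_entries (S : Cut (BitVec w)) (κ : ℕ) :
    (S.entries β κ).length = S.size := by
  induction S generalizing κ with
  | hole S _ => simp only [entries, size]; split_ifs <;> rfl
  | _ => simp_all [entries, size, add_assoc]

theorem code_micro (S : Cut (BitVec w)) (κ : ℕ) :
    (S.micro β).code =
      (S.entries β κ).flatMap fun e => [BitVec.ofNat w e.1, BitVec.ofNat w e.2.1] := by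
  induction S generalizing κ with
  | char a => simp [micro, Regex.code, entries]
  | cat S T hS hT | alt S T hS hT =>
    simp [micro, Regex.code, entries, List.flatMap_append, ← hS, ← hT]
  | star S hS => simp [micro, Regex.code, entries, List.flatMap_append, ← hS]
  | hole S _ => simp only [micro, stub, entries]; split_ifs <;> simp [Regex.code]

theorem getD_flatMap_pair {γ δ : Type} (f f' : γ → δ) (l : List γ) {t : ℕ} (ht : t < l.length)
    (d : γ) (d' : δ) : (l.flatMap fun e => [f e, f' e]).getD (2 * t) d' = f (l.getD t d) ∧
      (l.flatMap fun e => [f e, f' e]).getD (2 * t + 1) d' = f' (l.getD t d) := by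
  induction l generalizing t with
  | nil => simp at ht
  | cons e l ih =>
    cases t with
    | zero => simp
    | succ t =>
      simp only [List.length_cons, Nat.add_lt_add_iff_right] at ht
      have := ih ht
      simpa [List.flatMap_cons, mul_add] using this

theorem getD_code_micro (S : Cut (BitVec w)) (κ : ℕ) {t : ℕ} (ht : t < S.size) :
    (S.micro β).code.getD (2 * t) 0 = BitVec.ofNat w ((S.entries β κ).getD t (0, 0, 0)).1 ∧
    (S.micro β).code.getD (2 * t + 1) 0 =
      BitVec.ofNat w ((S.entries β κ).getD t (0, 0, 0)).2.1 := by
  rw [S.code_micro κ]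
  exact getD_flatMap_pair _ _ _ (by simpa) _ _

variable {T S : Cut (BitVec w)} {κ₀ κ o : ℕ} {A₀ A : Language (BitVec w)}

theorem Occ.entries_getD (h : T.Occ κ₀ A₀ S κ o A) {i : ℕ} (hi : i < S.size) :
    (T.entries β κ₀).getD (o + i) (0, 0, 0) = (S.entries β κ).getD i (0, 0, 0) := by
  induction h generalizing i with
  | root => rw [zero_add]
  | catL h ih | altL h ih =>
    rw [ih (by simp only [size]; omega), entries, List.getD_append _ _ _ _ (by simpa)]
  | catR h ih | altR h ih =>
    rw [add_assoc, ih (by simp only [size]; omega), entries,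
      List.getD_append_right _ _ _ _ (by simp), length_entries, Nat.add_sub_cancel_left,
      List.getD_append _ _ _ _ (by simpa)]
  | star h ih =>
    rw [ih (by simp only [size]; omega), entries, List.getD_append _ _ _ _ (by simpa)]

theorem getD_append_cases {γ : Type} (l l' : List γ) (i : ℕ) (d : γ) :
    (l ++ l').getD i d = l.getD i d ∧ i < l.length ∨
      (l ++ l').getD i d = l'.getD (i - l.length) d ∧ l.length ≤ i := by
  rcases lt_or_ge i l.length with h | h
  · exact .inl ⟨List.getD_append _ _ _ _ h, h⟩
  · exact .inr ⟨List.getD_append_right _ _ _ _ h, h⟩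

theorem getD_singleton_child {k i c : ℕ} {a : ℕ × ℕ}
    (h : ([(k, a.1, 0)].getD i (0, 0, 0)).2.2 = c + 1) : False := by
  cases i <;> simp at h

/-- A nonzero third component occurs only at the last node of a stub, hence it determines the hole
and its place. -/
theorem Occ.of_entries (h : T.Occ κ₀ A₀ S κ o A) {i c : ℕ}
    (hi : ((S.entries β κ).getD i (0, 0, 0)).2.2 = c + 1) :
    ∃ S' κ' o' A', T.Occ κ₀ A₀ (hole S') κ' o' A' ∧ o + i + 1 = o' + (hole S').size ∧
      c = κ' + S'.cnt := by
  induction S generalizing κ o A i with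
  | char a => exact (getD_singleton_child (a := (a.toNat, 0)) hi).elim
  | cat S S' hS hS' =>
    rw [entries] at hi
    rcases getD_append_cases (S.entries β κ) _ i (0, 0, 0) with ⟨h1, h2⟩ | ⟨h1, h2⟩ <;> rw [h1] at hi
    · exact hS h.catL hi
    · rw [length_entries] at hi h2
      rcases getD_append_cases (S'.entries β (κ + S.cnt)) [(1, 0, 0)] (i - S.size) (0, 0, 0)
        with ⟨h3, h4⟩ | ⟨h3, h4⟩ <;> rw [h3] at hi
      · obtain ⟨S'', κ', o', A', h5, h6, h7⟩ := hS' h.catR hi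
        exact ⟨S'', κ', o', A', h5, by omega, h7⟩
      · exact (getD_singleton_child (a := (0, 0)) hi).elim
  | alt S S' hS hS' =>
    rw [entries] at hi
    rcases getD_append_cases (S.entries β κ) _ i (0, 0, 0) with ⟨h1, h2⟩ | ⟨h1, h2⟩ <;> rw [h1] at hi
    · exact hS h.altL hi
    · rw [length_entries] at hi h2
      rcases getD_append_cases (S'.entries β (κ + S.cnt)) [(2, 0, 0)] (i - S.size) (0, 0, 0)
        with ⟨h3, h4⟩ | ⟨h3, h4⟩ <;> rw [h3] at hi
      · obtain ⟨S'', κ', o', A', h5, h6, h7⟩ := hS' h.altR hi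
        exact ⟨S'', κ', o', A', h5, by omega, h7⟩
      · exact (getD_singleton_child (a := (0, 0)) hi).elim
  | star S hS =>
    rw [entries] at hi
    rcases getD_append_cases (S.entries β κ) [(3, 0, 0)] i (0, 0, 0) with ⟨h1, h2⟩ | ⟨h1, h2⟩ <;>
      rw [h1] at hi
    · exact hS h.star hi
    · exact (getD_singleton_child (a := (0, 0)) hi).elim
  | hole S _ =>
    refine ⟨S, κ, o, A, h, ?_⟩
    simp only [entries, size] at hi ⊢
    split_ifs at hi ⊢
    · rcases i with _ | _ | i <;> simp at hi ⊢; omega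
    · rcases i with _ | i <;> simp at hi ⊢; omega

theorem entries_hole_last (S : Cut (BitVec w)) (κ : ℕ) :
    (((hole S).entries β κ).getD ((hole S).size - 1) (0, 0, 0)).2.2 = κ + S.cnt + 1 := by
  simp only [entries, size]
  split_ifs <;> simp

variable {K : ℕ} {g : ℕ → Info (BitVec w)}

/-- The program reads the links off the symbols: a child named at position `t` has the entry state
`2 * t` in the part that is being copied. -/
theorem Layout.ent_of_entries (L : Layout T K g) {k t c : ℕ} (hk : k < K)
    (h : (((g k).tree.entries β (g k).lo).getD t (0, 0, 0)).2.2 = c + 1) :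
    (g c).par = k ∧ (g c).ent = 2 * t ∧ c < k := by
  obtain ⟨S, κ, o, A, h1, h2, rfl⟩ := Occ.of_entries (β := β) (Occ.root (κ₀ := (g k).lo)
    (A₀ := (g k).ctx)) h
  rw [L.hole k hk _ _ _ _ h1]
  refine ⟨rfl, by simp only [startAt]; omega, ?_⟩
  have h3 := h1.cnt_le
  have := L.lo k hk
  simp only [cnt] at h3
  omega

/-- Conversely, every part other than the root is named when its parent is copied, so no link is
missing. -/
theorem Layout.exists_entry (L : Layout T K g) {c : ℕ} (hc : c + 1 < K) :
    ∃ t < (g (g c).par).tree.size,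
      (((g (g c).par).tree.entries β (g (g c).par).lo).getD t (0, 0, 0)).2.2 = c + 1 := by
  obtain ⟨o, h1, h2⟩ := L.occ c hc
  have h3 := h2.size_le
  have h4 := (Cut.hole (g c).tree).size_pos
  refine ⟨o + ((Cut.hole (g c).tree).size - 1), by omega, ?_⟩
  rw [h2.entries_getD (by omega), entries_hole_last, L.lo c (by omega)]

end Cut

/-! ### Simulation data structures with integral bounds -/

open WordRAM in
/-- What `D.Supports` says, with bounds on time and space that are integers. -/
structure SimDS.Sim (D : SimDS) (w x : ℕ) (Sig : Set (BitVec w)) (β : BitVec w) where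
  t : ℕ
  B : ℕ
  p : ℕ
  Rep : Regex (BitVec w) → ℕ → ℕ → Set ℕ → (BitVec w → BitVec w) → Prop
  le_B : x ≤ B
  congr : ∀ R b e Z mem mem', (∀ a ∈ block w b e, mem a = mem' a) →
    Rep R b e Z mem → Rep R b e Z mem'
  pre : ∀ (inp : ℕ → List (BitVec w)) (R : Regex (BitVec w)) (b : ℕ) (σ : State w),
    R.chars ⊆ Sig ∪ {β} → 2 * R.size ≤ x → b + B < 2 ^ w →
    σ.reg 0 = BitVec.ofNat w b → σ.reg 1 = BitVec.ofNat w R.size → σ.reg 2 = BitVec.ofNat w x →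
    σ.reg 3 = β → (∀ i < R.code.length, σ.mem (BitVec.ofNat w (b + i)) = R.code.getD i 0) →
    (∀ a ∈ block w (b + R.code.length) (b + B), σ.mem a = 0) →
    ∃ (k e : ℕ) (τ : State w), k ≤ p ∧ b + R.code.length ≤ e ∧ e ≤ b + B ∧
      Exec inp (block w b e) D.pre σ k τ ∧ τ.reg 0 = BitVec.ofNat w e ∧ Rep R b e ∅ τ.mem
  move : ∀ (inp : ℕ → List (BitVec w)) (R : Regex (BitVec w)) (b e : ℕ) (Z : Set ℕ) (σ : State w),
    R.chars ⊆ Sig ∪ {β} → 2 * R.size ≤ x → σ.reg 0 = BitVec.ofNat w b →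
    Z ⊆ (R.tnfa.states : Set ℕ) → Rep R b e Z σ.mem → σ.reg 1 ∈ Sig →
    ∃ (k : ℕ) (τ : State w), k ≤ t ∧ Exec inp (block w b e) D.move σ k τ ∧
      Rep R b e (R.tnfa.move Z (σ.reg 1)) τ.mem
  close : ∀ (inp : ℕ → List (BitVec w)) (R : Regex (BitVec w)) (b e : ℕ) (Z : Set ℕ) (σ : State w),
    R.chars ⊆ Sig ∪ {β} → 2 * R.size ≤ x → σ.reg 0 = BitVec.ofNat w b →
    Z ⊆ (R.tnfa.states : Set ℕ) → Rep R b e Z σ.mem →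
    ∃ (k : ℕ) (τ : State w), k ≤ t ∧ Exec inp (block w b e) D.close σ k τ ∧
      Rep R b e (R.tnfa.close Z) τ.mem
  member : ∀ (inp : ℕ → List (BitVec w)) (R : Regex (BitVec w)) (b e : ℕ) (Z : Set ℕ) (q : ℕ)
    (σ : State w), R.chars ⊆ Sig ∪ {β} → 2 * R.size ≤ x → σ.reg 0 = BitVec.ofNat w b →
    Z ⊆ (R.tnfa.states : Set ℕ) → Rep R b e Z σ.mem → q < 2 * R.size →
    σ.reg 1 = BitVec.ofNat w q →
    ∃ (k : ℕ) (τ : State w), k ≤ t ∧ Exec inp (block w b e) D.member σ k τ ∧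
      (τ.reg 0 ≠ 0 ↔ q ∈ Z) ∧ Rep R b e Z τ.mem
  insert : ∀ (inp : ℕ → List (BitVec w)) (R : Regex (BitVec w)) (b e : ℕ) (Z : Set ℕ) (q : ℕ)
    (σ : State w), R.chars ⊆ Sig ∪ {β} → 2 * R.size ≤ x → σ.reg 0 = BitVec.ofNat w b →
    Z ⊆ (R.tnfa.states : Set ℕ) → Rep R b e Z σ.mem → q < 2 * R.size →
    σ.reg 1 = BitVec.ofNat w q →
    ∃ (k : ℕ) (τ : State w), k ≤ t ∧ Exec inp (block w b e) D.insert σ k τ ∧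
      Rep R b e (Z ∪ {q}) τ.mem

theorem SimDS.Supports.exists_sim {D : SimDS} {w x : ℕ} {Sig : Set (BitVec w)} {β : BitVec w}
    {t s p : ℝ} (h : D.Supports w x Sig β t s p) (ht : 0 ≤ t) (hp : 0 ≤ p) :
    ∃ P : D.Sim w x Sig β, (P.t : ℝ) ≤ t ∧ (P.B : ℝ) ≤ s + x ∧ (P.p : ℝ) ≤ p := by
  obtain ⟨B, hB, Rep, h1, h2⟩ := h
  have hst : ∀ {R : Regex (BitVec w)} {q : ℕ}, q < 2 * R.size → q ∈ R.tnfa.states := by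
    intro R q hq
    exact (R.mem_tnfa_states q).2 hq
  -- Numbers of steps are integers, so the bounds on time may be rounded down. The block is enlarged
  -- by `x` cells to make sure that the code fits, whose length is the number of states.
  refine ⟨⟨⌊t⌋₊, B + x, ⌊p⌋₊, Rep, by omega, h1, ?_, ?_, ?_, ?_, ?_⟩, Nat.floor_le ht, ?_,
    Nat.floor_le hp⟩
  · intro inp R b σ hR hx hb r0 r1 r2 r3 hc hz
    obtain ⟨k, e, τ, hk, he, he', H⟩ := (h2 inp R b σ hR (by rwa [R.card_tnfa_states]) r0).1 (by omega) r1 r2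
      r3 hc fun a ha => hz a ⟨ha.1, by have := ha.2; omega⟩
    exact ⟨k, e, τ, Nat.le_floor hk, he, by omega, H⟩
  · intro inp R b e Z σ hR hx r0 hZ hr ha
    obtain ⟨k, τ, hk, H⟩ := ((h2 inp R b σ hR (by rwa [R.card_tnfa_states]) r0).2 e Z hZ hr).1 _ ha rfl
    exact ⟨k, τ, Nat.le_floor hk, H⟩
  · intro inp R b e Z σ hR hx r0 hZ hr
    obtain ⟨k, τ, hk, H⟩ := ((h2 inp R b σ hR (by rwa [R.card_tnfa_states]) r0).2 e Z hZ hr).2.1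
    exact ⟨k, τ, Nat.le_floor hk, H⟩
  · intro inp R b e Z q σ hR hx r0 hZ hr hq r1
    obtain ⟨k, τ, hk, H⟩ := ((h2 inp R b σ hR (by rwa [R.card_tnfa_states]) r0).2 e Z hZ hr).2.2.1 q (hst hq) r1
    exact ⟨k, τ, Nat.le_floor hk, H⟩
  · intro inp R b e Z q σ hR hx r0 hZ hr hq r1
    obtain ⟨k, τ, hk, H⟩ := ((h2 inp R b σ hR (by rwa [R.card_tnfa_states]) r0).2 e Z hZ hr).2.2.2 q (hst hq) r1
    exact ⟨k, τ, Nat.le_floor hk, H⟩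
  · push_cast; linarith

namespace WordRAM

/-! ### Partition of the expression -/

/-- A partition of an expression and a simulation data structure for its parts. -/
structure Setup (w : ℕ) where
  D : SimDS
  x : ℕ
  Sig : Set (BitVec w)
  β : BitVec w
  P : D.Sim w x Sig β
  E : Env w
  m : ℕ
  y : ℕ
  T : Cut (BitVec w)
  K : ℕ
  g : ℕ → Cut.Info (BitVec w)
  L : Cut.Layout T K g
  h64 : 64 ≤ 2 ^ w
  hm : 2 * m + 2 < 2 ^ w
  hxw : x < 2 ^ w
  hN : m + 2 ≤ E.N
  hS : 16 * E.N + K * P.B ≤ E.S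
  hSw : E.S < 2 ^ w
  hr : 4 ≤ E.r
  hpre : D.pre.regBound ≤ E.r
  hmove : D.move.regBound ≤ E.r
  hclose : D.close.regBound ≤ E.r
  hmember : D.member.regBound ≤ E.r
  hinsert : D.insert.regBound ≤ E.r
  hyx : 4 * y ≤ x + 2
  hy3 : 3 ≤ y
  hKm : K ≤ m + 1
  hg : ∀ k < K, (g k).tree.size < 2 * y ∧ (g k).tree.erase.chars ⊆ Sig
  hgm : ∀ k < K, (g k).tree.size ≤ m

namespace Setup

variable {w : ℕ} (U : Setup w)

/-- The expression that stands for part `k`. -/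
abbrev M (k : ℕ) : Regex (BitVec w) := (U.g k).tree.micro U.β

theorem M_size (k : ℕ) : (U.M k).size = (U.g k).tree.size := Cut.size_micro ..

theorem M_chars {k : ℕ} (hk : k < U.K) : (U.M k).chars ⊆ U.Sig ∪ {U.β} :=
  (Cut.chars_micro _ _).trans (Set.union_subset_union_left _ (U.hg k hk).2)

theorem M_le {k : ℕ} (hk : k < U.K) : 2 * (U.M k).size ≤ U.x := by
  have := (U.hg k hk).1; have := U.hyx; rw [M_size]; omega

/-- The first `κ` parts have been preprocessed. Arrays `8` and `9` hold their blocks and start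
states, arrays `10` and `11` the blocks and the states that the parts are linked to. -/
structure Built (κ : ℕ) (en : ℕ → ℕ) (h : Store w) : Prop where
  start : ∀ j < κ, h.a 9 j = Cut.start U.g j
  rep : ∀ j < κ, U.P.Rep (U.M j) (h.a 8 j) (en j) ∅ h.m
  le : ∀ j < κ, 16 * U.E.N ≤ h.a 8 j ∧ en j ≤ h.v vBlk
  disj : ∀ i < κ, ∀ j < κ, i < j → en i ≤ h.a 8 j
  blk : 16 * U.E.N ≤ h.v vBlk ∧ h.v vBlk ≤ 16 * U.E.N + κ * U.P.B
  zero : ∀ a : BitVec w, h.v vBlk ≤ a.toNat → h.m a = 0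
  link : ∀ c, c + 1 < U.K → (U.g c).par < κ →
    h.a 10 c = h.a 8 (U.g c).par ∧ h.a 11 c = (U.g c).ent

/-- The buffer holds the symbols `l` from position `o` on. -/
def Buf (a : ℕ → ℕ → ℕ) (l : List (ℕ × ℕ × ℕ)) (o : ℕ) : Prop :=
  ∀ i < l.length, a 5 (o + i) = (l.getD i (0, 0, 0)).1 ∧ a 6 (o + i) = (l.getD i (0, 0, 0)).2.1 ∧
    a 7 (o + i) = (l.getD i (0, 0, 0)).2.2

open WordRAM.Expr WordRAM.Prog in
-- Array `7` holds the number of a child plus one, zero if there is none. A child is linked only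
-- when its parent is copied, as the block of the parent is not known before.
def copyBody : Prog :=
  set vL (add (sub (var vTop) (var vG)) (var vJ)) ;;
  poke (add (var vBlk) (mul (nat 2) (var vJ))) (arr 5 (var vL)) ;;
  poke (add (add (var vBlk) (mul (nat 2) (var vJ))) (nat 1)) (arr 6 (var vL)) ;;
  set vC (arr 7 (var vL)) ;;
  ite (var vC)
    (put 10 (sub (var vC) (nat 1)) (var vBlk) ;;
      put 11 (sub (var vC) (nat 1)) (mul (nat 2) (var vJ)))
    skip ;;
  set vJ (add (var vJ) (nat 1))

open WordRAM.Expr WordRAM.Prog in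
/-- Preprocess the part whose symbols are the last `vG` symbols of the buffer. -/
def closePart (r : ℕ) (pre : Cmd) : Prog :=
  set vJ (nat 0) ;;
  raw (whileC r (lt (var vJ) (var vG)) copyBody) ;;
  put 8 (var vK) (var vBlk) ;;
  put 9 (var vK) (mul (nat 2) (sub (var vG) (nat 1))) ;;
  raw (callC r pre (var vBlk) (var vG) (var vX) (var vB) vBlk) ;;
  set vTop (sub (var vTop) (var vG)) ;;
  set vK (add (var vK) (nat 1))

/-- The first `t` symbols of part `k` have been copied. -/
structure Copied (k t : ℕ) (en : ℕ → ℕ) (h₀ h : Store w) : Prop where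
  v : ∀ i, i ≠ vJ → i ≠ vL → i ≠ vC → h.v i = h₀.v i
  j : h.v vJ = t
  a : ∀ i, i ≠ 10 → i ≠ 11 → h.a i = h₀.a i
  m : ∀ a : BitVec w, a.toNat < h₀.v vBlk ∨ h₀.v vBlk + 2 * t ≤ a.toNat → h.m a = h₀.m a
  code : ∀ i < 2 * t, h.m (BitVec.ofNat w (h₀.v vBlk + i)) = (U.M k).code.getD i 0
  link : ∀ c, c + 1 < U.K → (U.g c).par < k →
    h.a 10 c = h₀.a 8 (U.g c).par ∧ h.a 11 c = (U.g c).ent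
  link_new : ∀ i < t, ∀ c, c + 1 < U.K →
    (((U.g k).tree.entries U.β (U.g k).lo).getD i (0, 0, 0)).2.2 = c + 1 →
    h.a 10 c = h₀.v vBlk ∧ h.a 11 c = (U.g c).ent
  clk : h.clk ≤ h₀.clk + 100 * t

theorem copy_loop {k : ℕ} (hk : k < U.K) {en : ℕ → ℕ} {h : Store w} {Q : Store w → Prop}
    (hB : U.Built k en h) (hG : h.v vG = (U.g k).tree.size) (hT : (U.g k).tree.size ≤ h.v vTop)
    (hTm : h.v vTop ≤ U.m) (hJ : h.v vJ = 0)
    (hbuf : Buf h.a ((U.g k).tree.entries U.β (U.g k).lo) (h.v vTop - (U.g k).tree.size))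
    (H : ∀ h', U.Copied k (U.g k).tree.size en h h' → Q (h'.tick 4)) :
    Wp U.E (whileC U.E.r (.lt (.var vJ) (.var vG)) copyBody) Q h := by
  have hgm := U.hgm k hk
  have hm := U.hm
  have hN := U.hN
  have hKm := U.hKm
  have hgx := U.M_le hk
  rw [M_size] at hgx
  have hxB := U.P.le_B
  have hSw := U.hSw
  have hS : 16 * U.E.N + k * U.P.B + U.P.B ≤ U.E.S := by
    have h1 : (k + 1) * U.P.B ≤ U.K * U.P.B := Nat.mul_le_mul_right _ hk
    have := U.hS
    rw [Nat.succ_mul] at h1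
    omega
  have hb := hB.blk
  refine Wp.whileC_lt (n := (U.g k).tree.size) (j := 0) (I := fun t h' => U.Copied k t en h h')
    (by norm_num) (by norm_num) (by omega) (Nat.zero_le _) ?_ ?_ ?_ H
  · exact ⟨fun _ _ _ _ => rfl, hJ, fun _ _ _ => rfl, fun _ _ => rfl, fun i hi => by omega,
      hB.link, fun i hi => by omega, by omega⟩
  · intro j h' c
    exact ⟨c.j, (c.v _ (by norm_num) (by norm_num) (by norm_num)).trans hG⟩
  · intro t ht h' c
    have eJ := c.j
    have eG := (c.v vG (by norm_num) (by norm_num) (by norm_num)).trans hG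
    have eT := c.v vTop (by norm_num) (by norm_num) (by norm_num)
    have eB := c.v vBlk (by norm_num) (by norm_num) (by norm_num)
    have e5 := c.a 5 (by norm_num) (by norm_num)
    have e6 := c.a 6 (by norm_num) (by norm_num)
    have e7 := c.a 7 (by norm_num) (by norm_num)
    obtain ⟨b1, b2, b3⟩ := hbuf t (by simpa)
    obtain ⟨c1, c2⟩ := (U.g k).tree.getD_code_micro (β := U.β) (U.g k).lo ht
    set en := (((U.g k).tree.entries U.β (U.g k).lo).getD t (0, 0, 0)) with hen
    have hlen : ∀ d, en.2.2 = d + 1 → (U.g d).par = k ∧ (U.g d).ent = 2 * t ∧ d < k :=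
      fun d => U.L.ent_of_entries hk
    simp only [vJ, vG, vTop, vBlk] at *
    have n1 : h.v 6 - (U.g k).tree.size + t < U.E.N := by omega
    have n2 : h.v 8 + 2 * t < U.E.S := by omega
    have n3 : h.v 8 + 2 * t + 1 < U.E.S := by omega
    have n4 : 16 * U.E.N ≤ h.v 8 + 2 * t + 1 := by omega
    have n5 : 16 * U.E.N ≤ h.v 8 + 2 * t := by omega
    have n6 : en.2.2 < 2 ^ w := by
      rcases hc : en.2.2 with _ | d
      · positivity
      · have := hlen d hc; omega
    have n7 : en.2.2 ≠ 0 → 1 ≤ en.2.2 ∧ en.2.2 - 1 < U.E.N := by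
      intro h0
      obtain ⟨d, hd⟩ : ∃ d, en.2.2 = d + 1 := ⟨en.2.2 - 1, by omega⟩
      have := hlen d hd; omega
    simp [copyBody, Prog.wp, Expr.val, Expr.Ok, Expr.cost, eJ, eG, eT, eB, e5, e6, e7, b1, b2, b3,
      n1, n2, n3, n4, n5, n6, hT]
    have a1 : h.v 8 + 2 * t < 2 ^ w := by omega
    have a2 : h.v 8 + 2 * t + 1 < 2 ^ w := by omega
    have mem : ∀ a : BitVec w, a.toNat < h.v 8 ∨ h.v 8 + 2 * (t + 1) ≤ a.toNat →
        Function.update (Function.update h'.m (BitVec.ofNat w (h.v 8 + 2 * t))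
          (BitVec.ofNat w en.1)) (BitVec.ofNat w (h.v 8 + 2 * t + 1)) (BitVec.ofNat w en.2.1) a =
          h.m a := by
      intro a ha
      rw [Function.update_of_ne, Function.update_of_ne]
      · exact c.m a (by simp only [vBlk]; omega)
      · rintro rfl; rw [toNat_ofNat_of_lt a1] at ha; omega
      · rintro rfl; rw [toNat_ofNat_of_lt a2] at ha; omega
    have code : ∀ i < 2 * (t + 1),
        Function.update (Function.update h'.m (BitVec.ofNat w (h.v 8 + 2 * t))
          (BitVec.ofNat w en.1)) (BitVec.ofNat w (h.v 8 + 2 * t + 1)) (BitVec.ofNat w en.2.1)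
          (BitVec.ofNat w (h.v 8 + i)) = (U.M k).code.getD i 0 := by
      intro i hi
      have a3 : h.v 8 + i < 2 ^ w := by omega
      simp only [Function.update_apply, ofNat_inj a3 a1, ofNat_inj a3 a2]
      by_cases hi1 : i = 2 * t + 1
      · rw [if_pos (by omega), hi1, c2]
      · by_cases hi2 : i = 2 * t
        · rw [if_neg (by omega), if_pos (by omega), hi2, c1]
        · rw [if_neg (by omega), if_neg (by omega)]
          exact c.code i (by omega)
    refine ⟨fun h0 => ?_, fun h0 => ?_⟩
    · obtain ⟨d, hd⟩ : ∃ d, en.2.2 = d + 1 := ⟨en.2.2 - 1, by omega⟩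
      obtain ⟨d1, d2, d3⟩ := hlen d hd
      obtain ⟨n8, n9⟩ := n7 h0
      refine ⟨n8, n9, n8, n9, ⟨?_, ?_, ?_, ?_, ?_, ?_, ?_, ?_⟩⟩
      · intro i i1 i2 i3
        simp only [vJ, vL, vC] at i1 i2 i3
        simp [Function.update_of_ne i1, Function.update_of_ne i2, Function.update_of_ne i3,
          c.v i i1 i2 i3]
      · simp
      · intro i i1 i2
        simp [Function.update_of_ne i1, Function.update_of_ne i2, c.a i i1 i2]
      · exact mem
      · exact code
      · intro c' hc1 hc2
        have : c' ≠ d := by rintro rfl; omega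
        simpa [hd, this] using c.link c' hc1 hc2
      · intro i hi c' hc1 hc2
        by_cases hcd : c' = d
        · subst hcd; simp [hd, d2]
        · rcases Nat.lt_succ_iff_lt_or_eq.1 hi with hi | rfl
          · simpa [hd, hcd] using c.link_new i hi c' hc1 hc2
          · rw [← hen, hd] at hc2; omega
      · have := c.clk; simp; omega
    · refine ⟨?_, ?_, ?_, ?_, ?_, ?_, ?_, ?_⟩
      · intro i i1 i2 i3
        simp only [vJ, vL, vC] at i1 i2 i3
        simp [Function.update_of_ne i1, Function.update_of_ne i2, Function.update_of_ne i3,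
          c.v i i1 i2 i3]
      · simp
      · intro i i1 i2
        simp [c.a i i1 i2]
      · exact mem
      · exact code
      · exact c.link
      · intro i hi c' hc1 hc2
        rcases Nat.lt_succ_iff_lt_or_eq.1 hi with hi | rfl
        · exact c.link_new i hi c' hc1 hc2
        · rw [← hen, h0] at hc2; omega
      · have := c.clk; simp; omega

/-- Blocks are allocated one after the other. The new block starts at `vBlk`, preprocessing returns
its end, and all cells from there on are still zero because preprocessing stays inside of the block.
-/
theorem closePart_spec {k : ℕ} (hk : k < U.K) {en : ℕ → ℕ} {h : Store w} {Q : Store w → Prop}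
    (hB : U.Built k en h) (hG : h.v vG = (U.g k).tree.size) (hT : (U.g k).tree.size ≤ h.v vTop)
    (hTm : h.v vTop ≤ U.m) (hK : h.v vK = k) (hX : h.v vX = U.x) (hβ : h.v vB = U.β.toNat)
    (hbuf : Buf h.a ((U.g k).tree.entries U.β (U.g k).lo) (h.v vTop - (U.g k).tree.size))
    (H : ∀ en' h', U.Built (k + 1) en' h' → (∀ i < 6, h'.v i = h.v i) → h'.v vK = k + 1 →
      h'.v vTop = h.v vTop - (U.g k).tree.size →
      (∀ i, i ≠ 8 → i ≠ 9 → i ≠ 10 → i ≠ 11 → h'.a i = h.a i) →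
      h'.clk ≤ h.clk + (100 * (U.g k).tree.size + U.P.p + 100) → Q h') :
    (closePart U.E.r U.D.pre).wp U.E Q h := by
  have hgm := U.hgm k hk
  have hm := U.hm
  have hN := U.hN
  have hKm := U.hKm
  have hgx := U.M_le hk
  have hgx' := hgx
  rw [M_size] at hgx'
  have hgc := U.M_chars hk
  have hpos := (U.g k).tree.size_pos
  have hxB := U.P.le_B
  have hSw := U.hSw
  have hr := U.hr
  have hpre := U.hpre
  have hS : 16 * U.E.N + k * U.P.B + U.P.B ≤ U.E.S := by
    have h1 : (k + 1) * U.P.B ≤ U.K * U.P.B := Nat.mul_le_mul_right _ hk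
    have := U.hS
    rw [Nat.succ_mul] at h1
    omega
  have hb := hB.blk
  have hstart := Cut.start_add U.g k
  simp only [closePart, Prog.wp, Expr.val, Expr.Ok, true_and]
  refine ⟨by norm_num, U.copy_loop hk (en := en) ?_ ?_ ?_ ?_ ?_ ?_ fun h' c => ?_⟩
  · exact ⟨hB.start, hB.rep, hB.le, hB.disj, hB.blk, hB.zero, hB.link⟩
  · simpa using hG
  · simpa using hT
  · simpa using hTm
  · simp
  · simpa using hbuf
  have eG := (c.v vG (by norm_num) (by norm_num) (by norm_num))
  have eT := c.v vTop (by norm_num) (by norm_num) (by norm_num)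
  have eB := c.v vBlk (by norm_num) (by norm_num) (by norm_num)
  have eK := c.v vK (by norm_num) (by norm_num) (by norm_num)
  have eX := c.v vX (by norm_num) (by norm_num) (by norm_num)
  have eβ := c.v vB (by norm_num) (by norm_num) (by norm_num)
  have hcode := c.code
  have hmem := c.m
  simp at eG eT eB eK eX eβ hG hT hTm hK hX hβ hcode hmem hb
  simp [eG, hG, eK, hK]
  refine ⟨by omega, by omega, by omega, Wp.callC hpre hr ?_ ?_ ?_ ?_ ?_⟩
  · simp [Expr.Ok]
  · simp [Expr.Ok]
  · simp [Expr.Ok]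
  · simp [Expr.Ok]
  intro σ r0 r1 r2 r3 hmem'
  simp [Expr.val, eB, eG, hG, eX, hX, eβ, hβ] at r0 r1 r2 r3 hmem'
  have hc : ∀ i < (U.M k).code.length,
      σ.mem (BitVec.ofNat w (h.v 8 + i)) = (U.M k).code.getD i 0 := by
    intro i hi
    rw [Regex.length_code, M_size] at hi
    rw [hmem' _ (by rw [toNat_ofNat_of_lt] <;> omega)]
    simpa using hcode i hi
  have hz : ∀ a ∈ block w (h.v 8 + (U.M k).code.length) (h.v 8 + U.P.B), σ.mem a = 0 := by
    intro a ha
    rw [Regex.length_code, M_size] at ha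
    have h1 := ha.1
    rw [hmem' a (by omega), hmem a (by omega)]
    exact hB.zero a (by simp only [vBlk]; omega)
  obtain ⟨kk, e, τ, hkp, he1, he2, hx, r0', hrep⟩ := U.P.pre U.E.inp (U.M k) (h.v 8) σ hgc hgx
    (by omega) r0 (by rw [M_size]; exact r1) r2 r3 hc hz
  rw [Regex.length_code, M_size] at he1
  refine ⟨kk, U.P.p, h.v 8, e, τ, hkp, hb.1, by omega, hx, ?_⟩
  have het : (τ.reg 0).toNat = e := by rw [r0', toNat_ofNat_of_lt (by omega)]
  have hlow : ∀ a : BitVec w, 16 * U.E.N ≤ a.toNat → a.toNat < h.v 8 → τ.mem a = h.m a := by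
    intro a h1 h2
    rw [hx.mem_eq fun ha => by have := ha.1; omega, hmem' a h1, hmem a (.inl h2)]
  have hhigh : ∀ a : BitVec w, e ≤ a.toNat → τ.mem a = 0 := by
    intro a h1
    rw [hx.mem_eq fun ha => by have := ha.2; omega, hmem' a (by omega), hmem a (.inr (by omega))]
    exact hB.zero a (by simp only [vBlk]; omega)
  have a8 : h'.a 8 = h.a 8 := by simpa using c.a 8 (by norm_num) (by norm_num)
  have a9 : h'.a 9 = h.a 9 := by simpa using c.a 9 (by norm_num) (by norm_num)
  have hle := hB.le
  simp only [vBlk] at hle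
  simp [het, eT, eG, hG, hT, eK, hK, Expr.cost]
  refine H (Function.update en k e) _ ⟨?_, ?_, ?_, ?_, ?_, ?_, ?_⟩ ?_ ?_ ?_ ?_ ?_
  · intro j hj
    by_cases hjk : j = k
    · subst hjk; simp
    · simp [hjk, a9, hB.start j (by omega)]
  · intro j hj
    by_cases hjk : j = k
    · subst hjk; simpa [eB] using hrep
    · have h1 := hle j (by omega)
      simp only [Store.tick_a, Store.setV_a, Store.tick_m, Store.setV_m]
      rw [Function.update_of_ne (by norm_num), Function.update_self, Function.update_of_ne hjk,
        Function.update_of_ne hjk, a8]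
      refine U.P.congr _ _ _ _ _ _ (fun a ha => ?_) (hB.rep j (by omega))
      exact (hlow a (by have := ha.1; omega) (by have := ha.2; omega)).symm
  · intro j hj
    by_cases hjk : j = k
    · subst hjk; simp [eB]; omega
    · have h1 := hle j (by omega)
      simp [hjk, a8]; omega
  · intro i hi j hj hij
    have h1 := hle i (by omega)
    by_cases hjk : j = k
    · subst hjk; simp [hij.ne, eB]; omega
    · simp [hjk, show i ≠ k by omega, a8]
      exact hB.disj i (by omega) j (by omega) hij
  · simp [add_mul]; omega
  · intro a ha
    exact hhigh a (by simpa using ha)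
  · intro c' hc1 hc2
    by_cases hck : (U.g c').par = k
    -- The children of part `k` have just been linked while its symbols were copied.
    · obtain ⟨t, ht, ht'⟩ := U.L.exists_entry (β := U.β) hc1
      rw [hck] at ht ht'
      have := c.link_new t ht c' hc1 ht'
      simpa [hck, eB] using this
    · have := c.link c' hc1 (by omega)
      simpa [hck, a8] using this
  · intro i hi
    have := c.v i (by simp; omega) (by simp; omega) (by simp; omega)
    simp [show i ≠ 7 by omega, show i ≠ 6 by omega, show i ≠ 8 by omega, this,
      show i ≠ 13 by omega]
  · simp
  · simp
  · intro i h1 h2 h3 h4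
    simp [h1, h2, c.a i h3 h4]
  · have := c.clk
    simp [Expr.cost] at this ⊢
    omega

end Setup

end WordRAM

/-! ### Greedy partition with a stack of symbols -/

namespace WordRAM

namespace Setup

variable {w : ℕ} {U : Setup w}

theorem Built.of_eq {κ : ℕ} {en : ℕ → ℕ} {h h' : Store w} (H : U.Built κ en h)
    (h8 : h'.a 8 = h.a 8) (h9 : h'.a 9 = h.a 9) (h10 : h'.a 10 = h.a 10) (h11 : h'.a 11 = h.a 11)
    (hv : h'.v vBlk = h.v vBlk) (hm : h'.m = h.m) : U.Built κ en h' where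
  start := by rw [h9]; exact H.start
  rep := by rw [h8, hm]; exact H.rep
  le := by rw [h8, hv]; exact H.le
  disj := by rw [h8]; exact H.disj
  blk := by rw [hv]; exact H.blk
  zero := by rw [hv, hm]; exact H.zero
  link := by rw [h8, h10, h11]; exact H.link

theorem Buf.append {a : ℕ → ℕ → ℕ} {l l' : List (ℕ × ℕ × ℕ)} {o : ℕ} (h : Buf a l o)
    (h' : Buf a l' (o + l.length)) : Buf a (l ++ l') o := by
  intro i hi
  rcases lt_or_ge i l.length with hil | hil
  · rw [List.getD_append _ _ _ _ hil]; exact h i hil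
  · rw [List.getD_append_right _ _ _ _ hil]
    have := h' (i - l.length) (by rw [List.length_append] at hi; omega)
    rwa [show o + l.length + (i - l.length) = o + i by omega] at this

theorem Buf.congr {a a' : ℕ → ℕ → ℕ} {l : List (ℕ × ℕ × ℕ)} {o : ℕ} (h : Buf a l o)
    (H : ∀ i < o + l.length, ∀ k, 5 ≤ k → k ≤ 7 → a' k i = a k i) : Buf a' l o := by
  intro i hi
  rw [H _ (by omega) 5 (by norm_num) (by norm_num), H _ (by omega) 6 (by norm_num) (by norm_num),
    H _ (by omega) 7 (by norm_num) (by norm_num)]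
  exact h i hi

theorem buf_singleton {a : ℕ → ℕ → ℕ} {e : ℕ × ℕ × ℕ} {o : ℕ} (h5 : a 5 o = e.1)
    (h6 : a 6 o = e.2.1) (h7 : a 7 o = e.2.2) : Buf a [e] o := by
  intro i hi
  obtain rfl : i = 0 := by simpa using hi
  exact ⟨h5, h6, h7⟩

variable (U) in
/-- Parameters of the computation. -/
structure Params (h : Store w) : Prop where
  m : h.v vM = U.m
  x : h.v vX = U.x
  β : h.v vB = U.β.toNat
  y : h.v vY = U.y

/-- The partition algorithm has worked on the buffer from position `top` on, on nodes from `o` on,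
and on further parts. -/
structure Frame (top o : ℕ) (h h' : Store w) : Prop where
  v : ∀ i < 5, h'.v i = h.v i
  a : ∀ k, k ≠ 2 → k < 5 → h'.a k = h.a k
  buf : ∀ i < top, ∀ k, 5 ≤ k → k ≤ 7 → h'.a k i = h.a k i
  gp : ∀ i < o, h'.a 2 i = h.a 2 i

theorem Frame.trans {top o top' o' : ℕ} {h h' h'' : Store w} (H : Frame top o h h')
    (H' : Frame top' o' h' h'') (ht : top ≤ top') (ho : o ≤ o') : Frame top o h h'' where
  v i hi := (H'.v i hi).trans (H.v i hi)
  a k hk hk' := (H'.a k hk hk').trans (H.a k hk hk')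
  buf i hi k h1 h2 := (H'.buf i (by omega) k h1 h2).trans (H.buf i hi k h1 h2)
  gp i hi := (H'.gp i (by omega)).trans (H.gp i hi)

theorem Params.frame {top o : ℕ} {h h' : Store w} (P : U.Params h) (F : Frame top o h h') :
    U.Params h' where
  m := (F.v _ (by norm_num)).trans P.m
  x := (F.v _ (by norm_num)).trans P.x
  β := (F.v _ (by norm_num)).trans P.β
  y := (F.v _ (by norm_num)).trans P.y

variable (U) in
/-- The symbols of `X` are on top of the buffer, and its holes have been preprocessed. -/
structure Pushed (X : Cut (BitVec w)) (κ top : ℕ) (h : Store w) : Prop where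
  built : ∃ en, U.Built (κ + X.cnt) en h
  height : h.v vTop = top + X.size
  buf : Buf h.a (X.entries U.β κ) top
  cnt : h.v vK = κ + X.cnt

open WordRAM.Expr WordRAM.Prog in
/-- Put a symbol on top of the buffer. -/
def push (tag ch child : Expr) : Prog :=
  put 5 (var vTop) tag ;; put 6 (var vTop) ch ;; put 7 (var vTop) child ;;
  set vTop (add (var vTop) (nat 1))

open WordRAM.Expr WordRAM.Prog in
/-- Cut out the expression on top of the buffer if it is large enough. -/
def finishNode (r : ℕ) (pre : Cmd) : Prog :=
  ite (lt (var vG) (var vY)) (put 2 (var vI) (var vG))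
    (closePart r pre ;;
      ite (arr 1 (var vI))
        (push (nat 0) (var vB) (nat 0) ;; push (nat 3) (nat 0) (var vK) ;; put 2 (var vI) (nat 2))
        (push (nat 0) (var vB) (var vK) ;; put 2 (var vI) (nat 1))) ;;
  set vI (add (var vI) (nat 1))

/-- The time bound is amortised: each symbol in the buffer holds `100` units of time for being
copied, and each hole contributes `U.P.p + 1000` for preprocessing its part. Closing a part is paid
by the symbols that it removes and by the new hole, so that only `200` units are left for the node.
-/
theorem finishNode_spec {S : Cut (BitVec w)} {κ top i k o : ℕ} {A : Language (BitVec w)}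
    {h : Store w} {Q : Store w → Prop} (hp : U.Params h) (hS : U.Pushed S κ top h)
    (hk : k < U.K) (ho : (U.g k).tree.Occ (U.g k).lo (U.g k).ctx (Regex.cutOff U.y S) κ o A)
    (hi : h.v vI = i) (him : i < U.m) (htop : top + S.size ≤ i + 1) (hG : h.v vG = S.size)
    (hn : h.a 1 i = S.erase.nullable.toNat)
    (H : ∀ h', U.Pushed (Regex.cutOff U.y S) κ top h' → Frame top i h h' → h'.v vI = i + 1 →
      h'.a 2 i = (Regex.cutOff U.y S).size →
      h'.clk + 100 * (Regex.cutOff U.y S).size + (U.P.p + 1000) * S.cnt ≤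
        h.clk + 100 * S.size + (U.P.p + 1000) * (Regex.cutOff U.y S).cnt + 200 → Q h') :
    (finishNode U.E.r U.D.pre).wp U.E Q h := by
  obtain ⟨en, hB⟩ := hS.built
  have h64 := U.h64
  have hw0 : w ≠ 0 := by rintro rfl; norm_num at h64
  have hm := U.hm
  have hN := U.hN
  have hT := hS.height
  have hK := hS.cnt
  have hY := hp.y
  have hy3 := U.hy3
  have hyx := U.hyx
  have hxw := U.hxw
  have hKm := U.hKm
  have hβ := hp.β
  simp only [vI, vG, vTop, vK, vY, vB] at hi hG hT hK hY hβ
  rw [Regex.cutOff] at H ho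
  by_cases hys : U.y ≤ S.size
  · rw [if_pos hys] at ho
    simp only [if_pos hys] at H
    have hgk := U.L.hole k hk _ _ _ _ ho
    have hlo := U.L.lo k hk
    have hcl := ho.cnt_le
    simp only [Cut.cnt] at hcl
    have hkK : κ + S.cnt < U.K := by omega
    simp only [finishNode, Prog.wp]
    refine ⟨?_, ?_, ?_, ?_⟩
    · simp [Expr.Ok, Expr.val, hG, hY]; omega
    · simp [Expr.val, hG, hY]; split_ifs <;> omega
    · intro h0; exact absurd h0 (by simp [Expr.val, hG, hY]; omega)
    · intro h0
      refine U.closePart_spec hkK (en := en) (hB.of_eq rfl rfl rfl rfl rfl rfl) ?_ ?_ ?_ ?_ ?_ ?_ ?_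
        fun en' h' c1 c2 c3 c4 c5 c6 => ?_
      · simpa [hgk] using hG
      · simp [hgk, hT]
      · simp [hT]; omega
      · simpa using hK
      · simpa using hp.x
      · simpa using hβ
      · have := hS.buf
        simpa [hgk, hT] using this
      · have c7 := c2 5 (by norm_num)
        have c8 := c2 3 (by norm_num)
        have a1 := c5 1 (by norm_num) (by norm_num) (by norm_num) (by norm_num)
        have a2 := c5 2 (by norm_num) (by norm_num) (by norm_num) (by norm_num)
        simp [hT, hgk] at c3 c4 c7 c8 a1 a2
        have n1 : top < U.E.N := by omega
        have n2 : i < U.E.N := by omega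
        have n3 : top + 1 < U.E.N := by omega
        simp [Expr.val, Expr.Ok, Expr.cost, c7, hi, n1, n2, a1, hn, push, Prog.wp, c3, c4, c8, hβ,
          n3]
        have hclk : ∀ n ≤ 2, ∀ c, c ≤ h'.clk + 100 → c + 100 * n + (U.P.p + 1000) * S.cnt ≤
            h.clk + 100 * S.size + (U.P.p + 1000) * (S.cnt + 1) + 200 := by
          intro n hn c hc
          simp [hgk, Expr.cost] at c6
          rw [Nat.mul_succ]
          omega
        refine ⟨(Bool.toNat_lt _).trans_le (by omega), fun hnull => ?_, fun hnull => ?_⟩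
        · refine H _ ⟨⟨en', c1.of_eq ?_ ?_ ?_ ?_ ?_ ?_⟩, ?_, ?_, ?_⟩ ⟨?_, ?_, ?_, ?_⟩ ?_ ?_ ?_
          any_goals simp
          · simp [Cut.size, hnull]
          · rw [Cut.entries, if_pos hnull]
            refine Buf.append (l := [(0, U.β.toNat, 0)]) (l' := [(3, 0, κ + S.cnt + 1)])
              (buf_singleton ?_ ?_ ?_) (buf_singleton ?_ ?_ ?_) <;> simp
          · simpa [Cut.cnt, ← add_assoc] using c3
          · intro j hj
            have := c2 j (by omega)
            simpa [show j ≠ 5 by omega, show j ≠ 6 by omega] using this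
          · intro l l1 l2
            have := c5 l (by omega) (by omega) (by omega) (by omega)
            simpa [l1, show l ≠ 5 by omega, show l ≠ 6 by omega, show l ≠ 7 by omega] using this
          · intro j hj l l1 l2
            have := c5 l (by omega) (by omega) (by omega) (by omega)
            simp [show l ≠ 2 by omega, Function.update_apply]
            simp at this
            grind
          · intro j hj; simp [hj.ne, a2]
          · simp [Cut.size, hnull]
          · exact hclk _ (by simp only [Cut.size]; split_ifs; omega) _ (by omega)
        · refine H _ ⟨⟨en', c1.of_eq ?_ ?_ ?_ ?_ ?_ ?_⟩, ?_, ?_, ?_⟩ ⟨?_, ?_, ?_, ?_⟩ ?_ ?_ ?_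
          any_goals simp
          · simp [Cut.size, hnull]
          · rw [Cut.entries, if_neg (by simp [hnull])]
            exact buf_singleton (by simp) (by simp) (by simp)
          · simpa [Cut.cnt, ← add_assoc] using c3
          · intro j hj
            have := c2 j (by omega)
            simpa [show j ≠ 5 by omega, show j ≠ 6 by omega] using this
          · intro l l1 l2
            have := c5 l (by omega) (by omega) (by omega) (by omega)
            simpa [l1, show l ≠ 5 by omega, show l ≠ 6 by omega, show l ≠ 7 by omega] using this
          · intro j hj l l1 l2
            have := c5 l (by omega) (by omega) (by omega) (by omega)
            simp [show l ≠ 2 by omega, Function.update_apply]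
            simp at this
            grind
          · intro j hj; simp [hj.ne, a2]
          · simp [Cut.size, hnull]
          · exact hclk _ (by simp only [Cut.size]; split_ifs <;> omega) _ (by omega)
  · rw [if_neg hys] at ho
    simp only [if_neg hys] at H
    have n1 : i < U.E.N := by omega
    have n2 : S.size < 2 ^ w := by omega
    have n3 : U.y < 2 ^ w := by omega
    have n4 : S.size < U.y := by omega
    simp [finishNode, Prog.wp, Expr.val, Expr.Ok, Expr.cost, hi, hG, hY, n1, n2, n3, n4, hw0]
    refine H _ ⟨⟨en, hB.of_eq ?_ ?_ ?_ ?_ ?_ ?_⟩, ?_, ?_, ?_⟩ ⟨?_, ?_, ?_, ?_⟩ ?_ ?_ ?_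
    any_goals simp
    · exact hT
    · refine hS.buf.congr fun j hj k h1 h2 => ?_
      simp [show k ≠ 2 by omega]
    · exact hK
    · intro j hj; simp [show j ≠ 5 by omega]
    · intro k hk; simp [hk]
    · intro j hj k h1 h2; simp [show k ≠ 2 by omega]
    · intro j hj; simp [hj.ne]
    · omega

open WordRAM.Expr WordRAM.Prog in
/-- Put the symbol of node `vI` on top of the buffer, and its open part's size into `vG`. -/
def pushNode : Prog :=
  set vTag (inp 0 (mul (nat 2) (var vI))) ;;
  push (var vTag) (inp 0 (add (mul (nat 2) (var vI)) (nat 1))) (nat 0) ;;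
  ite (eq (var vTag) (nat 0)) (set vG (nat 1))
    (ite (eq (var vTag) (nat 3))
      (set vG (add (arr 2 (sub (var vI) (nat 1))) (nat 1)))
      (set vG (add (add (arr 2 (sub (sub (var vI) (nat 1)) (arr 0 (sub (var vI) (nat 1)))))
        (arr 2 (sub (var vI) (nat 1)))) (nat 1))))

def splitC (r : ℕ) (pre : Cmd) : Cmd :=
  whileC r (.lt (.var vI) (.var vM)) (pushNode ;; finishNode r pre)

/-- If `S` is cut out, it is the root of a part of its own. In either case its operands occur in a
known part, to which the induction hypothesis of the partition loop applies. -/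
theorem occ_of_cutOff {S : Cut (BitVec w)} {κ k o : ℕ} {A : Language (BitVec w)} (hk : k < U.K)
    (ho : (U.g k).tree.Occ (U.g k).lo (U.g k).ctx (Regex.cutOff U.y S) κ o A) :
    ∃ k' < U.K, ∃ o' A', (U.g k').tree.Occ (U.g k').lo (U.g k').ctx S κ o' A' := by
  rw [Regex.cutOff] at ho
  split_ifs at ho
  · have hgk := U.L.hole k hk _ _ _ _ ho
    have hlo := U.L.lo k hk
    have hcl := ho.cnt_le
    simp only [Cut.cnt] at hcl
    refine ⟨κ + S.cnt, by omega, 0, A, ?_⟩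
    rw [hgk]; exact .root
  · exact ⟨k, hk, o, A, ho⟩

theorem size_cutOff_le (R : Regex (BitVec w)) :
    (Regex.cutOff U.y (R.split U.y)).size ≤ R.size := by
  have := (Regex.size_cutOff U.hy3 (Regex.size_split U.hy3 R).1).1
  omega

/-- The partition is fixed in advance by `U`; the given occurrence says which of its parts the loop
is about to build, and `κ` how many have been closed. The summand `100 * size` is the time saved up
in the symbols of the buffer. -/
theorem split_loop (R : Regex (BitVec w)) : ∀ (o top κ k o' : ℕ) (A : Language (BitVec w))
    (h : Store w) (Q : Store w → Prop) (en : ℕ → ℕ), R.CodeAt (U.E.inp 0) o → U.Params h →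
    R.Table h.a o → h.v vI = o → o + R.size ≤ U.m → top ≤ o → U.Built κ en h → h.v vTop = top →
    h.v vK = κ → k < U.K →
    (U.g k).tree.Occ (U.g k).lo (U.g k).ctx (Regex.cutOff U.y (R.split U.y)) κ o' A →
    (∀ h', U.Pushed (Regex.cutOff U.y (R.split U.y)) κ top h' → Frame top o h h' →
      h'.v vI = o + R.size → h'.a 2 (o + R.size - 1) = (Regex.cutOff U.y (R.split U.y)).size →
      h'.clk + 100 * (Regex.cutOff U.y (R.split U.y)).size ≤ h.clk + 500 * R.size +
        (U.P.p + 1000) * (Regex.cutOff U.y (R.split U.y)).cnt →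
      Wp U.E (splitC U.E.r U.D.pre) Q h') →
    Wp U.E (splitC U.E.r U.D.pre) Q h := by
  have hw := U.h64
  have hw0 : w ≠ 0 := by rintro rfl; norm_num at hw
  have h1l : 1 < 2 ^ w := by omega
  have h2l : 2 < 2 ^ w := by omega
  have h3l : 3 < 2 ^ w := by omega
  have hm := U.hm
  have hN := U.hN
  induction R with
  | char a =>
    intro o top κ k o' A h Q en hc hp ht hI ho hto hB hT hK hk hocc H
    obtain ⟨k₁, hk₁, o₁, A₁, hocc₁⟩ := occ_of_cutOff hk hocc
    have hM := hp.m
    simp only [Regex.size] at ho H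
    refine Wp.whileC_lt_step (by norm_num) (by norm_num) (by omega) (by omega) ?_
    change (pushNode ;; finishNode U.E.r U.D.pre).wp U.E (Wp U.E (splitC U.E.r U.D.pre) Q) _
    have htN : top < U.E.N := by omega
    have ho2 : 2 * o < 2 ^ w := by omega
    have ho3 : 2 * o + 1 < 2 ^ w := by omega
    obtain ⟨t1, t2⟩ := hc
    simp only [vI, vTop] at hI hT
    simp [pushNode, push, Prog.wp, Expr.val, Expr.Ok, Expr.cost, -List.getD_eq_getElem?_getD, t1,
      t2, hI, hT, htN, ho2, ho3, h1l]
    refine finishNode_spec (S := .char a) (κ := κ) (top := top) (i := o) (k := k) (o := o')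
      (A := A) ⟨?_, ?_, ?_, ?_⟩ ⟨⟨en, hB.of_eq ?_ ?_ ?_ ?_ ?_ ?_⟩, ?_, ?_, ?_⟩ hk hocc ?_ ?_ ?_ ?_ ?_
      fun h' c1 c2 c3 c4 c5 => H h' c1 ?_ ?_ ?_ ?_
    any_goals simp
    · exact hp.m
    · exact hp.x
    · exact hp.β
    · exact hp.y
    · simp [Cut.size]
    · refine buf_singleton ?_ ?_ ?_ <;> simp
    · simpa [Cut.cnt] using hK
    · exact hI
    · omega
    · simp only [Cut.size]; omega
    · simp [Cut.size]
    · simpa [Regex.Table, Regex.nullable, Cut.erase] using ht.2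
    · refine Frame.trans (top' := top) (o' := o) (h' := h) ⟨?_, ?_, ?_, ?_⟩ ⟨?_, ?_, ?_, ?_⟩ le_rfl le_rfl
      any_goals intros; rfl
      · intro j hj
        simpa [show j ≠ 6 by omega, show j ≠ 9 by omega, show j ≠ 15 by omega] using c2.v j hj
      · intro l l1 l2
        simpa [show l ≠ 5 by omega, show l ≠ 6 by omega, show l ≠ 7 by omega] using c2.a l l1 l2
      · intro j hj l l1 l2
        have := c2.buf j hj l l1 l2
        simp [Function.update_apply] at this
        grind
      · intro j hj; simpa using c2.gp j hj
    · simpa using c3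
    · simpa [Regex.split] using c4
    · simp [Regex.split, Cut.size, Cut.cnt] at c5 ⊢
      omega
  | star S hS =>
    intro o top κ k o' A h Q en hc hp ht hI ho hto hB hT hK hk hocc H
    obtain ⟨k₁, hk₁, o₁, A₁, hocc₁⟩ := occ_of_cutOff hk hocc
    simp only [Regex.size] at ho H
    refine hS o top κ k₁ o₁ _ h Q en hc.1 hp ht.1 hI (by omega) hto hB hT hK hk₁ hocc₁.star
      fun h1 a1 a2 a3 a4 a5 => ?_
    have hle := size_cutOff_le (U := U) S
    have hXp := (Regex.cutOff U.y (S.split U.y)).size_pos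
    have hpos := S.size_pos
    have hp1 := hp.frame a2
    have hM := hp1.m
    obtain ⟨en1, hB1⟩ := a1.built
    have hT1 := a1.height
    have hK1 := a1.cnt
    have hb1 := a1.buf
    have ht1 := ht.congr (a' := h1.a) (fun i _ _ => by rw [a2.a 0 (by norm_num) (by norm_num)])
      fun i _ _ => by rw [a2.a 1 (by norm_num) (by norm_num)]
    refine Wp.whileC_lt_step (by norm_num) (by norm_num) (by omega) (by omega) ?_
    change (pushNode ;; finishNode U.E.r U.D.pre).wp U.E (Wp U.E (splitC U.E.r U.D.pre) Q) _
    have eX : (Regex.split U.y S.star) = .star (Regex.cutOff U.y (S.split U.y)) := rfl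
    rw [eX] at hocc H
    set X := Regex.cutOff U.y (S.split U.y)
    have htN : top + X.size < U.E.N := by omega
    have ho1 : 1 ≤ o + S.size := by omega
    have ho4 : o + S.size - 1 < U.E.N := by omega
    have ho2 : 2 * (o + S.size) < 2 ^ w := by omega
    have ho3 : 2 * (o + S.size) + 1 < 2 ^ w := by omega
    obtain ⟨-, t1, t2⟩ := hc
    simp only [vI, vTop] at a3 hT1
    simp [pushNode, push, Prog.wp, Expr.val, Expr.Ok, Expr.cost, -List.getD_eq_getElem?_getD, t1,
      t2, a3, a4, hT1, htN, ho1, ho2, ho3, ho4, h3l, hw0]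
    refine finishNode_spec (S := .star X) (κ := κ) (top := top) (i := o + S.size) (k := k) (o := o')
      (A := A) ⟨?_, ?_, ?_, ?_⟩ ⟨⟨en1, hB1.of_eq ?_ ?_ ?_ ?_ ?_ ?_⟩, ?_, ?_, ?_⟩ hk hocc ?_ ?_ ?_ ?_ ?_
      fun h' c1 c2 c3 c4 c5 => H h' c1 ?_ ?_ ?_ ?_
    any_goals simp
    · exact hp1.m
    · exact hp1.x
    · exact hp1.β
    · exact hp1.y
    · simp only [Cut.size]; omega
    · rw [Cut.entries]
      refine Buf.append (hb1.congr fun j hj l l1 l2 => ?_) (buf_singleton ?_ ?_ ?_)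
      · simp at hj
        simp [Function.update_apply]
        grind
      all_goals simp
    · simpa [Cut.cnt] using hK1
    · exact a3
    · omega
    · simp only [Cut.size]; omega
    · simp [Cut.size]
    · simpa [Regex.Table, Regex.nullable, Cut.erase] using ht1.2.2
    · refine Frame.trans (h' := h1) a2 (Frame.trans (top' := top) (o' := o + S.size) (h' := h1)
        ⟨?_, ?_, ?_, ?_⟩ ⟨?_, ?_, ?_, ?_⟩ le_rfl le_rfl) le_rfl (Nat.le_add_right _ _)
      any_goals intros; rfl
      · intro j hj
        simpa [show j ≠ 6 by omega, show j ≠ 9 by omega, show j ≠ 15 by omega] using c2.v j hj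
      · intro l l1 l2
        simpa [show l ≠ 5 by omega, show l ≠ 6 by omega, show l ≠ 7 by omega] using c2.a l l1 l2
      · intro j hj l l1 l2
        have := c2.buf j hj l l1 l2
        simp [Function.update_apply] at this
        grind
      · intro j hj; simpa using c2.gp j hj
    · simpa [add_assoc] using c3
    · simpa [← add_assoc] using c4
    · simp [Cut.size, Cut.cnt] at c5 ⊢
      omega
  | cat S T hS hT | alt S T hS hT =>
    intro o top κ k o' A h Q en hc hp ht hI ho hto hB hT' hK hk hocc H
    obtain ⟨k₁, hk₁, o₁, A₁, hocc₁⟩ := occ_of_cutOff hk hocc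
    simp only [Regex.size] at ho H
    refine hS o top κ k₁ _ _ h Q en hc.1 hp ht.1 hI (by omega) hto hB hT' hK hk₁
      (by first | exact hocc₁.catL | exact hocc₁.altL) fun h1 a1 a2 a3 a4 a5 => ?_
    have hle := size_cutOff_le (U := U) S
    have hXp := (Regex.cutOff U.y (S.split U.y)).size_pos
    have hpos := S.size_pos
    have hp1 := hp.frame a2
    obtain ⟨en1, hB1⟩ := a1.built
    have ht1 := ht.congr (a' := h1.a) (fun i _ _ => by rw [a2.a 0 (by norm_num) (by norm_num)])
      fun i _ _ => by rw [a2.a 1 (by norm_num) (by norm_num)]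
    refine hT (o + S.size) _ _ k₁ _ _ h1 Q en1 hc.2.1 hp1 ht1.2.1 a3 (by omega) (by omega) hB1
      a1.height a1.cnt hk₁ (by first | exact hocc₁.catR | exact hocc₁.altR)
      fun h2 b1 b2 b3 b4 b5 => ?_
    have hle' := size_cutOff_le (U := U) T
    have hXp' := (Regex.cutOff U.y (T.split U.y)).size_pos
    have hpos' := T.size_pos
    have hp2 := hp1.frame b2
    have hM := hp2.m
    obtain ⟨en2, hB2⟩ := b1.built
    have hT2 := b1.height
    have hK2 := b1.cnt
    have hb2 := b1.buf
    have ht2 := ht1.congr (a' := h2.a) (fun i _ _ => by rw [b2.a 0 (by norm_num) (by norm_num)])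
      fun i _ _ => by rw [b2.a 1 (by norm_num) (by norm_num)]
    obtain ⟨r1, -⟩ := ht2.2.1.root
    refine Wp.whileC_lt_step (by norm_num) (by norm_num) (by omega) (by omega) ?_
    change (pushNode ;; finishNode U.E.r U.D.pre).wp U.E (Wp U.E (splitC U.E.r U.D.pre) Q) _
    have a4' := (b2.gp (o + S.size - 1) (by omega)).trans a4
    simp only [Regex.split] at hocc H
    have hb1 := a1.buf
    set X := Regex.cutOff U.y (S.split U.y)
    set Y := Regex.cutOff U.y (T.split U.y)
    have htN : top + X.size + Y.size < U.E.N := by omega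
    have ho1 : 1 ≤ o + S.size + T.size := by omega
    have ho4 : o + S.size + T.size - 1 < U.E.N := by omega
    have ho2 : 2 * (o + S.size + T.size) < 2 ^ w := by omega
    have ho3 : 2 * (o + S.size + T.size) + 1 < 2 ^ w := by omega
    have ho5 : T.size ≤ o + S.size + T.size - 1 := by omega
    have ho6 : o + S.size + T.size - 1 - T.size = o + S.size - 1 := by omega
    have ho7 : o + S.size - 1 < U.E.N := by omega
    obtain ⟨-, -, t1, t2⟩ := hc
    simp only [vI, vTop] at b3 hT2
    simp [pushNode, push, Prog.wp, Expr.val, Expr.Ok, Expr.cost, -List.getD_eq_getElem?_getD, t1,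
      t2, b3, b4, a4', hT2, htN, ho1, ho2, ho3, ho4, ho5, ho6, ho7, h1l, h2l, h3l, r1]
    refine finishNode_spec (S := _) (κ := κ) (top := top)
      (i := o + S.size + T.size) (k := k) (o := o')
      (A := A) ⟨?_, ?_, ?_, ?_⟩ ⟨⟨en2, ?_⟩, ?_, ?_, ?_⟩ hk hocc ?_ ?_ ?_ ?_ ?_
      fun h' c1 c2 c3 c4 c5 => H h' c1 ?_ ?_ ?_ ?_
    any_goals simp
    · exact hp2.m
    · exact hp2.x
    · exact hp2.β
    · exact hp2.y
    · exact Built.of_eq (h := h2) (by simpa only [Cut.cnt, ← add_assoc] using hB2) (by simp)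
        (by simp) (by simp) (by simp) (by simp) rfl
    · simp only [Cut.size]; omega
    · rw [Cut.entries]
      have hb2' : Buf h2.a (Y.entries U.β (κ + X.cnt)) (top + (X.entries U.β κ).length) := by
        simpa using hb2
      refine Buf.append (hb1.congr fun j hj l l1 l2 => ?_)
        (Buf.append (hb2'.congr fun j hj l l1 l2 => ?_) (buf_singleton ?_ ?_ ?_))
      · have := b2.buf j (by simpa using hj) l l1 l2
        simp at hj
        have : j ≠ top + X.size + Y.size := by omega
        simp [Function.update_apply]
        grind
      · simp at hj
        simp [Function.update_apply]
        grind
      all_goals simp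
    · simpa [Cut.cnt, add_assoc] using hK2
    · exact b3
    · omega
    · simp only [Cut.size]; omega
    · simp [Cut.size]
    · simpa [Regex.Table, Regex.nullable, Cut.erase, X, Y, Regex.erase_cutOff] using ht2.2.2.2
    · refine Frame.trans (h' := h2) (a2.trans b2 ?_ ?_)
        (Frame.trans (top' := top) (o' := o + S.size + T.size) (h' := h2)
        ⟨?_, ?_, ?_, ?_⟩ ⟨?_, ?_, ?_, ?_⟩ le_rfl le_rfl) ?_ ?_
      any_goals omega
      any_goals intros; rfl
      · intro j hj
        simpa [show j ≠ 6 by omega, show j ≠ 9 by omega, show j ≠ 15 by omega] using c2.v j hj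
      · intro l l1 l2
        simpa [show l ≠ 5 by omega, show l ≠ 6 by omega, show l ≠ 7 by omega] using c2.a l l1 l2
      · intro j hj l l1 l2
        have := c2.buf j hj l l1 l2
        simp [Function.update_apply] at this
        grind
      · intro j hj; simpa using c2.gp j hj
    · simpa [add_assoc] using c3
    · simpa [← add_assoc] using c4
    · simp [Cut.size, Cut.cnt, mul_add] at c5 a5 b5 ⊢
      omega

end Setup

end WordRAM

namespace WordRAM

open WordRAM.Expr WordRAM.Prog in
/-- Partition the expression and preprocess the parts. -/
def partitionExpr (r : ℕ) (pre : Cmd) : Prog :=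
  set vI (nat 0) ;; set vTop (nat 0) ;; set vK (nat 0) ;;
  -- This is the first cell beyond the sixteen arrays of length `m + 2`.
  set vBlk (mul (nat 16) (add (var vM) (nat 2))) ;;
  raw (Setup.splitC r pre) ;;
  -- What remains in the buffer is the part of the root; it is closed whatever its size.
  set vG (var vTop) ;;
  Setup.closePart r pre

namespace Setup

variable {w : ℕ} {U : Setup w}

theorem partitionExpr_spec {R : Regex (BitVec w)} {h : Store w} {Q : Store w → Prop}
    (hN : U.E.N = U.m + 2) (hR : R.size = U.m) (hT : U.T = Regex.cutOff U.y (R.split U.y))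
    (hK : U.K = U.T.cnt + 1) (hc : R.CodeAt (U.E.inp 0) 0) (hp : U.Params h) (ht : R.Table h.a 0)
    (hz : ∀ a : BitVec w, 16 * U.E.N ≤ a.toNat → h.m a = 0)
    (H : ∀ en h', U.Built U.K en h' → (∀ i < 5, h'.v i = h.v i) → h'.v vK = U.K →
      h'.clk ≤ h.clk + 500 * U.m + (U.P.p + 1000) * U.K → Q h') :
    (partitionExpr U.E.r U.D.pre).wp U.E Q h := by
  have hM := hp.m
  have hm := U.hm
  have hKp := U.L.pos
  have hroot := U.L.tree_root
  have hlo := U.L.lo (U.K - 1) (by omega)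
  have hKT : U.K - 1 = U.T.cnt := by omega
  rw [hroot] at hlo
  have hlo0 : (U.g (U.K - 1)).lo = 0 := by omega
  have hle := size_cutOff_le (U := U) R
  rw [← hT, hR] at hle
  simp only [vM] at hM
  simp [partitionExpr, Prog.wp, Expr.val, Expr.Ok, Expr.cost, hM]
  refine split_loop R 0 0 0 (U.K - 1) 0 (U.g (U.K - 1)).ctx _ _ (fun _ => 0) hc ⟨?_, ?_, ?_, ?_⟩ ?_
    ?_ ?_ ?_ ⟨?_, ?_, ?_, ?_, ?_, ?_, ?_⟩ ?_ ?_ ?_ ?_ fun h' c1 c2 c3 c4 c5 => ?_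
  any_goals simp
  · exact hp.m
  · exact hp.x
  · exact hp.β
  · exact hp.y
  · exact ht
  · omega
  · omega
  · intro a ha; exact hz a (by omega)
  · omega
  · rw [← hT]
    have h1 := Cut.Occ.root (T := U.T) (κ₀ := (U.g (U.K - 1)).lo) (A₀ := (U.g (U.K - 1)).ctx)
    rw [hroot]
    rw [hlo0] at h1 ⊢
    exact h1
  · rw [← hT] at c1 c5
    obtain ⟨en, hB⟩ := c1.built
    have hb := c1.buf
    have hh := c1.height
    have hk := c1.cnt
    refine Wp.whileC_lt_done (by norm_num) (by norm_num) ?_ ?_ ?_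
    · rw [c2.v vM (by norm_num)]; simp [hM]; omega
    · rw [c2.v vM (by norm_num), c3]; simp [hM, hR]
    · have h0 := c2.v 0 (by norm_num)
      have h2 := c2.v 2 (by norm_num)
      have h3 := c2.v 3 (by norm_num)
      simp at hh hk h0 h2 h3
      simp only [Store.tick_v, hh]
      refine U.closePart_spec (k := U.K - 1) (en := en) (by omega)
        (Built.of_eq (h := h') ?_ rfl rfl rfl rfl rfl rfl) ?_ ?_ ?_ ?_ ?_ ?_ ?_
        fun en' h'' d1 d2 d3 d4 d5 d6 => H en' h'' ?_ ?_ ?_ ?_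
      · simpa [hKT] using hB
      · simp [hroot]
      · simp [hroot, hh]
      · simp [hh]; omega
      · simpa [hKT] using hk
      · simpa [h2] using hp.x
      · simpa [h3] using hp.β
      · simpa [hh, hroot, hlo0] using hb
      · rwa [Nat.sub_add_cancel hKp] at d1
      · intro i hi
        have e1 := d2 i (by omega)
        have e2 := c2.v i hi
        simp [show i ≠ 15 by omega, show i ≠ 8 by omega, show i ≠ 7 by omega, show i ≠ 6 by omega,
          show i ≠ 5 by omega] at e1 e2
        exact e1.trans e2
      · omega
      · simp [hroot] at d6 c5
        rw [hK, Nat.mul_succ]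
        omega

/-! ### Operations on the parts -/

/-- The state-sets of the parts are `Z`. -/
structure Live (U : Setup w) (h₀ : Store w) (en : ℕ → ℕ) (Z : ℕ → Set ℕ) (h : Store w) : Prop where
  built : U.Built U.K en h₀
  a : h.a = h₀.a
  v : ∀ i < 5, h.v i = h₀.v i
  K : h.v vK = U.K
  rep : ∀ j < U.K, U.P.Rep (U.M j) (h₀.a 8 j) (en j) (Z j) h.m
  sub : ∀ j < U.K, ∀ q ∈ Z j, q < 2 * (U.g j).tree.size

theorem Live.of_eq {h₀ h h' : Store w} {en : ℕ → ℕ} {Z : ℕ → Set ℕ} (L : U.Live h₀ en Z h)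
    (ha : h'.a = h.a) (hv : ∀ i < 5, h'.v i = h.v i) (hK : h'.v vK = h.v vK) (hm : h'.m = h.m) :
    U.Live h₀ en Z h' :=
  ⟨L.built, ha.trans L.a, fun i hi => (hv i hi).trans (L.v i hi), hK.trans L.K,
    by rw [hm]; exact L.rep, L.sub⟩

theorem Live.range {h₀ h : Store w} {en : ℕ → ℕ} {Z : ℕ → Set ℕ} (L : U.Live h₀ en Z h) {j : ℕ}
    (hj : j < U.K) : 16 * U.E.N ≤ h₀.a 8 j ∧ en j ≤ U.E.S := by
  have := L.built.le j hj
  have := L.built.blk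
  have := U.hS
  omega

theorem Live.start {h₀ h : Store w} {en : ℕ → ℕ} {Z : ℕ → Set ℕ} (L : U.Live h₀ en Z h) {j : ℕ}
    (hj : j < U.K) : h₀.a 9 j = Cut.start U.g j := L.built.start j hj

/-- The blocks are disjoint, so a call for part `j` changes its state-set only. The operations below
differ in the new set `X` and in what `P` says about the answer. -/
theorem Live.call {h₀ h : Store w} {en : ℕ → ℕ} {Z : ℕ → Set ℕ} (L : U.Live h₀ en Z h) {j : ℕ}
    (hj : j < U.K) {c : Cmd} (hc : c.regBound ≤ U.E.r) {e e' : Expr} (ok : e.Ok U.E h)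
    (ok' : e'.Ok U.E h) (he : e.val U.E h = h₀.a 8 j) {X : Set ℕ} {P : BitVec w → Prop}
    {Q : Store w → Prop} (hX : ∀ q ∈ X, q < 2 * (U.g j).tree.size)
    (hop : ∀ σ : State w, σ.reg 0 = BitVec.ofNat w (h₀.a 8 j) →
      σ.reg 1 = BitVec.ofNat w (e'.val U.E h) → U.P.Rep (U.M j) (h₀.a 8 j) (en j) (Z j) σ.mem →
      ∃ (k : ℕ) (τ : State w), k ≤ U.P.t ∧
        Exec U.E.inp (block w (h₀.a 8 j) (en j)) c σ k τ ∧ P (τ.reg 0) ∧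
        U.P.Rep (U.M j) (h₀.a 8 j) (en j) X τ.mem)
    (H : ∀ h', U.Live h₀ en (Function.update Z j X) h' → (∀ i, i ≠ vR → h'.v i = h.v i) →
      (∃ b, P b ∧ h'.v vR = b.toNat) → h'.clk ≤ h.clk + (U.P.t + e.cost + e'.cost + 7) → Q h') :
    Wp U.E (callC U.E.r c e e' (.nat 0) (.nat 0) vR) Q h := by
  refine Wp.callC hc U.hr ok ok' trivial trivial fun σ r0 r1 _ _ hm => ?_
  rw [he] at r0
  have hr := L.range hj
  obtain ⟨k, τ, hk, hx, hP, hrep⟩ := hop σ r0 r1 (U.P.congr _ _ _ _ _ _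
    (fun a ha => (hm a (hr.1.trans ha.1)).symm) (L.rep j hj))
  refine ⟨k, U.P.t, _, _, τ, hk, hr.1, hr.2, hx, H _ ⟨L.built, ?_, ?_, ?_, ?_, ?_⟩ ?_ ⟨_, hP, ?_⟩ ?_⟩
  · exact L.a
  · intro i hi
    simpa [show i ≠ 14 by omega] using L.v i hi
  · simpa using L.K
  · intro i hi
    by_cases hij : i = j
    · subst hij; simpa using hrep
    · simp only [Store.tick_m, Store.setV_m]
      rw [Function.update_of_ne hij]
      refine U.P.congr _ _ _ _ _ _ (fun a ha => ?_) (L.rep i hi)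
      have hr' := L.range hi
      have h1 := ha.1
      have h2 := ha.2
      rw [hx.mem_eq, hm a (by omega)]
      rintro ⟨h3, h4⟩
      rcases lt_or_gt_of_ne hij with h5 | h5
      · have := L.built.disj i hi j hj h5; omega
      · have := L.built.disj j hj i hi h5; omega
  · intro i hi
    by_cases hij : i = j
    · subst hij; simpa using hX
    · rw [Function.update_of_ne hij]; exact L.sub i hi
  · intro i hi
    simpa using Function.update_of_ne hi _ _
  · simp
  · simp [Expr.cost]; omega

section Ops

variable {h₀ h : Store w} {en : ℕ → ℕ} {Z : ℕ → Set ℕ} {j : ℕ} {e e' : Expr} {Q : Store w → Prop}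

theorem Live.subset (L : U.Live h₀ en Z h) (hj : j < U.K) :
    Z j ⊆ ((U.M j).tnfa.states : Set ℕ) := by
  intro q hq
  rw [Finset.mem_coe, Regex.mem_tnfa_states, M_size]
  exact L.sub j hj q hq

theorem edge_lt {p q : ℕ} {l : Option (BitVec w)} (h : (U.M j).tnfa.edge p l q) :
    q < 2 * (U.g j).tree.size := by
  have := (Cut.micro_edge_range (o := 0) h).2.2.2
  omega

theorem Live.close (L : U.Live h₀ en Z h) (hj : j < U.K) (ok : e.Ok U.E h)
    (he : e.val U.E h = h₀.a 8 j)
    (H : ∀ h', U.Live h₀ en (Function.update Z j ((U.M j).tnfa.close (Z j))) h' →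
      (∀ i, i ≠ vR → h'.v i = h.v i) → h'.clk ≤ h.clk + (U.P.t + e.cost + 8) → Q h') :
    Wp U.E (callC U.E.r U.D.close e (.nat 0) (.nat 0) (.nat 0) vR) Q h := by
  refine L.call hj U.hclose ok (e' := .nat 0) trivial he (P := fun _ => True) ?_ ?_
    fun h' h1 h2 _ h3 => H h' h1 h2 (by simpa [Expr.cost] using h3)
  · rintro q ⟨p, hp, hpq⟩
    induction hpq with
    | refl => exact L.sub j hj p hp
    | tail _ he _ => exact edge_lt he
  · intro σ r0 _ hr
    obtain ⟨k, τ, h1, h2, h3⟩ := U.P.close U.E.inp _ _ _ _ σ (U.M_chars hj) (U.M_le hj) r0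
      (L.subset hj) hr
    exact ⟨k, τ, h1, h2, trivial, h3⟩

theorem Live.move (L : U.Live h₀ en Z h) (hj : j < U.K) (ok : e.Ok U.E h) (ok' : e'.Ok U.E h)
    (he : e.val U.E h = h₀.a 8 j) {a : BitVec w} (ha : BitVec.ofNat w (e'.val U.E h) = a)
    (has : a ∈ U.Sig)
    (H : ∀ h', U.Live h₀ en (Function.update Z j ((U.M j).tnfa.move (Z j) a)) h' →
      (∀ i, i ≠ vR → h'.v i = h.v i) → h'.clk ≤ h.clk + (U.P.t + e.cost + e'.cost + 7) → Q h') :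
    Wp U.E (callC U.E.r U.D.move e e' (.nat 0) (.nat 0) vR) Q h := by
  refine L.call hj U.hmove ok ok' he (P := fun _ => True) ?_ ?_
    fun h' h1 h2 _ h3 => H h' h1 h2 h3
  · rintro q ⟨p, hp, hpq⟩
    exact edge_lt hpq
  · intro σ r0 r1 hr
    rw [ha] at r1
    obtain ⟨k, τ, h1, h2, h3⟩ := U.P.move U.E.inp _ _ _ _ σ (U.M_chars hj) (U.M_le hj) r0
      (L.subset hj) hr (by rwa [r1])
    rw [r1] at h3
    exact ⟨k, τ, h1, h2, trivial, h3⟩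

theorem Live.member (L : U.Live h₀ en Z h) (hj : j < U.K) (ok : e.Ok U.E h) (ok' : e'.Ok U.E h)
    (he : e.val U.E h = h₀.a 8 j) {q : ℕ} (ha : e'.val U.E h = q)
    (hq : q < 2 * (U.g j).tree.size)
    (H : ∀ h', U.Live h₀ en Z h' → (∀ i, i ≠ vR → h'.v i = h.v i) → h'.v vR < 2 ^ w →
      (h'.v vR ≠ 0 ↔ q ∈ Z j) → h'.clk ≤ h.clk + (U.P.t + e.cost + e'.cost + 7) → Q h') :
    Wp U.E (callC U.E.r U.D.member e e' (.nat 0) (.nat 0) vR) Q h := by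
  refine L.call hj U.hmember ok ok' he (X := Z j) (P := fun b => b ≠ 0 ↔ q ∈ Z j) ?_ ?_ ?_
  · exact L.sub j hj
  · intro σ r0 r1 hr
    rw [ha] at r1
    exact U.P.member U.E.inp _ _ _ _ q σ (U.M_chars hj) (U.M_le hj) r0 (L.subset hj) hr
      (by rwa [M_size]) r1
  · rintro h' h1 h2 ⟨b, hb, hb'⟩ h3
    rw [Function.update_eq_self] at h1
    refine H h' h1 h2 (by rw [hb']; exact b.isLt) ?_ h3
    rw [hb', ← hb]
    exact (BitVec.toNat_eq (y := BitVec.ofNat w 0)).not.symm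

theorem Live.insert (L : U.Live h₀ en Z h) (hj : j < U.K) (ok : e.Ok U.E h) (ok' : e'.Ok U.E h)
    (he : e.val U.E h = h₀.a 8 j) {q : ℕ} (ha : e'.val U.E h = q)
    (hq : q < 2 * (U.g j).tree.size)
    (H : ∀ h', U.Live h₀ en (Function.update Z j (Z j ∪ {q})) h' →
      (∀ i, i ≠ vR → h'.v i = h.v i) → h'.clk ≤ h.clk + (U.P.t + e.cost + e'.cost + 7) → Q h') :
    Wp U.E (callC U.E.r U.D.insert e e' (.nat 0) (.nat 0) vR) Q h := by
  refine L.call hj U.hinsert ok ok' he (P := fun _ => True) ?_ ?_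
    fun h' h1 h2 _ h3 => H h' h1 h2 h3
  · rintro p (hp | rfl)
    · exact L.sub j hj p hp
    · exact hq
  · intro σ r0 r1 hr
    rw [ha] at r1
    obtain ⟨k, τ, h1, h2, h3⟩ := U.P.insert U.E.inp _ _ _ _ q σ (U.M_chars hj) (U.M_le hj) r0
      (L.subset hj) hr (by rwa [M_size]) r1
    exact ⟨k, τ, h1, h2, trivial, h3⟩

end Ops

end Setup

end WordRAM

/-! ### The two passes and the simulation as programs -/

namespace WordRAM

open WordRAM.Expr WordRAM.Prog

/-- Close part `vJ`, and pass on to its parent that it has been matched. -/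
def ascendBody (r : ℕ) (D : SimDS) : Prog :=
  raw (callC r D.close (arr 8 (var vJ)) (nat 0) (nat 0) (nat 0) vR) ;;
  ite (lt (add (var vJ) (nat 1)) (var vK))
    (raw (callC r D.member (arr 8 (var vJ)) (add (arr 9 (var vJ)) (nat 1)) (nat 0) (nat 0) vR) ;;
      ite (var vR)
        (raw (callC r D.insert (arr 10 (var vJ)) (add (arr 11 (var vJ)) (nat 1)) (nat 0) (nat 0) vR))
        skip)
    skip ;;
  set vJ (add (var vJ) (nat 1))

/-- Start part `vJ - 1` if its parent asks for it, and close it. -/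
def descendBody (r : ℕ) (D : SimDS) : Prog :=
  set vJ (sub (var vJ) (nat 1)) ;;
  ite (lt (add (var vJ) (nat 1)) (var vK))
    (raw (callC r D.member (arr 10 (var vJ)) (arr 11 (var vJ)) (nat 0) (nat 0) vR) ;;
      ite (var vR)
        (raw (callC r D.insert (arr 8 (var vJ)) (arr 9 (var vJ)) (nat 0) (nat 0) vR))
        skip)
    skip ;;
  raw (callC r D.close (arr 8 (var vJ)) (nat 0) (nat 0) (nat 0) vR)

/-- Close the state-sets under all `ε`-transitions. -/
def closeParts (r : ℕ) (D : SimDS) : Prog :=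
  set vJ (nat 0) ;;
  raw (whileC r (lt (var vJ) (var vK)) (ascendBody r D)) ;;
  raw (whileC r (var vJ) (descendBody r D))

def moveBody (r : ℕ) (D : SimDS) : Prog :=
  raw (callC r D.move (arr 8 (var vJ)) (var vC) (nat 0) (nat 0) vR) ;;
  set vJ (add (var vJ) (nat 1))

/-- Read a character. -/
def charBody (r : ℕ) (D : SimDS) : Prog :=
  set vC (inp 1 (var vI)) ;;
  set vJ (nat 0) ;;
  raw (whileC r (lt (var vJ) (var vK)) (moveBody r D)) ;;
  closeParts r D ;;
  set vI (add (var vI) (nat 1))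

/-- Match the string, and put the answer into `vR`. -/
def simulate (r : ℕ) (D : SimDS) : Prog :=
  set vJ (sub (var vK) (nat 1)) ;;
  raw (callC r D.insert (arr 8 (var vJ)) (arr 9 (var vJ)) (nat 0) (nat 0) vR) ;;
  closeParts r D ;;
  set vI (nat 0) ;;
  raw (whileC r (lt (var vI) (var vN)) (charBody r D)) ;;
  set vJ (sub (var vK) (nat 1)) ;;
  raw (callC r D.member (arr 8 (var vJ)) (add (arr 9 (var vJ)) (nat 1)) (nat 0) (nat 0) vR)

namespace Setup

variable {w : ℕ} {U : Setup w} {h₀ h : Store w} {en : ℕ → ℕ} {Y Z : ℕ → Set ℕ} {u : List (BitVec w)}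
  {Q : Store w → Prop}

/-- Only scratch variables have changed. -/
def SameVars (h h' : Store w) : Prop := ∀ i, i ≠ vR → i ≠ vJ → h'.v i = h.v i

theorem lt_two_pow {j : ℕ} (hj : j < U.K) : j + 1 < 2 ^ w ∧ U.K < 2 ^ w ∧ j < U.E.N := by
  have := U.hm; have := U.hKm; have := U.hN; omega

theorem SameVars.trans {h₁ h₂ h₃ : Store w} (H : SameVars h₁ h₂) (H' : SameVars h₂ h₃) :
    SameVars h₁ h₃ := fun i h1 h2 => (H' i h1 h2).trans (H i h1 h2)

theorem SameVars.of_ne {h₁ h₂ : Store w} (H : ∀ i, i ≠ vR → h₂.v i = h₁.v i) : SameVars h₁ h₂ :=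
  fun i h1 _ => H i h1

theorem ascendBody_spec {j : ℕ} (hj : j < U.K) (L : U.Live h₀ en Z h) (hJ : h.v vJ = j)
    (hZ : Cut.Layout.UpTo U.K U.g U.β Y u j Z)
    (H : ∀ Z' h', U.Live h₀ en Z' h' → h'.v vJ = j + 1 →
      Cut.Layout.UpTo U.K U.g U.β Y u (j + 1) Z' → SameVars h h' →
      h'.clk ≤ h.clk + (3 * U.P.t + 100) → Q h') :
    (ascendBody U.E.r U.D).wp U.E Q h := by
  obtain ⟨l1, l2, l3⟩ := lt_two_pow hj
  have h64 := U.h64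
  have h1l : 1 < 2 ^ w := by omega
  have hst := Cut.start_add U.g j
  simp only [vJ] at hJ
  simp only [ascendBody, Prog.wp]
  refine L.close hj (by simp [Expr.Ok, Expr.val, hJ, l3]) (by simp [Expr.val, hJ, L.a])
    fun h1 L1 v1 c1 => ?_
  have j1 : h1.v 13 = j := (v1 13 (by norm_num)).trans hJ
  have k1 : h1.v 7 = U.K := L1.K
  have hset : ∀ (h2 : Store w), SameVars h h2 →
      SameVars h ((h2.setV 13 (j + 1)).tick ((Expr.add (var vJ) (nat 1)).cost + 1)) := by
    intro h2 hs i i1 i2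
    simp only [vJ] at i2
    simpa [Function.update_of_ne i2] using hs i i1 i2
  have hlive : ∀ (Z') (h2 : Store w), U.Live h₀ en Z' h2 →
      U.Live h₀ en Z' ((h2.setV 13 (j + 1)).tick ((Expr.add (var vJ) (nat 1)).cost + 1)) := by
    intro Z' h2 hL
    exact hL.of_eq rfl (fun i hi => by simp [show i ≠ 13 by omega]) (by simp) rfl
  simp [Expr.cost] at c1
  refine ⟨by simp [Expr.Ok, Expr.val, j1, k1]; omega, ?_, fun ht => ?_, fun ht => ?_⟩
  · simp [Expr.val, j1, k1]; split_ifs <;> omega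
  · have hj1 : j + 1 < U.K := by
      simp only [Expr.val, vJ, vK, j1, k1] at ht
      by_contra hcon
      rw [if_neg hcon] at ht
      exact ht rfl
    have hpar := U.L.par_lt j hj1
    have hent := U.L.ent_lt hj1
    have hlink := L.built.link j hj1 hpar
    refine Live.member (L1.of_eq (h' := h1.tick _) rfl (fun _ _ => rfl) rfl rfl) hj
      (q := Cut.start U.g j + 1)
      (by simp [Expr.Ok, Expr.val, j1, l3]) (by simp [Expr.Ok, Expr.val, j1, l3])
      (by simp [Expr.val, j1, L1.a]) (by simp [Expr.val, j1, L1.a, L.start hj]) (by omega)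
      fun h2 L2 v2 lt2 m2 c2 => ?_
    have j2 : h2.v 13 = j := (v2 13 (by norm_num)).trans j1
    simp [Expr.cost] at c2
    have s2 : SameVars h h2 := (SameVars.of_ne v1).trans (SameVars.of_ne v2)
    rw [Function.update_self] at m2
    refine ⟨by norm_num [Expr.Ok], lt2, fun h0 => ?_, fun h0 => ?_⟩
    · refine Live.insert (L2.of_eq (h' := h2.tick _) rfl (fun _ _ => rfl) rfl rfl) hpar
        (q := (U.g j).ent + 1)
        (by simp [Expr.Ok, Expr.val, j2, l3]) (by simp [Expr.Ok, Expr.val, j2, l3])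
        (by simp [Expr.val, j2, L2.a, hlink.1]) (by simp [Expr.val, j2, L2.a, hlink.2])
        (by omega) fun h3 L3 v3 c3 => ?_
      have j3 : h3.v 13 = j := (v3 13 (by norm_num)).trans j2
      simp [Expr.cost] at c3
      simp only [vJ, Expr.val, j3]
      refine ⟨by norm_num, by norm_num [Expr.Ok], H _ _ (hlive _ _ L3) (by simp) ?_
        (hset _ (s2.trans (SameVars.of_ne v3))) ?_⟩
      · exact hZ.succ_insert U.L hj1 (m2.1 h0)
      · simp [Expr.cost]; omega
    · simp only [vJ, Expr.val, Store.tick_v, j2]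
      refine ⟨by norm_num, by norm_num [Expr.Ok], H _ _ (hlive _ _ (L2.of_eq rfl (fun _ _ => rfl) rfl rfl))
        (by simp) ?_ (hset _ s2) ?_⟩
      · refine hZ.succ hj fun hcon => (m2.2 hcon.2) h0
      · simp [Expr.cost]; omega
  · have hj1 : ¬j + 1 < U.K := by
      intro hcon
      simp only [Expr.val, vJ, vK, j1, k1, if_pos hcon] at ht
      omega
    simp only [vJ, Expr.val, Store.tick_v, j1]
    refine ⟨by norm_num, by norm_num [Expr.Ok], H _ _ (hlive _ _ (L1.of_eq rfl (fun _ _ => rfl) rfl rfl))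
      (by simp) ?_ (hset _ (SameVars.of_ne v1)) ?_⟩
    · exact hZ.succ hj fun hcon => hj1 hcon.1
    · simp [Expr.cost]; omega

theorem descendBody_spec {j : ℕ} (hj : j < U.K) (L : U.Live h₀ en Z h) (hJ : h.v vJ = j + 1)
    (hZ : Cut.Layout.DownTo U.K U.g U.β Y u (j + 1) Z)
    (H : ∀ Z' h', U.Live h₀ en Z' h' → h'.v vJ = j →
      Cut.Layout.DownTo U.K U.g U.β Y u j Z' → SameVars h h' →
      h'.clk ≤ h.clk + (3 * U.P.t + 100) → Q h') :
    (descendBody U.E.r U.D).wp U.E Q h := by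
  obtain ⟨l1, l2, l3⟩ := lt_two_pow hj
  have h64 := U.h64
  have h1l : 1 < 2 ^ w := by omega
  have hst := Cut.start_add U.g j
  simp only [vJ] at hJ
  have hK : h.v 7 = U.K := L.K
  simp only [descendBody, Prog.wp, Expr.val, vJ, hJ, Nat.add_sub_cancel]
  set h1 := (h.setV 13 j).tick ((Expr.sub (var 13) (nat 1)).cost + 1) with hh1
  have L1 : U.Live h₀ en Z h1 :=
    L.of_eq rfl (fun i hi => by simp [h1, show i ≠ 13 by omega]) (by simp [h1]) rfl
  have j1 : h1.v 13 = j := by simp [h1]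
  have k1 : h1.v 7 = U.K := L1.K
  have s1 : SameVars h h1 := fun i _ i2 => by
    simp only [vJ] at i2; simp [h1, Function.update_of_ne i2]
  have c1 : h1.clk = h.clk + 4 := rfl
  -- All branches end with the same call; `X` is the state-set of part `j` before it.
  have last : ∀ X h2, U.Live h₀ en (Function.update Z j X) h2 → h2.v 13 = j → SameVars h h2 →
      h2.clk ≤ h.clk + (2 * U.P.t + 80) →
      (X = Z j ∨ j + 1 < U.K ∧ X = Z j ∪ {Cut.start U.g j} ∧ (U.g j).ent ∈ Z (U.g j).par) →
      (j + 1 < U.K → (U.g j).ent ∈ Z (U.g j).par → Cut.start U.g j ∈ X) →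
      Wp U.E (callC U.E.r U.D.close (arr 8 (var 13)) (nat 0) (nat 0) (nat 0) 14) Q h2 := by
    intro X h2 L2 j2 s2 c2 hX hX'
    refine L2.close hj (by simp [Expr.Ok, Expr.val, j2, l3]) (by simp [Expr.val, j2, L2.a])
      fun h3 L3 v3 c3 => H _ _ L3 ((v3 13 (by norm_num)).trans j2) ?_ (s2.trans (SameVars.of_ne v3)) ?_
    · rw [Function.update_self, Function.update_idem]
      exact hZ.step U.L hj hX hX'
    · simp [Expr.cost] at c3; omega
  have L1' : U.Live h₀ en (Function.update Z j (Z j)) h1 := by rwa [Function.update_eq_self]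
  refine ⟨by norm_num, by norm_num [Expr.Ok, Expr.val, hJ], by simp [Expr.Ok, Expr.val, k1, j1]; omega, ?_,
    fun ht => ?_, fun ht => ?_⟩
  · split_ifs <;> omega
  · have hj1 : j + 1 < U.K := by
      simp only [vK, j1, k1] at ht
      by_contra hcon
      rw [if_neg hcon] at ht
      exact ht rfl
    have hpar := U.L.par_lt j hj1
    have hent := U.L.ent_lt hj1
    have hlink := L.built.link j hj1 hpar
    refine Live.member (L1.of_eq (h' := h1.tick _) rfl (fun _ _ => rfl) rfl rfl) hpar
      (q := (U.g j).ent)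
      (by simp [Expr.Ok, Expr.val, j1, l3]) (by simp [Expr.Ok, Expr.val, j1, l3])
      (by simp [Expr.val, j1, L1.a, hlink.1]) (by simp [Expr.val, j1, L1.a, hlink.2]) (by omega)
      fun h2 L2 v2 lt2 m2 c2 => ?_
    have j2 : h2.v 13 = j := (v2 13 (by norm_num)).trans j1
    simp [Expr.cost] at c2
    have s2 : SameVars h h2 := s1.trans (SameVars.of_ne v2)
    refine ⟨by norm_num [Expr.Ok], lt2, fun h0 => ?_, fun h0 => ?_⟩
    · refine Live.insert (L2.of_eq (h' := h2.tick _) rfl (fun _ _ => rfl) rfl rfl) hj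
        (q := Cut.start U.g j)
        (by simp [Expr.Ok, Expr.val, j2, l3]) (by simp [Expr.Ok, Expr.val, j2, l3])
        (by simp [Expr.val, j2, L2.a]) (by simp [Expr.val, j2, L2.a, L.start hj])
        (by omega) fun h3 L3 v3 c3 => ?_
      have j3 : h3.v 13 = j := (v3 13 (by norm_num)).trans j2
      simp [Expr.cost] at c3
      refine last _ _ L3 j3 (s2.trans (SameVars.of_ne v3)) (by omega) (.inr ⟨hj1, rfl, m2.1 h0⟩)
        fun _ _ => .inr rfl
    · refine last (Z j) _ ?_ j2 s2 (by simp [Expr.cost]; omega) (.inl rfl) fun _ he => absurd h0 (m2.2 he)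
      rw [Function.update_eq_self]
      exact L2.of_eq rfl (fun _ _ => rfl) rfl rfl
  · have hj1 : ¬j + 1 < U.K := by
      intro hcon
      simp only [vK, j1, k1, if_pos hcon] at ht
      omega
    exact last (Z j) _ (L1'.of_eq rfl (fun _ _ => rfl) rfl rfl) j1 s1 (by simp [Expr.cost]; omega)
      (.inl rfl) fun hcon => absurd hcon hj1

theorem closeParts_spec (L : U.Live h₀ en Y h) (hr : Cut.Reached U.K U.g u Y)
    (H : ∀ Z h', U.Live h₀ en Z h' → (∀ j < U.K, Y j ⊆ Z j) → Cut.Reached U.K U.g u Z →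
      Cut.IsClosed U.K U.g U.β Z → SameVars h h' →
      h'.clk ≤ h.clk + U.K * (6 * U.P.t + 210) + 20 → Q h') :
    (closeParts U.E.r U.D).wp U.E Q h := by
  have hK := lt_two_pow (U := U) (j := U.K - 1) (by have := U.L.pos; omega)
  simp only [closeParts, Prog.wp, Expr.val, Expr.Ok, true_and]
  refine ⟨by norm_num, ?_⟩
  refine Wp.whileC_lt (n := U.K) (j := 0) (I := fun j h' => ∃ Z, U.Live h₀ en Z h' ∧
    Cut.Layout.UpTo U.K U.g U.β Y u j Z ∧ h'.v vJ = j ∧ SameVars h h' ∧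
    h'.clk ≤ h.clk + 4 + j * (3 * U.P.t + 104)) (by norm_num) (by norm_num) hK.2.1 (Nat.zero_le _)
    ?_ ?_ ?_ ?_
  · refine ⟨Y, L.of_eq rfl (fun i hi => by simp [show i ≠ 13 by omega]) (by simp) rfl,
      Cut.Layout.upTo_zero hr, by simp, fun i _ i2 => ?_, by simp [Expr.cost]⟩
    simp only [vJ] at i2
    simp [Function.update_of_ne i2]
  · rintro j h' ⟨Z, L', -, hJ, -⟩
    exact ⟨hJ, L'.K⟩
  · rintro j hj h' ⟨Z, L', hZ, hJ, hs, hc⟩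
    refine ascendBody_spec hj (L'.of_eq rfl (fun _ _ => rfl) rfl rfl) hJ hZ
      fun Z' h'' L'' hJ' hZ' hs' hc' => ⟨Z', L'', hZ', hJ', hs.trans hs', ?_⟩
    simp at hc'
    rw [add_mul]
    omega
  · rintro h1 ⟨Z, L1, hZ, hJ, hs, hc⟩
    -- The downward loop runs until its counter is zero. The summand `j * (3 * U.P.t + 106)` is the
    -- time set aside for the rounds that are left.
    have key : ∀ (j : ℕ) (Z : ℕ → Set ℕ) (h1 : Store w), j ≤ U.K → U.Live h₀ en Z h1 →
        Cut.Layout.DownTo U.K U.g U.β Y u j Z → h1.v vJ = j → SameVars h h1 →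
        h1.clk + j * (3 * U.P.t + 106) ≤ h.clk + 8 + U.K * (6 * U.P.t + 210) →
        Wp U.E (whileC U.E.r (var vJ) (descendBody U.E.r U.D)) Q h1 := by
      intro j
      induction j with
      | zero =>
        intro Z h1 _ L1 hZ hJ hs hc
        refine Wp.whileC_done (by norm_num [Expr.Ok]) hJ (H Z _ (L1.of_eq rfl (fun _ _ => rfl) rfl rfl)
          hZ.sub hZ.reached hZ.isClosed hs ?_)
        simp [Expr.cost]; omega
      | succ j ih =>
        intro Z h1 hj L1 hZ hJ hs hc
        refine Wp.whileC_var_step (by norm_num) (by omega) (by omega) ?_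
        refine descendBody_spec hj (L1.of_eq rfl (fun _ _ => rfl) rfl rfl) hJ hZ
          fun Z' h'' L'' hJ' hZ' hs' hc' => ih Z' h'' (by omega) L'' hZ' hJ' (hs.trans hs') ?_
        simp at hc'
        rw [add_mul] at hc
        omega
    refine key U.K Z _ le_rfl (L1.of_eq rfl (fun _ _ => rfl) rfl rfl) hZ.downTo hJ hs ?_
    have e1 : U.K * (6 * U.P.t + 210) = U.K * (3 * U.P.t + 104) + U.K * (3 * U.P.t + 106) := by ring
    simp
    omega

end Setup

end WordRAM

/-! ### Reading characters and the whole string -/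

namespace WordRAM

open WordRAM.Expr WordRAM.Prog

namespace Setup

variable {w : ℕ} {U : Setup w} {h₀ h : Store w} {en : ℕ → ℕ} {Y Z : ℕ → Set ℕ} {u : List (BitVec w)}
  {Q : Store w → Prop}

theorem charBody_spec {s : ℕ} {a : BitVec w} (hβ : U.β ∉ U.Sig) (ha : a ∈ U.Sig)
    (hs : s < 2 ^ w) (hI : h.v vI = s) (has : (U.E.inp 1).getD s 0 = a) (L : U.Live h₀ en Z h)
    (hr : Cut.Reached U.K U.g u Z)
    (H : ∀ Z' h', U.Live h₀ en Z' h' → h'.v vI = s + 1 → Cut.Reached U.K U.g (u ++ [a]) Z' →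
      Cut.IsClosed U.K U.g U.β Z' →
      (∀ j < U.K, ∀ p ∈ Z j, ∀ q, (Cut.auto U.g U.β j).edge p (some a) q → q ∈ Z' j) →
      h'.clk ≤ h.clk + U.K * (7 * U.P.t + 300) → Q h') :
    (charBody U.E.r U.D).wp U.E Q h := by
  have hKpos := U.L.pos
  have hK := lt_two_pow (U := U) (j := U.K - 1) (by omega)
  simp only [vI] at hI
  simp only [charBody, Prog.wp, Expr.val, Expr.Ok, true_and, vC, vJ, vI, hI, has]
  refine ⟨by norm_num, ⟨by norm_num, hs⟩, by norm_num, ?_⟩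
  have h12 : ∀ i < 5, i ≠ 12 ∧ i ≠ 13 := by omega
  refine Wp.whileC_lt (n := U.K) (j := 0) (I := fun j h' =>
    U.Live h₀ en (fun i => if i < j then (U.M i).tnfa.move (Z i) a else Z i) h' ∧
    h'.v 13 = j ∧ h'.v 12 = a.toNat ∧ h'.v 5 = s ∧
    h'.clk ≤ h.clk + 10 + j * (U.P.t + 30)) (by norm_num) (by norm_num) hK.2.1 (Nat.zero_le _)
    ?_ ?_ ?_ ?_
  · refine ⟨?_, by simp, by simp, by simp [hI], by simp [Expr.cost]⟩
    simp only [Nat.not_lt_zero, if_false]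
    refine L.of_eq rfl (fun i hi => ?_) (by simp) rfl
    simp [h12 i hi]
  · rintro j h' ⟨L', hJ, -⟩
    exact ⟨hJ, L'.K⟩
  · rintro j hj h' ⟨L', hJ, hC, hI', hc⟩
    have hj' := lt_two_pow (U := U) hj
    simp only [moveBody, Prog.wp]
    refine Live.move (L'.of_eq (h' := h'.tick 4) rfl (fun _ _ => rfl) rfl rfl) hj (a := a)
      (by simp [Expr.Ok, Expr.val, hJ, hj']) (by norm_num [Expr.Ok])
      (by simp [Expr.val, hJ, L'.a]) (by simp [Expr.val, hC]) ha fun h1 L1 v1 c1 => ?_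
    have j1 : h1.v 13 = j := (v1 13 (by norm_num)).trans hJ
    have i1 : h1.v 5 = s := (v1 5 (by norm_num)).trans hI'
    have cc1 : h1.v 12 = a.toNat := (v1 12 (by norm_num)).trans hC
    simp [Expr.cost] at c1
    simp only [Expr.val, vJ, j1]
    refine ⟨by norm_num, by norm_num [Expr.Ok], ?_, by simp, by simp [cc1], by simp [i1], ?_⟩
    · have hupd : (fun i => if i < j + 1 then (U.M i).tnfa.move (Z i) a else Z i) =
          Function.update (fun i => if i < j then (U.M i).tnfa.move (Z i) a else Z i) j
            ((U.M j).tnfa.move (Z j) a) := by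
        funext i
        by_cases hij : i = j
        · subst hij; simp
        · rw [Function.update_of_ne hij]
          simp only [show i < j + 1 ↔ i < j by omega]
      rw [hupd]
      simp only [lt_irrefl, if_false] at L1
      exact L1.of_eq rfl (fun i hi => by simp [h12 i hi]) (by simp) rfl
    · simp [Expr.cost]
      rw [add_mul]
      omega
  · rintro h1 ⟨L1, -, -, i1, c1⟩
    refine closeParts_spec (u := u ++ [a]) (L1.of_eq rfl (fun _ _ => rfl) rfl rfl) ?_
      fun Z' h2 L2 z1 z2 z3 s2 c2 => ?_
    · intro j hj q hq
      simp only [if_pos hj] at hq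
      obtain ⟨p, hp, hpq⟩ := hq
      -- The new character `β` is not in the alphabet, so `a ≠ β` and the move is sound.
      exact hr.edge hj hp (l := some a) (by rintro ⟨⟩; exact hβ ha) hpq rfl
    · have i2 : h2.v 5 = s := (s2 5 (by norm_num) (by norm_num)).trans i1
      simp only [i2]
      refine ⟨by norm_num, by norm_num [Expr.Ok], H Z' _ (L2.of_eq rfl (fun i hi => ?_) (by simp) rfl)
        (by simp) z2 z3 ?_ ?_⟩
      · simp [show i ≠ 5 by omega]
      · intro j hj p hp q hq
        refine z1 j hj ?_
        simp only [if_pos hj]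
        exact ⟨p, hp, hq⟩
      · simp [Expr.cost] at c2 ⊢
        have e1 : U.K * (7 * U.P.t + 300) =
          U.K * (U.P.t + 30) + U.K * (6 * U.P.t + 210) + 60 * U.K := by ring
        omega

theorem simulate_spec {q : List (BitVec w)} (hβ : U.β ∉ U.Sig) (hq : ∀ a ∈ q, a ∈ U.Sig)
    (hinp : U.E.inp 1 = q) (hlen : q.length < 2 ^ w) (hN : h.v vN = q.length)
    (hB : U.Built U.K en h) (hK : h.v vK = U.K)
    (H : ∀ h', h'.v vR < 2 ^ w → (h'.v vR ≠ 0 ↔ q ∈ U.T.erase.lang) →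
      h'.clk ≤ h.clk + (q.length + 2) * (U.K * (8 * U.P.t + 400)) → Q h') :
    (simulate U.E.r U.D).wp U.E Q h := by
  have hKpos := U.L.pos
  have hKl := lt_two_pow (U := U) (j := U.K - 1) (by omega)
  have hr : U.K - 1 < U.K := by omega
  have hst := Cut.start_add U.g (U.K - 1)
  have hpos := (U.g (U.K - 1)).tree.size_pos
  have h13 : ∀ i < 5, i ≠ 13 := by omega
  simp only [vK] at hK
  simp only [simulate, Prog.wp, Expr.val, Expr.Ok, true_and, vJ, vI, vK, hK]
  refine ⟨by norm_num, ⟨by norm_num, hKpos⟩, ?_⟩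
  have L₀ : U.Live h en (fun _ => ∅) ((h.setV 13 (U.K - 1)).tick
      ((Expr.sub (var 7) (nat 1)).cost + 1)) :=
    ⟨hB, rfl, fun i hi => by simp [h13 i hi], by simp [hK], hB.rep, fun _ _ _ h => h.elim⟩
  refine Live.insert L₀ hr (q := Cut.start U.g (U.K - 1)) (by simp [Expr.Ok, Expr.val, hKl])
    (by simp [Expr.Ok, Expr.val, hKl]) (by simp [Expr.val]) (by simp [Expr.val, L₀.start hr])
    (by omega) fun h1 L1 v1 c1 => ?_
  simp [Expr.cost] at c1
  refine closeParts_spec (u := []) L1 ?_ fun Z₀ h2 L2 z1 z2 z3 s2 c2 => ?_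
  · intro j hj p hp
    by_cases hjr : j = U.K - 1
    · subst hjr
      obtain rfl : p = Cut.start U.g (U.K - 1) := by simpa using hp
      rw [Cut.Layout.pre_start, U.L.ctx_root]
      rfl
    · rw [Function.update_of_ne hjr] at hp
      exact hp.elim
  refine ⟨by norm_num, ?_⟩
  -- The family `F` keeps the state-sets after every prefix read, since completeness refers to all
  -- of them.
  refine Wp.whileC_lt (n := q.length) (j := 0) (I := fun s h' => ∃ F : ℕ → ℕ → Set ℕ,
    U.Live h en (F s) h' ∧ h'.v 5 = s ∧ (∀ s' ≤ s, Cut.IsClosed U.K U.g U.β (F s')) ∧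
    (∀ s' < s, ∀ (h : s' < q.length), ∀ j < U.K, ∀ p ∈ F s' j, ∀ p',
      (Cut.auto U.g U.β j).edge p (some q[s']) p' → p' ∈ F (s' + 1) j) ∧
    Cut.start U.g (U.K - 1) ∈ F 0 (U.K - 1) ∧ Cut.Reached U.K U.g (q.take s) (F s) ∧
    h'.clk ≤ h.clk + (s + 1) * (U.K * (7 * U.P.t + 304)) + U.P.t + 100)
    (by norm_num) (by norm_num) hlen (Nat.zero_le _) ?_ ?_ ?_ ?_
  · refine ⟨fun _ => Z₀, L2.of_eq rfl (fun i hi => ?_) (by simp) rfl, by simp, fun _ _ => z3,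
      fun _ h => absurd h (Nat.not_lt_zero _), z1 _ hr (by simp), by simpa using z2, ?_⟩
    · simp [show i ≠ 5 by omega]
    · have e1 : U.K * (7 * U.P.t + 304) = U.K * (6 * U.P.t + 210) + U.K * (U.P.t + 94) := by ring
      simp [Expr.cost]
      omega
  · rintro s h' ⟨F, L', hI, -⟩
    exact ⟨hI, (L'.v 1 (by norm_num)).trans hN⟩
  · rintro s hs h' ⟨F, L', hI, f1, f2, f3, f4, hc⟩
    refine charBody_spec (a := q[s]) hβ (hq _ (List.getElem_mem hs)) (by omega) hI
      (by simp [hinp, hs]) (L'.of_eq rfl (fun _ _ => rfl) rfl rfl) f4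
      fun Z' h'' L'' hI' z1 z2 z3 hc' => ⟨Function.update F (s + 1) Z', ?_, hI', ?_, ?_, ?_, ?_, ?_⟩
    · rwa [Function.update_self]
    · intro s' hs'
      by_cases hs1 : s' = s + 1
      · rw [hs1, Function.update_self]; exact z2
      · rw [Function.update_of_ne hs1]; exact f1 s' (by omega)
    · intro s' hs' hsq j hj p hp p' he
      rw [Function.update_of_ne (by omega)] at hp
      by_cases hs1 : s' = s
      · subst hs1; rw [Function.update_self]; exact z3 j hj p hp p' he
      · rw [Function.update_of_ne (by omega)]; exact f2 s' (by omega) hsq j hj p hp p' he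
    · rw [Function.update_of_ne (by omega)]; exact f3
    · rw [Function.update_self, ← List.take_concat_get' q s hs]
      simpa using z1
    · simp at hc'
      have e1 : (s + 1 + 1) * (U.K * (7 * U.P.t + 304)) =
        (s + 1) * (U.K * (7 * U.P.t + 304)) + U.K * (7 * U.P.t + 300) + 4 * U.K := by ring
      omega
  · rintro h3 ⟨F, L3, hI, f1, f2, f3, f4, hc⟩
    have k3 : h3.v 7 = U.K := L3.K
    rw [List.take_length] at f4
    simp only [Store.tick_v, k3]
    refine ⟨by norm_num, ⟨by norm_num, hKpos⟩, ?_⟩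
    refine Live.member (L3.of_eq rfl (fun i hi => by simp [h13 i hi]) (by simp) rfl) hr
      (q := Cut.start U.g (U.K - 1) + 1) (by simp [Expr.Ok, Expr.val, hKl])
      (by simp [Expr.Ok, Expr.val, hKl]) (by simp [Expr.val, L3.a])
      (by simp [Expr.val, L3.a, L₀.start hr]) (by omega) fun h4 L4 v4 lt4 m4 c4 => H h4 lt4 ?_ ?_
    · rw [m4]
      exact U.L.mem_lang_iff (H := F) f1 (fun s hs => f2 s hs hs) f3 f4
    · simp [Expr.cost] at c4
      have e1 : (q.length + 2) * (U.K * (8 * U.P.t + 400)) = (q.length + 1) * (U.K * (7 * U.P.t + 304))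
        + (q.length + 1) * (U.K * (U.P.t + 96)) + U.K * (8 * U.P.t + 400) := by ring
      have e2 : 8 * U.P.t + 400 ≤ U.K * (8 * U.P.t + 400) := Nat.le_mul_of_pos_left _ hKpos
      omega

end Setup

end WordRAM

/-! ### The complete algorithm -/

namespace WordRAM

open WordRAM.Expr WordRAM.Prog

/-- The matching algorithm. -/
def matchProg (r : ℕ) (D : SimDS) : Prog :=
  set vI (nat 0) ;;
  raw (tableC r) ;;
  -- For the empty string the bound is of order `m p(x) / x`, in which operations of time `t(x)`
  -- cannot be charged.
  ite (eq (var vN) (nat 0))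
    (set vR (arr 1 (sub (var vM) (nat 1))))
    (ite (lt (var vX) (nat 10))
      (direct r)
      (set vY (shr (add (var vX) (nat 2)) (nat 2)) ;; partitionExpr r D.pre ;; simulate r D))

theorem ite_lt_two_pow {w : ℕ} (hw : 1 < 2 ^ w) (P : Prop) [Decidable P] :
    (if P then 1 else 0) < 2 ^ w := by
  split_ifs <;> omega

/-- Time bounds are required for each branch separately, and a partition only where it is used. -/
theorem matchProg_spec {w : ℕ} {E : Env w} {D : SimDS} {R : Regex (BitVec w)}
    {q : List (BitVec w)} {x : ℕ} {β : BitVec w} {t : ℕ} {h : Store w}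
    (h64 : 64 ≤ 2 ^ w) (hm : 2 * R.size < 2 ^ w) (hE : E.inp = matchInput R q)
    (hN : E.N = R.size + 2) (hlen : q.length < 2 ^ w) (hx : x + 2 < 2 ^ w)
    (hvM : h.v vM = R.size) (hvN : h.v vN = q.length) (hvX : h.v vX = x)
    (hvB : h.v vB = β.toNat) (ha : h.a = fun _ _ => 0) (hmem : h.m = fun _ => 0)
    (ht : h.clk + 200 * R.size + 100 ≤ t)
    (hd : q ≠ [] → x < 10 → h.clk + 200 * R.size + 100 + 1000 * R.size * (q.length + 1) ≤ t)
    (hu : q ≠ [] → 10 ≤ x → ∃ U : Setup w, U.E = E ∧ U.D = D ∧ U.x = x ∧ U.β = β ∧ U.m = R.size ∧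
      U.y = (x + 2) / 4 ∧ U.T = Regex.cutOff U.y (R.split U.y) ∧ U.K = U.T.cnt + 1 ∧ β ∉ U.Sig ∧
      (∀ a ∈ q, a ∈ U.Sig) ∧
      h.clk + 200 * R.size + 100 + (500 * R.size + (U.P.p + 1000) * U.K) +
        (q.length + 2) * (U.K * (8 * U.P.t + 400)) ≤ t) :
    (matchProg E.r D).wp E
      (fun h' => h'.v vR < 2 ^ w ∧ (h'.v vR ≠ 0 ↔ q ∈ R.lang) ∧ h'.clk ≤ t) h := by
  have hc : R.CodeAt (E.inp 0) 0 := by rw [hE]; exact R.codeAt_code (by omega)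
  have hpos := R.size_pos
  refine ⟨by norm_num, trivial, table_loop h64 hm (by omega) R 0 _ _ hc (by simp [Expr.val])
    (by simpa using hvM) (by omega) fun h1 i1 k1 t1 _ c1 => ?_⟩
  have e0 : h1.v 0 = R.size := (k1.v 0 (by norm_num)).trans (by simpa using hvM)
  have e1 : h1.v 1 = q.length := (k1.v 1 (by norm_num)).trans (by simpa using hvN)
  have e2 : h1.v 2 = x := (k1.v 2 (by norm_num)).trans (by simpa using hvX)
  have e3 : h1.v 3 = β.toNat := (k1.v 3 (by norm_num)).trans (by simpa using hvB)
  have em : h1.m = fun _ => 0 := k1.m.trans (by simpa using hmem)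
  have ea : ∀ i, h1.a 4 i = 0 := fun i => by
    rw [k1.a 4 (by simp)]; simp [ha]
  simp [Expr.cost] at c1
  refine Wp.whileC_lt_done (by norm_num) (by norm_num) (by simp [e0]; omega)
    (by simp [i1, e0]) ?_
  have hr := t1.root
  rw [zero_add] at hr
  refine ⟨by simp [Expr.Ok, Expr.val, e1, hlen], ?_, fun h0 => ?_, fun h0 => ?_⟩
  · simp only [Expr.val]; exact ite_lt_two_pow (by omega) _
  · simp [Expr.val, e1] at h0
    have hq : q = [] := h0
    refine ⟨by norm_num, ?_, ?_⟩
    · simp [Expr.Ok, Expr.val, e0, hN]; omega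
    · simp [Expr.val, Expr.cost, e0, hr.2, hq, ← R.nullable_iff]
      refine ⟨?_, ?_⟩
      · have := Bool.toNat_le R.nullable; omega
      · omega
  · simp [Expr.val, e1] at h0
    have hq : q ≠ [] := h0
    refine ⟨by simp [Expr.Ok, Expr.val, e2]; omega, ?_, fun h10 => ?_, fun h10 => ?_⟩
    · simp only [Expr.val]; exact ite_lt_two_pow (by omega) _
    · simp [Expr.val, e2] at h10
      refine direct_spec h64 (by rw [hE]; rfl) (by rw [hE]; rfl) hm (by omega) hlen hq t1
        (by simpa using e0) (by simpa using e1) (fun i _ => ea i) fun h' hR hcl => ⟨hR.1, hR.2, ?_⟩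
      have := hd hq h10
      simp [Expr.cost] at hcl
      omega
    · simp [Expr.val, e2] at h10
      obtain ⟨U, rfl, rfl, rfl, rfl, hUm, hUy, hT, hK, hβ, hqs, hb⟩ := hu hq h10
      refine ⟨by norm_num, by simp [Expr.Ok, Expr.val, e2]; omega, ?_⟩
      refine Setup.partitionExpr_spec (by omega) hUm.symm hT hK hc ⟨?_, ?_, ?_, ?_⟩ t1
        (fun a _ => by simp [em]) fun en h2 B2 v2 K2 c2 => ?_
      · simpa [hUm] using e0
      · simpa using e2
      · simpa using e3
      · simp [Expr.val, e2, hUy]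
      · have n2 : h2.v 1 = q.length := (v2 1 (by norm_num)).trans (by simpa using e1)
        refine Setup.simulate_spec hβ hqs (by rw [hE]; rfl) hlen n2 B2 K2
          fun h3 lt3 m3 c3 => ⟨lt3, ?_, ?_⟩
        · rw [m3, hT, Regex.erase_cutOff, Regex.erase_split]
        · simp [Expr.cost] at c2
          rw [hUm] at c2
          omega

/-- The matching algorithm, applied to the input of a program. -/
def matchCmd (r : ℕ) (D : SimDS) : Cmd :=
  .seq (.seq (.bin .and (r + 0) 0 0) (.seq (.bin .and (r + 1) 1 1)
    (.seq (.bin .and (r + 2) 2 2) (.bin .and (r + 3) 3 3))))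
    (.seq ((matchProg r D).comp r) (.bin .and 0 (r + vR) (r + vR)))

/-- The store at the start of the matching algorithm. -/
def matchStore {w : ℕ} (m n x : ℕ) (β : BitVec w) : Store w where
  v
    | 0 => m
    | 1 => n
    | 2 => x
    | 3 => β.toNat
    | _ => 0
  a _ _ := 0
  m _ := 0
  -- Four steps have copied the input registers to variables.
  clk := 4

theorem exec_matchCmd {w : ℕ} {E : Env w} {D : SimDS} {R : Regex (BitVec w)}
    {q : List (BitVec w)} {x : ℕ} {β : BitVec w} {t : ℕ} (hr : 4 ≤ E.r)
    (hE : E.inp = matchInput R q)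
    (H : (matchProg E.r D).wp E
      (fun h' => h'.v vR < 2 ^ w ∧ (h'.v vR ≠ 0 ↔ q ∈ R.lang) ∧ h'.clk ≤ t)
      (matchStore R.size q.length x β)) :
    ∃ k τ, k ≤ t + 1 ∧ Exec (matchInput R q) (block w 0 E.S) (matchCmd E.r D)
      (matchInit R q x β) k τ ∧ (τ.reg 0 ≠ 0 ↔ q ∈ R.lang) := by
  have step : ∀ (υ : State w) (s t : ℕ),
      Exec E.inp (block w 0 E.S) (.bin .and s t t) υ 1 (υ.setReg s (υ.reg t)) := by
    intro υ s t
    have := Exec.bin (inp := E.inp) (M := block w 0 E.S) υ .and s t t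
    simpa [BinOp.eval] using this
  set σ := matchInit R q x β with hσ
  have hreg : ∀ i, 4 ≤ i → σ.reg i = 0 := fun i hi => by
    obtain ⟨j, rfl⟩ := Nat.exists_eq_add_of_le' hi
    rfl
  set σ' := (((σ.setReg (E.r + 0) (σ.reg 0)).setReg (E.r + 1) (σ.reg 1)).setReg (E.r + 2)
    (σ.reg 2)).setReg (E.r + 3) (σ.reg 3) with hσ'
  have h0 := step σ (E.r + 0) 0
  have h1 := step (σ.setReg (E.r + 0) (σ.reg 0)) (E.r + 1) 1
  rw [State.setReg_ne (s := 1) _ _ _ (by omega)] at h1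
  have h2 := step ((σ.setReg (E.r + 0) (σ.reg 0)).setReg (E.r + 1) (σ.reg 1)) (E.r + 2) 2
  rw [State.setReg_ne (s := 2) _ _ _ (by omega), State.setReg_ne (s := 2) _ _ _ (by omega)] at h2
  have h3 := step (((σ.setReg (E.r + 0) (σ.reg 0)).setReg (E.r + 1) (σ.reg 1)).setReg (E.r + 2)
    (σ.reg 2)) (E.r + 3) 3
  rw [State.setReg_ne (s := 3) _ _ _ (by omega), State.setReg_ne (s := 3) _ _ _ (by omega),
    State.setReg_ne (s := 3) _ _ _ (by omega)] at h3
  have hH : Holds E σ' (matchStore R.size q.length x β) := by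
    refine ⟨fun i _ => ?_, fun k _ i _ => rfl, fun a _ => rfl⟩
    rw [hσ']
    match i with
    | 0 =>
      rw [State.setReg_ne _ _ _ (by omega), State.setReg_ne _ _ _ (by omega),
        State.setReg_ne _ _ _ (by omega), State.setReg_self]; rfl
    | 1 =>
      rw [State.setReg_ne _ _ _ (by omega), State.setReg_ne _ _ _ (by omega),
        State.setReg_self]; rfl
    | 2 => rw [State.setReg_ne _ _ _ (by omega), State.setReg_self]; rfl
    | 3 => rw [State.setReg_self]; change β = BitVec.ofNat w β.toNat; simp
    | i + 4 =>
      iterate 4 rw [State.setReg_ne _ _ _ (by omega)]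
      exact hreg _ (by omega)
  obtain ⟨k, τ, h', hx, hτ, hk, hlt, hiff, ht⟩ := Prog.wp_comp H σ' hH
  refine ⟨1 + (1 + (1 + 1)) + (k + 1), τ.setReg 0 (τ.reg (E.r + vR)), ?_, ?_, ?_⟩
  · change 4 + k ≤ _ at hk
    omega
  · rw [← hE]
    exact (h0.seq (h1.seq (h2.seq h3))).seq (hx.seq (step _ _ _))
  · rw [State.setReg_self, hτ.var _ (by norm_num), ofNat_ne_zero_iff hlt, hiff]

/-- A bound `u` for each of the `K ≤ 14 m / x` parts is summed up, with `u` one of `s(x)`, `p(x)`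
and `t(x)`. -/
theorem mul_le_mul_div {K m x u : ℝ} (hx : 0 < x) (hK : K * x ≤ 14 * m) (hu : 0 ≤ u) :
    K * u ≤ 14 * (m * u / x) := by
  have h : K * u = K * x * u / x := by field_simp
  rw [h, ← mul_div_assoc, ← mul_assoc]
  gcongr

end WordRAM

/-! ### Choice of the partition and of the constants -/

open WordRAM in
-- Space bounds a natural number, so `c * s(x)` is nonnegative; this yields `0 ≤ c`, although `c` is
-- an arbitrary real number.
theorem SimDS.Supports.nonneg {D : SimDS} {w x : ℕ} {Sig : Set (BitVec w)} {β : BitVec w}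
    {t s p : ℝ} (h : D.Supports w x Sig β t s p) : 0 ≤ s := by
  obtain ⟨B, hB, -⟩ := h
  exact B.cast_nonneg.trans hB

open WordRAM in
theorem Regex.exists_setup {w m x : ℕ} {D : SimDS} {Sig : Set (BitVec w)} {β : BitVec w}
    (P : D.Sim w x Sig β) (R : Regex (BitVec w)) (hR : R.chars ⊆ Sig) (hm : R.size = m)
    (hx : 10 ≤ x) (hxm : x < m) (h64 : 64 ≤ 2 ^ w) (h2m : 2 * m + 2 < 2 ^ w)
    (inp : ℕ → List (BitVec w)) {r : ℕ} (hr : max 4 (max D.pre.regBound (max D.move.regBound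
      (max D.close.regBound (max D.member.regBound D.insert.regBound)))) ≤ r)
    (hS : ∀ K, K * x ≤ 14 * m → 16 * (m + 2) + K * P.B < 2 ^ w) :
    ∃ U : Setup w, U.K * x ≤ 14 * m ∧ U.D = D ∧ U.x = x ∧ U.β = β ∧ U.m = m ∧ U.E.inp = inp ∧
      U.E.r = r ∧ U.E.N = m + 2 ∧ U.E.S = 16 * (m + 2) + U.K * P.B ∧
      U.P.p = P.p ∧ U.P.t = P.t ∧ U.Sig = Sig ∧
      U.y = (x + 2) / 4 ∧ U.T = Regex.cutOff U.y (R.split U.y) ∧ U.K = U.T.cnt + 1 := by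
  simp only [max_le_iff] at hr
  obtain ⟨hr4, hpre, hmove, hclose, hmember, hinsert⟩ := hr
  obtain ⟨y, hy⟩ : ∃ y, y = (x + 2) / 4 := ⟨_, rfl⟩
  have hy3 : 3 ≤ y := by omega
  obtain ⟨h1, h2⟩ := Regex.split_spec hy3 R hR
  obtain ⟨h3, h4⟩ := Regex.size_cutOff hy3 (Regex.size_split hy3 R).1
  obtain ⟨T, hT⟩ : ∃ T, T = Regex.cutOff y (R.split y) := ⟨_, rfl⟩
  rw [← hT] at h3 h4
  obtain ⟨g, L, hg⟩ := Cut.exists_layout T (fun S => S.size < 2 * y ∧ S.erase.chars ⊆ Sig)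
    ⟨by omega, by rwa [hT, Regex.erase_cutOff, Regex.erase_split]⟩
    (by rw [hT]; exact Regex.allHoles_cutOff h1 h2)
  have hcnt : T.cnt ≤ (y - 2) * T.cnt := Nat.le_mul_of_pos_left _ (by omega)
  have hKx : (T.cnt + 1) * x ≤ 14 * m := by
    -- For `10 ≤ x` one has `x ≤ 13 * (y - 2)`, with equality for `x = 13` and `y = 3`. The part of
    -- the root adds `x < m`, which makes `14 * m`.
    have : T.cnt * x ≤ T.cnt * (13 * (y - 2)) := Nat.mul_le_mul_left _ (by omega)
    have e : T.cnt * (13 * (y - 2)) = 13 * ((y - 2) * T.cnt) := by ring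
    rw [add_mul]
    omega
  refine ⟨{
    D := D, x := x, Sig := Sig, β := β, P := P
    E := ⟨inp, r, m + 2, 16 * (m + 2) + (T.cnt + 1) * P.B, by omega, (hS _ hKx).le⟩
    m := m, y := y, T := T, K := T.cnt + 1, g := g, L := L, h64 := h64, hm := h2m
    hxw := by omega
    hN := le_rfl, hS := le_rfl, hSw := hS _ hKx
    hr := hr4, hpre := hpre, hmove := hmove, hclose := hclose, hmember := hmember
    hinsert := hinsert
    hyx := by omega
    hy3 := hy3
    hKm := by omega
    hg := hg
    hgm := fun k hk => by have := (hg k hk).1; omega },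
    hKx, rfl, rfl, rfl, rfl, rfl, rfl, rfl, rfl, rfl, rfl, rfl, hy, hT, rfl⟩

theorem lemma6 :
    ∀ c : ℝ, ∃ C : ℝ, ∀ D : SimDS, ∃ prog : WordRAM.Cmd,
      ∀ (t s p : ℕ → ℝ) (w x m n : ℕ) (Sig : Set (BitVec w)) (β : BitVec w)
        (R : Regex (BitVec w)) (Q : List (BitVec w)),
        -- `β` is a new character, `R` and `Q` are over `Sig`, of lengths `m` and `n`
        β ∉ Sig → R.chars ⊆ Sig → (∀ a ∈ Q, a ∈ Sig) → R.size = m → Q.length = n →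
        0 < x → x < m →
        -- an operation takes a step, and a TNFA with `x` states takes `x` words and steps to read
        1 ≤ t x → (x : ℝ) ≤ s x → (x : ℝ) ≤ p x →
        -- words hold the length of the string and the addresses of the working memory
        n < 2 ^ w → C * (m * s x / x) ≤ 2 ^ w →
        D.Supports w x Sig β (c * t x) (c * s x) (c * p x) →
        WordRAM.SolvesMatching prog R Q x β
          (C * (n * m * t x / x + m * p x / x)) (C * (m * s x / x)) := by
  intro c
  -- The constant is chosen before it is known that `c` is nonnegative, hence the absolute value.
  -- The factor is generous.
  refine ⟨100000 * (|c| + 1), fun D => ?_⟩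
  obtain ⟨r, hr⟩ : ∃ r, r = max 4 (max D.pre.regBound (max D.move.regBound (max D.close.regBound
    (max D.member.regBound D.insert.regBound)))) := ⟨_, rfl⟩
  have hr4 : 4 ≤ r := hr ▸ le_max_left ..
  refine ⟨WordRAM.matchCmd r D, ?_⟩
  intro t s p w x m n Sig β R Q hβ hR hQ hm hn hx0 hxm ht hs hp hnw hC hD
  have x0 : (0 : ℝ) < x := by exact_mod_cast hx0
  have xm : (x : ℝ) ≤ m := by exact_mod_cast hxm.le
  have m2 : (2 : ℝ) ≤ m := by exact_mod_cast (show 2 ≤ m by omega)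
  have n0 : (0 : ℝ) ≤ n := n.cast_nonneg
  have c0 : 0 ≤ c := nonneg_of_mul_nonneg_left hD.nonneg (x0.trans_le hs)
  rw [abs_of_nonneg c0] at hC ⊢
  have hA : (m : ℝ) ≤ m * s x / x := by rw [le_div_iff₀ x0]; gcongr
  have hG : (m : ℝ) ≤ m * p x / x := by rw [le_div_iff₀ x0]; gcongr
  have hT : 0 ≤ n * m * t x / x := by positivity
  obtain ⟨A, eA⟩ : ∃ A : ℝ, A = m * s x / x := ⟨_, rfl⟩
  obtain ⟨G, eG⟩ : ∃ G, G = m * p x / x := ⟨_, rfl⟩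
  obtain ⟨T, eT⟩ : ∃ T, T = n * m * t x / x := ⟨_, rfl⟩
  rw [← eA] at hC hA ⊢
  rw [← eG] at hG ⊢
  rw [← eT] at hT ⊢
  have hcA : 0 ≤ c * A := mul_nonneg c0 (by linarith)
  have hcG : 0 ≤ c * G := mul_nonneg c0 (by linarith)
  have hcT : 0 ≤ c * T := by positivity
  -- Words are long enough for the constants of the program because `C * (m * s x / x) ≤ 2 ^ w` and
  -- `m ≤ m * s x / x`.
  have h64 : 64 ≤ 2 ^ w := by
    have : (64 : ℝ) ≤ 2 ^ w := by linarith
    exact_mod_cast this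
  have h2m : 2 * m + 2 < 2 ^ w := by
    have : (2 * m + 2 : ℝ) < 2 ^ w := by linarith
    exact_mod_cast this
  subst hm hn
  have h16 : 16 * (R.size + 2) < 2 ^ w := by
    have : (16 * (R.size + 2) : ℝ) < 2 ^ w := by linarith
    exact_mod_cast this
  -- Exactly in the first case the program builds a partition and calls `D`.
  by_cases hbig : Q ≠ [] ∧ 10 ≤ x
  · obtain ⟨hQ0, h10⟩ := hbig
    obtain ⟨P, Pt, PB, Pp⟩ := hD.exists_sim (by positivity)
      (mul_nonneg c0 (x0.le.trans hp))
    -- The arrays take `16 * (m + 2) ≤ 32 * m` cells since `m ≥ 2`, and the blocks at most `14 * (c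
    -- + 1) * A`, which makes `46`.
    have hS : ∀ K : ℕ, K * x ≤ 14 * R.size →
        ((16 * (R.size + 2) + K * P.B : ℕ) : ℝ) ≤ 46 * (c + 1) * A := by
      intro K hK
      have hK' : (K * x : ℝ) ≤ 14 * R.size := by exact_mod_cast hK
      have h1 := WordRAM.mul_le_mul_div x0 hK' (x0.le.trans hs)
      rw [← eA] at h1
      have h2 : (K * P.B : ℝ) ≤ (c + 1) * (K * s x) := by
        calc (K * P.B : ℝ) ≤ K * (c * s x + x) := by gcongr
          _ ≤ K * (c * s x + s x) := by gcongr
          _ = _ := by ring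
      have h3 : (c + 1) * (K * s x) ≤ (c + 1) * (14 * A) := by gcongr
      push_cast
      linarith
    have hSw : ∀ K : ℕ, K * x ≤ 14 * R.size → 16 * (R.size + 2) + K * P.B < 2 ^ w := by
      intro K hK
      have : ((16 * (R.size + 2) + K * P.B : ℕ) : ℝ) < 2 ^ w := (hS K hK).trans_lt (by linarith)
      exact_mod_cast this
    obtain ⟨U, hK, rfl, ex, rfl, em, ei, er, eN, eE, ep, et, rfl, ey, eT', eK⟩ :=
      Regex.exists_setup P R hR rfl h10 hxm h64 h2m (WordRAM.matchInput R Q) hr.ge hSw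
    obtain ⟨k, τ, hk, hex, hiff⟩ := WordRAM.exec_matchCmd (D := U.D) (R := R) (q := Q) (x := x)
      (β := U.β) (E := U.E)
      (t := 104 + 200 * R.size + (500 * R.size + (P.p + 1000) * U.K) +
        (Q.length + 2) * (U.K * (8 * P.t + 400))) (by omega) ei
      (WordRAM.matchProg_spec h64 (by omega) ei eN hnw (x := x) (by omega) rfl rfl rfl rfl rfl rfl
        (by simp [WordRAM.matchStore]; omega) (fun _ _ => by omega)
        fun _ _ => ⟨U, rfl, rfl, ex, rfl, em, ey, eT', eK, hβ, hQ, by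
          rw [ep, et]; simp [WordRAM.matchStore]; omega⟩)
    rw [er] at hex
    refine ⟨k, U.E.S, τ, ?_, ?_, hex, hiff⟩
    · have n1 : (1 : ℝ) ≤ Q.length := by
        exact_mod_cast List.length_pos_iff.2 hQ0
      have hK' : (U.K * x : ℝ) ≤ 14 * R.size := by exact_mod_cast hK
      have k1 := WordRAM.mul_le_mul_div x0 hK' (x0.le.trans hp)
      rw [← eG] at k1
      have k2 : (U.K : ℝ) ≤ 14 * R.size := by
        have : (1 : ℝ) ≤ x := by exact_mod_cast hx0
        exact (le_mul_of_one_le_right U.K.cast_nonneg this).trans hK'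
      have k3 := WordRAM.mul_le_mul_div x0 hK' (zero_le_one.trans ht)
      have k4 : (P.p : ℝ) * U.K ≤ c * (14 * G) :=
        calc (P.p : ℝ) * U.K ≤ c * p x * U.K := by gcongr
          _ = c * (U.K * p x) := by ring
          _ ≤ _ := by gcongr
      -- The string is nonempty, so `n + 2 ≤ 3 * n`, and `42 = 3 * 14`.
      have k5 : ((Q.length : ℝ) + 2) * (U.K * (8 * P.t + 400)) ≤ (8 * c + 400) * (42 * T) :=
        calc ((Q.length : ℝ) + 2) * (U.K * (8 * P.t + 400))
            ≤ (3 * Q.length) * (U.K * (8 * (c * t x) + 400 * t x)) := by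
              gcongr <;> linarith
          _ = (8 * c + 400) * (3 * Q.length * (U.K * t x)) := by ring
          _ ≤ (8 * c + 400) * (3 * Q.length * (14 * (R.size * t x / x))) := by gcongr
          _ = _ := by rw [eT]; ring
      have hk' : (k : ℝ) ≤ 104 + 200 * R.size + (500 * R.size + (P.p + 1000) * U.K) +
        (Q.length + 2) * (U.K * (8 * P.t + 400)) + 1 := by exact_mod_cast hk
      linarith
    · rw [eE]
      exact (hS _ hK).trans (by linarith)
  · obtain ⟨k, τ, hk, hex, hiff⟩ := WordRAM.exec_matchCmd (D := D) (R := R) (q := Q) (x := x)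
      (β := β) (E := ⟨WordRAM.matchInput R Q, r, R.size + 2, 16 * (R.size + 2), le_rfl, h16.le⟩)
      (t := 104 + 200 * R.size + if Q = [] then 0 else 1000 * R.size * (Q.length + 1)) hr4 rfl
      (WordRAM.matchProg_spec h64 (by omega) rfl rfl hnw (x := x) (by omega) rfl rfl rfl rfl rfl rfl
        (by simp [WordRAM.matchStore]; omega) (fun h _ => by simp [WordRAM.matchStore, h]; omega)
        fun h h' => absurd ⟨h, h'⟩ hbig)
    refine ⟨k, _, τ, ?_, ?_, hex, hiff⟩
    · have h1 : Q ≠ [] → x ≤ 10 := fun h => not_lt.1 fun h' => hbig ⟨h, h'.le⟩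
      -- Either the string is empty or `x ≤ 10 ≤ 10 * t x`, so that time `n * m` fits into the
      -- bound.
      have h2 : (R.size * Q.length : ℝ) ≤ 10 * T := by
        by_cases hQ0 : Q = []
        · rw [hQ0] at n0 ⊢; simp; linarith
        · have h10 : (x : ℝ) ≤ 10 := by exact_mod_cast h1 hQ0
          rw [eT, ← mul_div_assoc, le_div_iff₀ x0]
          calc (R.size * Q.length * x : ℝ) ≤ R.size * Q.length * (10 * t x) := by
                gcongr; linarith
            _ = _ := by ring
      have h3 : k ≤ 105 + 1200 * R.size + 1000 * (R.size * Q.length) := by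
        refine hk.trans ?_
        have e : 1000 * R.size * (Q.length + 1) = 1000 * (R.size * Q.length) + 1000 * R.size := by
          ring
        split_ifs <;> omega
      have h4 : (k : ℝ) ≤ 105 + 1200 * R.size + 1000 * (R.size * Q.length) := by
        exact_mod_cast h3
      linarith
    · push_cast
      linarith
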